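/- **Theorem 1.** Consider $n\ge 1$ agents and $m\ge 0$ indivisible chores with additive costs, where agent $i$ has cost $c_{ij}$ for chore $j$, and suppose the instance is bivalued: there are real numbers $a,b>0$ with $c_{ij}\in\{a,b\}$ for all $i,j$. Write $c_i(S)=\sum_{j\in S}c_{ij}$. Then there is an allocation (a partition of the chores into bundles $\mathbf x_1,\dots,\mathbf x_n$, possibly empty) that is * EF1 (envy-free up to one chore): for all agents $i,h$, either $\mathbf x_i=\emptyset$ or there is $j\in \mathbf x_i$ with $c_i(\mathbf x_i\setminus\{j\})\le c_i(\mathbf x_h)$; and * fPO (fractionally Pareto-optimal): there is no $y\in[0,1]^{n\times m}$ with $\sum_i y_{ij}=1$ for every chore $j$ such that $\sum_j c_{ij}y_{ij}\le c_i(\mathbf x_i)$ for all agents $i$, with strict inequality for at least one agent. Moreover, there are prices $p_j>0$ such that $(\mathbf x,p)$ is on minimum bang-per-buck, i.e. $c_{ij}/p_j=\min_{j'}c_{ij'}/p_{j'}$ whenever $j\in\mathbf x_i$, and price-EF1, i.e. for all agents $i,h$, either $\mathbf x_i=\emptyset$ or there is $j\in\mathbf x_i$ with $\sum_{l\in \mathbf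 x_i\setminus\{j\}}p_l\le\sum_{l\in\mathbf x_h}p_l$. Such an allocation can be computed in strongly polynomial time: there is a single random access machine program (unit-cost arithmetic $+,-,\times,\div$ and comparisons on real numbers; addition, truncated subtraction, comparison and addressing on natural-number indices) that, given $n$, $m$ and the costs $c_{ij}$ of any such instance, outputs such an allocation after a number of steps that is polynomial in $n$ and $m$; and if all $c_{ij}$ are rational, then every number computed on the way is a rational number whose bit length is polynomial in the encoding length of the instance. -/

import Mathlib

/-! ## Indivisible chores: allocations, fairness, efficiency, prices

An instance with `n` agents and `m` chores is a cost matrix `c : Fin n → Fin m → ℝ`; the additive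
cost of a bundle `S` to agent `i` is `∑ j ∈ S, c i j`. -/

/-- A family of bundles is an allocation if it partitions the chores: every chore lies in exactly
one bundle (bundles may be empty). -/
def IsAllocation {n m : ℕ} (x : Fin n → Finset (Fin m)) : Prop :=
  ∀ j, ∃! i, j ∈ x i

/-- Envy-freeness up to one chore. An agent without chores envies nobody. -/
def EF1 {n m : ℕ} (c : Fin n → Fin m → ℝ) (x : Fin n → Finset (Fin m)) : Prop :=
  ∀ i h, x i = ∅ ∨ ∃ j ∈ x i, ∑ l ∈ (x i).erase j, c i l ≤ ∑ l ∈ x h, c i l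

/-- A fractional allocation: `y i j` is the fraction of chore `j` given to agent `i`. -/
def IsFracAllocation {n m : ℕ} (y : Fin n → Fin m → ℝ) : Prop :=
  (∀ i j, 0 ≤ y i j ∧ y i j ≤ 1) ∧ ∀ j, ∑ i, y i j = 1

/-- Fractional Pareto-optimality: no fractional allocation costs every agent at most as much as
the bundle she has, and some agent strictly less. -/
def FPO {n m : ℕ} (c : Fin n → Fin m → ℝ) (x : Fin n → Finset (Fin m)) : Prop :=
  ¬ ∃ y : Fin n → Fin m → ℝ, IsFracAllocation y ∧
    (∀ i, ∑ j, c i j * y i j ≤ ∑ j ∈ x i, c i j) ∧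
    ∃ h, ∑ j, c h j * y h j < ∑ j ∈ x h, c h j

/-- The set of chores with minimum bang-per-buck ratio `c i j / p j` for agent `i`. -/
def mBB {n m : ℕ} (c : Fin n → Fin m → ℝ) (p : Fin m → ℝ) (i : Fin n) : Set (Fin m) :=
  {j | ∀ j', c i j / p j ≤ c i j' / p j'}

/-- Agents only receive chores of minimum bang-per-buck. -/
def OnMBB {n m : ℕ} (c : Fin n → Fin m → ℝ) (x : Fin n → Finset (Fin m)) (p : Fin m → ℝ) : Prop :=
  ∀ i, ∀ j ∈ x i, j ∈ mBB c p i

/-- Price envy-freeness up to one chore. -/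
def PEF1 {n m : ℕ} (x : Fin n → Finset (Fin m)) (p : Fin m → ℝ) : Prop :=
  ∀ i h, x i = ∅ ∨ ∃ j ∈ x i, ∑ l ∈ (x i).erase j, p l ≤ ∑ l ∈ x h, p l

/-! ## A random access machine with exact arithmetic

The machine has two kinds of memory, both random access and organized in two-dimensional arrays
`A[i, j]` (array name, row and column are natural numbers, a program names its arrays by
constants): index cells hold natural numbers, which can be compared, added and subtracted (cut off
at `0`) and used as addresses; number cells hold real numbers, which can be compared, added,
subtracted, multiplied and divided. Nothing turns the contents of a number cell into an index except
the outcome of a comparison. Programs are structured (sequence, branch, loop) and finite, and one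
program serves all input sizes. All elementary operations have unit cost. As index arithmetic has no
multiplication, the indices occurring in the first `t` steps have `O(t)` more bits than the initial
ones. -/

/-- Memory contents. A cell `A[i, j]` is addressed by the triple `(A, i, j)`. -/
structure State where
  idx : ℕ × ℕ × ℕ → ℕ
  num : ℕ × ℕ × ℕ → ℝ

/-- Index expressions. -/
inductive IExpr where
  | const (k : ℕ)
  | read (A : ℕ) (i j : IExpr)
  | add (e f : IExpr)
  | sub (e f : IExpr)

/-- Value of an index expression. -/
def IExpr.eval (s : State) : IExpr → ℕ
  | .const k => k
  | .read A i j => s.idx (A, i.eval s, j.eval s)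
  | .add e f => e.eval s + f.eval s
  | .sub e f => e.eval s - f.eval s

/-- Cost of an index expression: one step for every node. -/
def IExpr.cost : IExpr → ℕ
  | .const _ => 1
  | .read _ i j => 1 + i.cost + j.cost
  | .add e f => 1 + e.cost + f.cost
  | .sub e f => 1 + e.cost + f.cost

/-- A cell `A[row, col]` whose row and column are computed by index expressions. -/
structure Cell where
  A : ℕ
  row : IExpr
  col : IExpr

/-- The address of a cell. -/
def Cell.addr (s : State) (r : Cell) : ℕ × ℕ × ℕ := (r.A, r.row.eval s, r.col.eval s)

/-- Cost of addressing a cell. -/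
def Cell.cost (r : Cell) : ℕ := 1 + r.row.cost + r.col.cost

/-- A single arithmetic operation on number cells, or an integer constant, or a copy. -/
inductive NumOp where
  | const (z : ℤ)
  | copy (u : Cell)
  | add (u v : Cell)
  | sub (u v : Cell)
  | mul (u v : Cell)
  | div (u v : Cell)

/-- `op.Result s y`: in state `s` the operation is defined and has the result `y`.
Division by zero has no result. -/
def NumOp.Result (s : State) (y : ℝ) : NumOp → Prop
  | .const z => y = z
  | .copy u => y = s.num (u.addr s)
  | .add u v => y = s.num (u.addr s) + s.num (v.addr s)
  | .sub u v => y = s.num (u.addr s) - s.num (v.addr s)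
  | .mul u v => y = s.num (u.addr s) * s.num (v.addr s)
  | .div u v => s.num (v.addr s) ≠ 0 ∧ y = s.num (u.addr s) / s.num (v.addr s)

/-- Cost of an arithmetic operation, addressing included. -/
def NumOp.cost : NumOp → ℕ
  | .const _ => 1
  | .copy u => 1 + u.cost
  | .add u v => 1 + u.cost + v.cost
  | .sub u v => 1 + u.cost + v.cost
  | .mul u v => 1 + u.cost + v.cost
  | .div u v => 1 + u.cost + v.cost

/-- Tests: comparisons of indices and of numbers, and their Boolean combinations. -/
inductive Test where
  | leIdx (e f : IExpr)
  | leNum (u v : Cell)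
  | neg (b : Test)
  | conj (b d : Test)

/-- Truth of a test. -/
def Test.Holds (s : State) : Test → Prop
  | .leIdx e f => e.eval s ≤ f.eval s
  | .leNum u v => s.num (u.addr s) ≤ s.num (v.addr s)
  | .neg b => ¬ b.Holds s
  | .conj b d => b.Holds s ∧ d.Holds s

/-- Cost of a test. -/
def Test.cost : Test → ℕ
  | .leIdx e f => 1 + e.cost + f.cost
  | .leNum u v => 1 + u.cost + v.cost
  | .neg b => 1 + b.cost
  | .conj b d => 1 + b.cost + d.cost

/-- Programs. -/
inductive Prog where
  | setIdx (r : Cell) (e : IExpr)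
  | setNum (r : Cell) (op : NumOp)
  | seq (P Q : Prog)
  | branch (b : Test) (P Q : Prog)
  | loop (b : Test) (P : Prog)

/-- `Exec P s t L s'`: started in state `s`, the program `P` halts in state `s'` after exactly `t`
steps, and `L` lists the results of all arithmetic operations on numbers that it performs. -/
inductive Exec : Prog → State → ℕ → List ℝ → State → Prop where
  | setIdx (r : Cell) (e : IExpr) (s : State) :
      Exec (.setIdx r e) s (r.cost + e.cost) []
        { s with idx := Function.update s.idx (r.addr s) (e.eval s) }
  | setNum (r : Cell) (op : NumOp) (s : State) (y : ℝ) (hy : op.Result s y) :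
      Exec (.setNum r op) s (r.cost + op.cost) [y]
        { s with num := Function.update s.num (r.addr s) y }
  | seq {P Q : Prog} {s s₁ s₂ : State} {t₁ t₂ : ℕ} {L₁ L₂ : List ℝ}
      (h₁ : Exec P s t₁ L₁ s₁) (h₂ : Exec Q s₁ t₂ L₂ s₂) :
      Exec (.seq P Q) s (t₁ + t₂) (L₁ ++ L₂) s₂
  | branchTrue {b : Test} {P Q : Prog} {s s₁ : State} {t : ℕ} {L : List ℝ}
      (hb : b.Holds s) (h : Exec P s t L s₁) : Exec (.branch b P Q) s (b.cost + t) L s₁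
  | branchFalse {b : Test} {P Q : Prog} {s s₁ : State} {t : ℕ} {L : List ℝ}
      (hb : ¬ b.Holds s) (h : Exec Q s t L s₁) : Exec (.branch b P Q) s (b.cost + t) L s₁
  | loopTrue {b : Test} {P : Prog} {s s₁ s₂ : State} {t₁ t₂ : ℕ} {L₁ L₂ : List ℝ}
      (hb : b.Holds s) (h₁ : Exec P s t₁ L₁ s₁) (h₂ : Exec (.loop b P) s₁ t₂ L₂ s₂) :
      Exec (.loop b P) s (b.cost + t₁ + t₂) (L₁ ++ L₂) s₂
  | loopFalse {b : Test} {P : Prog} {s : State} (hb : ¬ b.Holds s) :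
      Exec (.loop b P) s b.cost [] s

/-- The initial memory for an instance: the index cells `0[0, 0]` and `0[0, 1]` hold `n` and `m`,
the number cell `0[i, j]` holds `c i j`, and all other cells hold `0`. -/
noncomputable def inputState {n m : ℕ} (c : Fin n → Fin m → ℝ) : State where
  idx z := if z = (0, 0, 0) then n else if z = (0, 0, 1) then m else 0
  num z := if h : z.1 = 0 ∧ z.2.1 < n ∧ z.2.2 < m then c ⟨z.2.1, h.2.1⟩ ⟨z.2.2, h.2.2⟩ else 0

/-- The family of bundles read off the final memory: the index cell `1[0, j]` holds the agent who
receives chore `j`. -/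
def outputBundles (n m : ℕ) (s : State) : Fin n → Finset (Fin m) :=
  fun i => Finset.univ.filter fun j => s.idx (1, 0, (j : ℕ)) = i

/-- Number of bits of a rational number: numerator, denominator and sign. -/
def ratBits (q : ℚ) : ℕ := q.num.natAbs.size + q.den.size + 1

/-- Encoding length of a rational instance. -/
def instBits {n m : ℕ} (q : Fin n → Fin m → ℚ) : ℕ := n + m + ∑ i, ∑ j, ratBits (q i j)

/-! Let a ≤ b be the lowest and the highest cost. A chore is easy for an agent who has no cheaper
one, and `U` is the set of chores that are easy for nobody. All prices will be a or b. Positive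
prices on minimum bang-per-buck give fPO, because a dominating fractional allocation would lower the
total price (`fpo_of_onMBB`), and they turn price-EF1 into EF1 (`ef1_of_pef1`). What remains is to
find such prices with price-EF1.

The chores outside `U` go to agents who find them easy, balanced along paths: the number of chores
of an agent exceeds that of any agent reachable from her by at most one. For a threshold τ, let `C`
consist of the agents with at least τ of these chores and everybody reachable from them. The chores
in `U` and those of agents in `C` are raised to price b; the others cost a. Nobody outside `C` finds
a raised chore easy, so outsiders may own any raised chore and members of `C` the easy ones without
leaving minimum bang-per-buck (`IsStage.onMBB`). The raised chores are then balanced again, along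
paths of permitted transfers.

The threshold descends from m + 2, where `C` is empty. The invariant is `Settled`: owners of raised
chores envy nobody up to one chore. If a settled stage of threshold τ + 1 still has envy, the envier
owns low-priced chores only, at most τ of them, so somebody earns less than a(τ - 1)
(`IsStage.load_lt_of_violation`). Hence some agent stays outside the next `C` and can take `U`
(`IsStage.exists_cnt_lt`), and the next stage is settled too. This is the heart of the matter
(`IsStage.settled_of_violation`): if an owner i of a raised chore envied e there, every agent
reachable from i would own at least as many newly raised chores as before, and i strictly more,
although all these chores already belonged to agents reachable from i. Envy forces τ ≥ 2
(`two_le_of_load_lt`), so the descent ends without envy.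

The step count does not depend on the size of the costs: transfers are counted by a potential made
of ranks of heights (`potential_lt`). Every computed number is u·a + v·b with u, v ≤ m + 1 (`Good`),
which bounds the bit lengths. -/

namespace BivaluedChores

/-! ## Fairness and efficiency from prices -/

section Prices

variable {n m : ℕ}

/-- The bundles given by an owner for every chore. -/
def bundles (o : Fin m → Fin n) (i : Fin n) : Finset (Fin m) :=
  Finset.univ.filter fun j => o j = i

theorem isAllocation_bundles (o : Fin m → Fin n) : IsAllocation (bundles o) := by
  intro j
  exact ⟨o j, by simp [bundles], fun i hi => by simpa [bundles, eq_comm] using hi⟩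

/-- The minimum ratio of the agent serves as r: scaled by r, prices bound her costs from below and
are exact on her own bundle. Only these two facts are used for fairness and efficiency. -/
theorem exists_ratio {c : Fin n → Fin m → ℝ} {p : Fin m → ℝ} {x : Fin n → Finset (Fin m)}
    (hc : ∀ i j, 0 < c i j) (hp : ∀ j, 0 < p j) (h : OnMBB c x p) (i : Fin n) :
    ∃ r : ℝ, 0 < r ∧ (∀ l, r * p l ≤ c i l) ∧ ∀ l ∈ x i, c i l = r * p l := by
  rcases isEmpty_or_nonempty (Fin m) with he | hne
  · exact ⟨1, one_pos, fun l => he.elim l, fun l => he.elim l⟩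
  · obtain ⟨j, hj⟩ := Finite.exists_min fun j => c i j / p j
    refine ⟨c i j / p j, div_pos (hc i j) (hp j), fun l => ?_, fun l hl => ?_⟩
    · exact (le_div_iff₀ (hp l)).1 (hj l)
    · exact (div_eq_iff (hp l).ne').1 (le_antisymm (h i l hl j) (hj l))

theorem ef1_of_pef1 {c : Fin n → Fin m → ℝ} {p : Fin m → ℝ} {x : Fin n → Finset (Fin m)}
    (hc : ∀ i j, 0 < c i j) (hp : ∀ j, 0 < p j) (h : OnMBB c x p) (hx : PEF1 x p) : EF1 c x := by
  intro i k
  obtain ⟨r, hr, hle, heq⟩ := exists_ratio hc hp h i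
  refine (hx i k).imp_right ?_
  rintro ⟨j, hj, hjk⟩
  refine ⟨j, hj, ?_⟩
  calc ∑ l ∈ (x i).erase j, c i l = r * ∑ l ∈ (x i).erase j, p l := by
        rw [Finset.mul_sum]
        exact Finset.sum_congr rfl fun l hl => heq l (Finset.mem_of_mem_erase hl)
    _ ≤ r * ∑ l ∈ x k, p l := by gcongr
    _ ≤ ∑ l ∈ x k, c i l := by
        rw [Finset.mul_sum]
        exact Finset.sum_le_sum fun l _ => hle l

/-- A weak (strict) improvement in cost is a weak (strict) decrease in the price of the agent's
share. Summed over the agents, both allocations distribute exactly the total price of all chores, so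
no strict decrease is possible. -/
theorem fpo_of_onMBB {c : Fin n → Fin m → ℝ} {p : Fin m → ℝ} {o : Fin m → Fin n}
    (hc : ∀ i j, 0 < c i j) (hp : ∀ j, 0 < p j) (h : OnMBB c (bundles o) p) :
    FPO c (bundles o) := by
  rintro ⟨y, ⟨hy, hy1⟩, hle, k, hk⟩
  have key : ∀ i, (∑ j, c i j * y i j ≤ ∑ j ∈ bundles o i, c i j →
      ∑ j, p j * y i j ≤ ∑ j ∈ bundles o i, p j) ∧
      (∑ j, c i j * y i j < ∑ j ∈ bundles o i, c i j →
      ∑ j, p j * y i j < ∑ j ∈ bundles o i, p j) := by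
    intro i
    obtain ⟨r, hr, h1, h2⟩ := exists_ratio hc hp h i
    have e1 : r * ∑ j, p j * y i j ≤ ∑ j, c i j * y i j := by
      rw [Finset.mul_sum]
      refine Finset.sum_le_sum fun j _ => ?_
      rw [← mul_assoc]
      exact mul_le_mul_of_nonneg_right (h1 j) (hy i j).1
    have e2 : ∑ j ∈ bundles o i, c i j = r * ∑ j ∈ bundles o i, p j := by
      rw [Finset.mul_sum]
      exact Finset.sum_congr rfl h2
    rw [e2]
    exact ⟨fun hh => le_of_mul_le_mul_left (e1.trans hh) hr,
      fun hh => lt_of_mul_lt_mul_left (e1.trans_lt hh) hr.le⟩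
  have hlt : ∑ i, ∑ j, p j * y i j < ∑ i, ∑ j ∈ bundles o i, p j :=
    Finset.sum_lt_sum (fun i _ => (key i).1 (hle i)) ⟨k, Finset.mem_univ _, (key k).2 hk⟩
  rw [Finset.sum_comm] at hlt
  simp only [← Finset.mul_sum, hy1, mul_one] at hlt
  unfold bundles at hlt
  rw [Finset.sum_fiberwise] at hlt
  exact lt_irrefl _ hlt

end Prices

/-! ## Counts, loads and reachability -/

section Stages

open Classical in
/-- The number of chores from `S` owned by `i`. -/
noncomputable def cnt {n m : ℕ} (o : Fin m → Fin n) (S : Set (Fin m)) (i : Fin n) : ℕ :=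
  (Finset.univ.filter fun j => o j = i ∧ j ∈ S).card

/-- Agent `i` can hand a chore from `H` to agent `e`, for whom it is allowed. -/
def Link {n m : ℕ} (o : Fin m → Fin n) (H : Set (Fin m)) (al : Fin n → Fin m → Prop)
    (i e : Fin n) : Prop :=
  ∃ j ∈ H, o j = i ∧ al e j

/-- The earning of an agent when chores in `H` have price `b` and the others price `β`. -/
noncomputable def load {n m : ℕ} (β b : ℝ) (o : Fin m → Fin n) (H : Set (Fin m)) (i : Fin n) : ℝ :=
  b * cnt o H i + β * cnt o Hᶜ i

open Classical in
/-- The highest price of a chore of `i` (`β` if there is none). -/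
noncomputable def top {n m : ℕ} (β b : ℝ) (o : Fin m → Fin n) (H : Set (Fin m)) (i : Fin n) : ℝ :=
  if ∃ j ∈ H, o j = i then b else β

/-- No agent envies, up to one chore, an agent to whom a chore can be passed along a path. -/
def Balanced {n m : ℕ} (β b : ℝ) (o : Fin m → Fin n) (H : Set (Fin m))
    (al : Fin n → Fin m → Prop) : Prop :=
  ∀ i e, Relation.ReflTransGen (Link o H al) i e → load β b o H i ≤ load β b o H e + top β b o H i

variable {n m : ℕ}

theorem cnt_pos {o : Fin m → Fin n} {S : Set (Fin m)} {i : Fin n} :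
    0 < cnt o S i ↔ ∃ j ∈ S, o j = i := by
  classical
  simp only [cnt, Finset.card_pos, Finset.Nonempty, Finset.mem_filter, Finset.mem_univ, true_and]
  exact ⟨fun ⟨j, h⟩ => ⟨j, h.2, h.1⟩, fun ⟨j, h⟩ => ⟨j, h.2, h.1⟩⟩

theorem cnt_congr {o o' : Fin m → Fin n} {S S' : Set (Fin m)} {i : Fin n}
    (h : ∀ j, o j = i ∧ j ∈ S ↔ o' j = i ∧ j ∈ S') : cnt o S i = cnt o' S' i := by
  classical
  simp only [cnt, h]

theorem cnt_le (o : Fin m → Fin n) (S : Set (Fin m)) (i : Fin n) : cnt o S i ≤ m := by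
  classical
  exact (Finset.card_le_univ _).trans (by simp)

theorem top_of_mem {β b : ℝ} {o : Fin m → Fin n} {H : Set (Fin m)} {i : Fin n}
    (h : ∃ j ∈ H, o j = i) : top β b o H i = b := by
  simp only [top, if_pos h]

theorem top_of_not {β b : ℝ} {o : Fin m → Fin n} {H : Set (Fin m)} {i : Fin n}
    (h : ¬ ∃ j ∈ H, o j = i) : top β b o H i = β := by
  simp only [top, if_neg h]

theorem top_eq (β b : ℝ) (o : Fin m → Fin n) (H : Set (Fin m)) (i : Fin n) :
    top β b o H i = if 0 < cnt o H i then b else β := by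
  by_cases h : 0 < cnt o H i
  · rw [if_pos h, top_of_mem (cnt_pos.1 h)]
  · rw [if_neg h, top_of_not fun hh => h (cnt_pos.2 hh)]

/-- If the agents in `R` own, together, no more chores under `(o, S)` than under `(o', S')`, then
they cannot all own at least as many and one of them more. -/
theorem not_forall_cnt_le {o o' : Fin m → Fin n} {S S' : Set (Fin m)} {R : Set (Fin n)}
    (hsub : ∀ j ∈ S, o j ∈ R → j ∈ S' ∧ o' j ∈ R)
    (hle : ∀ f ∈ R, cnt o' S' f ≤ cnt o S f) {i : Fin n} (hi : i ∈ R)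
    (hlt : cnt o' S' i < cnt o S i) : False := by
  classical
  -- Double counting: grouping the chores of S owned within R by their owners.
  have hs : ∀ (o : Fin m → Fin n) (S : Set (Fin m)), ∑ f ∈ Finset.univ.filter (· ∈ R), cnt o S f =
      (Finset.univ.filter fun j => j ∈ S ∧ o j ∈ R).card := by
    intro o S
    rw [Finset.card_eq_sum_card_fiberwise (f := o) (t := Finset.univ.filter (· ∈ R))]
    · refine Finset.sum_congr rfl fun f hf => ?_
      simp only [Finset.mem_filter, Finset.mem_univ, true_and] at hf
      rw [cnt, Finset.filter_filter]
      congr 1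
      ext j
      simp only [Finset.mem_filter, Finset.mem_univ, true_and]
      constructor
      · rintro ⟨rfl, h⟩
        exact ⟨⟨h, hf⟩, rfl⟩
      · rintro ⟨⟨h, -⟩, h'⟩
        exact ⟨h', h⟩
    · intro j hj
      simp only [Finset.coe_filter, Finset.mem_univ, true_and, Set.mem_ofPred_eq] at hj ⊢
      exact hj.2
  have h1 : ∑ f ∈ Finset.univ.filter (· ∈ R), cnt o' S' f <
      ∑ f ∈ Finset.univ.filter (· ∈ R), cnt o S f :=
    Finset.sum_lt_sum (fun f hf => hle f (by simpa using hf)) ⟨i, by simpa using hi, hlt⟩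
  rw [hs, hs] at h1
  refine absurd (Finset.card_le_card ?_) h1.not_ge
  intro j hj
  simp only [Finset.mem_filter, Finset.mem_univ, true_and] at hj ⊢
  exact hsub j hj.1 hj.2

/-! ## Raising the prices of the chores of heavily loaded agents -/

/-- The chores of high price when the agents in `C` are raised: the chores in `U` (difficult for
everybody) and those that belong to agents in `C`. -/
def raised (U : Set (Fin m)) (o₀ : Fin m → Fin n) (C : Set (Fin n)) : Set (Fin m) :=
  {j | j ∈ U ∨ o₀ j ∈ C}

/-- The chores of high price that an agent may own. -/
def Allowed (low : Fin n → Fin m → Prop) (C : Set (Fin n)) (e : Fin n) (j : Fin m) : Prop :=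
  e ∉ C ∨ low e j

/-- `C` consists of the agents with at least `τ` chores and of agents with `τ - 1` chores, and
nobody outside `C` finds a chore of `C` easy. -/
structure IsLayer (low : Fin n → Fin m → Prop) (U : Set (Fin m)) (o₀ : Fin m → Fin n) (τ : ℕ)
    (C : Set (Fin n)) : Prop where
  mem : ∀ i, τ ≤ cnt o₀ Uᶜ i → i ∈ C
  closed : ∀ j ∉ U, o₀ j ∈ C → ∀ e, low e j → e ∈ C
  le : ∀ i ∈ C, τ ≤ cnt o₀ Uᶜ i + 1

/-- A balanced reallocation of the chores of high price. -/
structure IsStage (low : Fin n → Fin m → Prop) (U : Set (Fin m)) (o₀ : Fin m → Fin n) (a b : ℝ)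
    (C : Set (Fin n)) (o : Fin m → Fin n) : Prop where
  fixed : ∀ j ∉ raised U o₀ C, o j = o₀ j
  allowed : ∀ j ∈ raised U o₀ C, Allowed low C (o j) j
  balanced : Balanced a b o (raised U o₀ C) (Allowed low C)

/-- Owners of chores of high price envy nobody up to one chore. -/
def Settled (a b : ℝ) (o : Fin m → Fin n) (H : Set (Fin m)) : Prop :=
  ∀ i e, (∃ j ∈ H, o j = i) → load a b o H i ≤ load a b o H e + b

variable {low : Fin n → Fin m → Prop} {U : Set (Fin m)} {o₀ : Fin m → Fin n} {a b : ℝ}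

/-! ### Earnings in a stage, and what envy in a settled stage implies -/

namespace IsStage

variable {C : Set (Fin n)} {o : Fin m → Fin n}

theorem cnt_compl_of_mem (h : IsStage low U o₀ a b C o) {f : Fin n} (hf : f ∈ C) :
    cnt o (raised U o₀ C)ᶜ f = 0 := by
  by_contra hne
  obtain ⟨j, hj, hjf⟩ := cnt_pos.1 (Nat.pos_of_ne_zero hne)
  refine hj (Or.inr ?_)
  rw [← h.fixed j hj, hjf]
  exact hf

theorem cnt_compl_of_not_mem (h : IsStage low U o₀ a b C o) {f : Fin n} (hf : f ∉ C) :
    cnt o (raised U o₀ C)ᶜ f = cnt o₀ Uᶜ f := by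
  refine cnt_congr fun j => ⟨?_, ?_⟩
  · rintro ⟨hj, hjH⟩
    exact ⟨by rw [← h.fixed j hjH, hj], fun hu => hjH (Or.inl hu)⟩
  · rintro ⟨hj, hjU⟩
    have : j ∉ raised U o₀ C := fun hh => hh.elim hjU fun hh => hf (hj ▸ hh)
    exact ⟨by rw [h.fixed j this, hj], this⟩

theorem load_of_mem (h : IsStage low U o₀ a b C o) {f : Fin n} (hf : f ∈ C) :
    load a b o (raised U o₀ C) f = b * cnt o (raised U o₀ C) f := by
  simp [load, h.cnt_compl_of_mem hf]

theorem load_of_not_mem (h : IsStage low U o₀ a b C o) {f : Fin n} (hf : f ∉ C) :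
    load a b o (raised U o₀ C) f = b * cnt o (raised U o₀ C) f + a * cnt o₀ Uᶜ f := by
  simp [load, h.cnt_compl_of_not_mem hf]

/-- Every agent may own every raised chore, so everybody is one link away from any owner and balance
applies directly. This starts the induction over thresholds. -/
theorem settled_of_empty (h : IsStage low U o₀ a b C o) (hC : ∀ i, i ∉ C) :
    Settled a b o (raised U o₀ C) := by
  rintro i e ⟨j, hj, hji⟩
  have := h.balanced i e (.single ⟨j, hj, hji, Or.inl (hC e)⟩)
  rwa [top_of_mem ⟨j, hj, hji⟩] at this

/-- In a settled stage with envy, some agent earns little. -/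
theorem load_lt_of_violation (h : IsStage low U o₀ a b C o) {τ : ℕ}
    (hC : IsLayer low U o₀ (τ + 1) C) (ha : 0 < a) (hab : a ≤ b)
    (hs : Settled a b o (raised U o₀ C)) {i e : Fin n}
    (hv : load a b o (raised U o₀ C) e + top a b o (raised U o₀ C) i <
      load a b o (raised U o₀ C) i) :
    load a b o (raised U o₀ C) e + a < a * τ := by
  by_cases hi : ∃ j ∈ raised U o₀ C, o j = i
  · rw [top_of_mem hi] at hv
    exact absurd (hs i e hi) hv.not_ge
  rw [top_of_not hi] at hv
  have h0 : cnt o (raised U o₀ C) i = 0 := by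
    by_contra hne
    exact hi (cnt_pos.1 (Nat.pos_of_ne_zero hne))
  have hpos : 0 ≤ load a b o (raised U o₀ C) e := by
    have := ha.le.trans hab
    unfold load
    positivity
  -- A member of `C` owns raised chores only, hence nothing here, and cannot envy. An outsider owns
  -- at most τ low-priced chores, since τ + 1 of them would have put her into `C`.
  by_cases hiC : i ∈ C
  · rw [h.load_of_mem hiC, h0] at hv
    simp only [Nat.cast_zero, mul_zero] at hv
    linarith
  · rw [h.load_of_not_mem hiC, h0] at hv
    have : cnt o₀ Uᶜ i ≤ τ := by
      by_contra hlt
      exact hiC (hC.mem i (by omega))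
    have : (cnt o₀ Uᶜ i : ℝ) ≤ τ := by exact_mod_cast this
    have := mul_le_mul_of_nonneg_left this ha.le
    simp only [Nat.cast_zero, mul_zero] at hv
    linarith

end IsStage

/-- Earnings are nonnegative. This is what stops the descent of the threshold. -/
theorem two_le_of_load_lt {o : Fin m → Fin n} {H : Set (Fin m)} {e : Fin n} {τ : ℕ} (ha : 0 < a)
    (hab : a ≤ b) (hv : load a b o H e + a < a * τ) : 2 ≤ τ := by
  have hpos : 0 ≤ load a b o H e := by
    have := ha.le.trans hab
    unfold load
    positivity
  have h1 : a * 1 < a * τ := by linarith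
  have h2 : (1 : ℝ) < τ := lt_of_mul_lt_mul_left h1 ha.le
  exact_mod_cast h2

/-! ### From one settled stage to the next -/

namespace IsStage

variable {C C' : Set (Fin n)} {o o' : Fin m → Fin n} {τ : ℕ} {e' : Fin n}

/-- Being settled towards the poor agent e' gives b·cnt ≤ load e' + b < a(τ - 1) + b ≤ bτ. -/
theorem cnt_lt_of_mem (h : IsStage low U o₀ a b C' o') (ha : 0 < a) (hab : a ≤ b)
    (hs : Settled a b o' (raised U o₀ C'))
    (hv : load a b o' (raised U o₀ C') e' + a < a * τ) {f : Fin n} (hf : f ∈ C') :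
    cnt o' (raised U o₀ C') f < τ := by
  have hτ := two_le_of_load_lt ha hab hv
  rcases Nat.eq_zero_or_pos (cnt o' (raised U o₀ C') f) with h0 | h0
  · omega
  · have h1 := hs f e' (cnt_pos.1 h0)
    rw [h.load_of_mem hf] at h1
    have hτ' : (2 : ℝ) ≤ τ := by exact_mod_cast hτ
    have h2 : b * (cnt o' (raised U o₀ C') f : ℝ) < b * τ := by nlinarith
    have h3 := lt_of_mul_lt_mul_left h2 (ha.le.trans hab)
    exact_mod_cast h3

/-- The same comparison with e', keeping the low-priced chores that an outsider still owns. -/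
theorem load_lt_of_not_mem (h : IsStage low U o₀ a b C' o')
    (hs : Settled a b o' (raised U o₀ C'))
    (hv : load a b o' (raised U o₀ C') e' + a < a * τ) {f : Fin n} (hf : f ∉ C')
    (h0 : 0 < cnt o' (raised U o₀ C') f) :
    b * cnt o' (raised U o₀ C') f + a * cnt o₀ Uᶜ f + a < a * τ + b := by
  have h1 := hs f e' (cnt_pos.1 h0)
  rw [h.load_of_not_mem hf] at h1
  linarith

/-- After envy in a settled stage some agent has too few chores to be raised next. -/
theorem exists_cnt_lt (h : IsStage low U o₀ a b C' o') (hC : IsLayer low U o₀ (τ + 1) C')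
    (ha : 0 < a) (hab : a ≤ b) (hs : Settled a b o' (raised U o₀ C'))
    (hv : load a b o' (raised U o₀ C') e' + a < a * τ) :
    ∃ z, cnt o₀ Uᶜ z + 1 < τ := by
  by_contra! hno
  have hτ := two_le_of_load_lt ha hab hv
  have hb : 0 < b := ha.trans_le hab
  have hno' : ∀ z, a * τ ≤ a * cnt o₀ Uᶜ z + a := by
    intro z
    have : (τ : ℝ) ≤ cnt o₀ Uᶜ z + 1 := by exact_mod_cast hno z
    nlinarith
  -- If every agent had at least τ - 1 chores initially, an outsider would earn at least a(τ - 1),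
  -- too much for e'. For the same reason no outsider owns a raised chore.
  have he : e' ∈ C' := by
    by_contra he
    rw [h.load_of_not_mem he] at hv
    have : (0 : ℝ) ≤ b * cnt o' (raised U o₀ C') e' := by positivity
    linarith [hno' e']
  have hz : ∀ f ∉ C', cnt o' (raised U o₀ C') f = 0 := by
    intro f hf
    by_contra hne
    have h0 := Nat.pos_of_ne_zero hne
    have h1 := h.load_lt_of_not_mem hs hv hf h0
    have h2 : (1 : ℝ) ≤ cnt o' (raised U o₀ C') f := by exact_mod_cast h0
    have h3 := mul_le_mul_of_nonneg_left h2 hb.le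
    linarith [hno' f]
  have hlt : ∀ f ∈ C', cnt o' (raised U o₀ C') f < cnt o₀ Uᶜ f := by
    intro f hf
    have := h.cnt_lt_of_mem ha hab hs hv hf
    have := hC.le f hf
    omega
  -- So the initial chores of C' are all still inside C', while each member of C' owns fewer raised
  -- chores than she had initially.
  refine not_forall_cnt_le (o := o₀) (S := Uᶜ) (o' := o') (S' := raised U o₀ C') (R := C') ?_
    (fun f hf => (hlt f hf).le) he (hlt e' he)
  intro j _ hj
  have hjH : j ∈ raised U o₀ C' := Or.inr hj
  refine ⟨hjH, ?_⟩
  by_contra hn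
  exact (cnt_pos.2 ⟨j, hjH, rfl⟩).ne (hz _ hn).symm

/-- Raising one layer more in a settled stage with envy leads to a settled stage. -/
theorem settled_of_violation (h₀ : ∀ j ∉ U, low (o₀ j) j) (ha : 0 < a) (hab : a ≤ b)
    (h' : IsStage low U o₀ a b C' o') (hC' : IsLayer low U o₀ (τ + 1) C')
    (hs : Settled a b o' (raised U o₀ C'))
    (hv : load a b o' (raised U o₀ C') e' + a < a * τ)
    (h : IsStage low U o₀ a b C o) (hC : IsLayer low U o₀ τ C) :
    Settled a b o (raised U o₀ C) := by
  intro i e hi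
  by_contra! hie
  have hτ := two_le_of_load_lt ha hab hv
  have hb : 0 < b := ha.trans_le hab
  have hCC : ∀ f ∈ C', f ∈ C := fun f hf => hC.mem f (by have := hC'.le f hf; omega)
  set H := raised U o₀ C with hH
  set H' := raised U o₀ C' with hH'
  have hHH : ∀ j ∈ H', j ∈ H := fun j hj => hj.imp id (hCC _)
  let G := Link o H (Allowed low C)
  have hiH := hi
  obtain ⟨ji, hji, hjio⟩ := hi
  -- An outsider may own any raised chore, so i reaches every outsider in one step.
  have hout : ∀ f, ¬ Relation.ReflTransGen G i f → f ∈ C := by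
    intro f hf
    by_contra hfC
    exact hf (.single ⟨ji, hji, hjio, Or.inl hfC⟩)
  have hei : ¬ Relation.ReflTransGen G i e := by
    intro hr
    have := h.balanced i e hr
    rw [top_of_mem hiH] at this
    linarith
  have heC := hout e hei
  -- the envied agent owns at least `τ - 1` chores
  have hde : τ ≤ cnt o H e + 1 := by
    by_contra! hlt
    -- With the agents who reach e: by balance, none of them would own more raised chores than
    -- initially, and e fewer. But each initial chore of R is raised, and its present owner can
    -- return it to the initial owner, so she lies in R too.
    let R : Set (Fin n) := {f | Relation.ReflTransGen G f e}
    have hRC : ∀ f ∈ R, f ∈ C := fun f hf => hout f fun hr => hei (hr.trans hf)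
    have hle : ∀ f ∈ R, cnt o H f ≤ cnt o H e + 1 := by
      intro f hf
      rcases Nat.eq_zero_or_pos (cnt o H f) with h0 | h0
      · omega
      · have h1 := h.balanced f e hf
        rw [top_of_mem (cnt_pos.1 h0), h.load_of_mem (hRC f hf), h.load_of_mem heC] at h1
        have h2 : b * (cnt o H f : ℝ) ≤ b * ((cnt o H e + 1 : ℕ) : ℝ) := by
          push_cast; linarith
        exact_mod_cast le_of_mul_le_mul_left h2 hb
    refine not_forall_cnt_le (o := o₀) (S := Uᶜ) (o' := o) (S' := H) (R := R) ?_ ?_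
      (i := e) .refl ?_
    · intro j hjU hj
      have hjH : j ∈ H := Or.inr (hRC _ hj)
      exact ⟨hjH, .head ⟨j, hjH, rfl, Or.inr (h₀ j hjU)⟩ hj⟩
    · intro f hf
      have := hC.le f (hRC f hf)
      have := hle f hf
      omega
    · have := hC.le e heC
      omega
  have hde' : a * τ ≤ b * cnt o H e + a := by
    have h1 : (τ : ℝ) ≤ cnt o H e + 1 := by exact_mod_cast hde
    have h2 : (0 : ℝ) ≤ cnt o H e := by positivity
    nlinarith
  have hde'' : b * τ ≤ b * cnt o H e + b := by
    have h1 : (τ : ℝ) ≤ cnt o H e + 1 := by exact_mod_cast hde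
    nlinarith
  have hle := h.load_of_mem heC
  rw [← hH] at hle
  rw [hle] at hie
  -- counts before raising
  have hnew : ∀ f ∈ C, f ∉ C' → cnt o' H' f = 0 := by
    intro f hf hf'
    by_contra hne
    have h0 := Nat.pos_of_ne_zero hne
    have h1 := h'.load_lt_of_not_mem hs hv hf' h0
    have h2 : (1 : ℝ) ≤ cnt o' H' f := by exact_mod_cast h0
    have h3 : (τ : ℝ) ≤ cnt o₀ Uᶜ f + 1 := by exact_mod_cast hC.le f hf
    rw [← hH'] at h1
    nlinarith
  have hcC' : ∀ f ∈ C', cnt o' H f = cnt o' H' f := by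
    intro f hf
    refine cnt_congr fun j => ⟨fun hj => ⟨hj.1, ?_⟩, fun hj => ⟨hj.1, hHH j hj.2⟩⟩
    by_contra hjH
    exact absurd (h'.cnt_compl_of_mem hf) (cnt_pos.2 ⟨j, hjH, hj.1⟩).ne'
  have hcD : ∀ f ∈ C, f ∉ C' → cnt o' H f = cnt o₀ Uᶜ f := by
    intro f hf hf'
    rw [← h'.cnt_compl_of_not_mem hf']
    refine cnt_congr fun j => ⟨fun hj => ⟨hj.1, fun hjH => ?_⟩, fun hj => ⟨hj.1, Or.inr ?_⟩⟩
    · exact absurd (hnew f hf hf') (cnt_pos.2 ⟨j, hjH, hj.1⟩).ne'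
    · rw [← h'.fixed j hj.2, hj.1]
      exact hf
  have hcN : ∀ f ∉ C, cnt o' H f = cnt o' H' f := by
    intro f hf
    refine cnt_congr fun j => ⟨fun hj => ⟨hj.1, ?_⟩, fun hj => ⟨hj.1, hHH j hj.2⟩⟩
    by_contra hjH
    rcases hj.2 with hu | hc
    · exact hjH (Or.inl hu)
    · rw [← h'.fixed j hjH, hj.1] at hc
      exact hf hc
  -- every agent reachable from `i` owns at least as many chores of high price as before
  have hbal : ∀ f, Relation.ReflTransGen G i f →
      load a b o H i ≤ load a b o H f + b := by
    intro f hf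
    have := h.balanced i f hf
    rwa [top_of_mem hiH] at this
  -- Members of `C` now own at least τ + k raised chores. Before, with the newly raised ones
  -- included, members of C' owned fewer than τ and new members at most τ. For outsiders, the old
  -- bound from e' and the lower bound on e combine to b(old + k) < b(new + 1). The case k = 0
  -- serves all reachable agents, k = 1 serves i.
  have hgrow : ∀ f (k : ℕ), b * (cnt o H e + k : ℝ) < load a b o H f →
      k ≤ cnt o H f → cnt o' H f + k ≤ cnt o H f := by
    intro f k hf hk
    by_cases hfC : f ∈ C
    · rw [hH, h.load_of_mem hfC, ← hH] at hf
      have h1 := lt_of_mul_lt_mul_left hf hb.le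
      have h2 : cnt o H e + k < cnt o H f := by exact_mod_cast h1
      by_cases hfC' : f ∈ C'
      · have := h'.cnt_lt_of_mem ha hab hs hv hfC'
        rw [← hH'] at this
        rw [hcC' f hfC']
        omega
      · rw [hcD f hfC hfC']
        have : cnt o₀ Uᶜ f ≤ τ := by
          by_contra hlt
          exact hfC' (hC'.mem f (by omega))
        omega
    · rw [hH, h.load_of_not_mem hfC, ← hH] at hf
      rw [hcN f hfC]
      rcases Nat.eq_zero_or_pos (cnt o' H' f) with h0 | h0
      · omega
      · have h1 := h'.load_lt_of_not_mem hs hv (fun hf' => hfC (hCC f hf')) h0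
        rw [← hH'] at h1
        have h2 : b * ((cnt o' H' f + k : ℕ) : ℝ) < b * ((cnt o H f + 1 : ℕ) : ℝ) := by
          push_cast
          linarith
        have h3 := lt_of_mul_lt_mul_left h2 hb.le
        have h4 : cnt o' H' f + k < cnt o H f + 1 := by exact_mod_cast h3
        omega
  refine not_forall_cnt_le (o := o) (S := H) (o' := o') (S' := H)
    (R := {f | Relation.ReflTransGen G i f}) ?_ ?_ (i := i) .refl ?_
  · intro j hjH hj
    refine ⟨hjH, ?_⟩
    by_contra hn
    -- An unreachable previous owner lies in `C` and found the chore easy, so the present owner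
    -- could hand it back and the previous owner would be reachable after all.
    refine hn (hj.tail ⟨j, hjH, rfl, Or.inr ?_⟩)
    have hC1 := hout _ hn
    by_cases hC2 : o' j ∈ C'
    · have hjH' : j ∈ H' := by
        by_contra hjH'
        exact absurd (h'.cnt_compl_of_mem hC2) (cnt_pos.2 ⟨j, hjH', rfl⟩).ne'
      exact (h'.allowed j hjH').resolve_left (fun hh => hh hC2)
    · have hjH' : j ∉ H' := fun hjH' =>
        absurd (hnew _ hC1 hC2) (cnt_pos.2 ⟨j, hjH', rfl⟩).ne'
      rw [h'.fixed j hjH']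
      exact h₀ j fun hu => hjH' (Or.inl hu)
  · intro f hf
    have := hbal f hf
    exact hgrow f 0 (by push_cast; linarith) (Nat.zero_le _)
  · refine hgrow i 1 ?_ (cnt_pos.2 hiH)
    push_cast
    linarith

end IsStage

end Stages

/-! ### From stages to prices on minimum bang-per-buck and price-EF1 -/

section StageConsequences

variable {n m : ℕ}

theorem load_eq_sum {β b : ℝ} (o : Fin m → Fin n) (H : Set (Fin m)) (p : Fin m → ℝ)
    (hb : ∀ j ∈ H, p j = b) (hβ : ∀ j ∉ H, p j = β) (i : Fin n) :
    ∑ j ∈ bundles o i, p j = load β b o H i := by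
  classical
  rw [← Finset.sum_filter_add_sum_filter_not _ (· ∈ H), load]
  congr 1
  · rw [Finset.sum_congr rfl fun j hj => hb j (Finset.mem_filter.1 hj).2, Finset.sum_const,
      nsmul_eq_mul, mul_comm, bundles, Finset.filter_filter]
    simp only [cnt]
  · rw [Finset.sum_congr rfl fun j hj => hβ j (Finset.mem_filter.1 hj).2, Finset.sum_const,
      nsmul_eq_mul, mul_comm, bundles, Finset.filter_filter]
    simp only [cnt, Set.mem_compl_iff]

theorem pef1_of_load_le {a b : ℝ} {o : Fin m → Fin n} {H : Set (Fin m)} {p : Fin m → ℝ}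
    (hb : ∀ j ∈ H, p j = b) (ha : ∀ j ∉ H, p j = a)
    (h : ∀ i e, load a b o H i ≤ load a b o H e + top a b o H i) : PEF1 (bundles o) p := by
  intro i e
  rw [or_iff_not_imp_left, ← ne_eq, ← Finset.nonempty_iff_ne_empty]
  intro hne
  -- The chore to remove is a most expensive one; the bundle is nonempty, so the default value of
  -- `top` is attained as well.
  have key : ∃ j ∈ bundles o i, p j = top a b o H i := by
    by_cases hi : ∃ j ∈ H, o j = i
    · obtain ⟨j, hj, hji⟩ := hi
      exact ⟨j, by simpa [bundles] using hji, by rw [top_of_mem ⟨j, hj, hji⟩, hb j hj]⟩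
    · obtain ⟨j, hj⟩ := hne
      refine ⟨j, hj, ?_⟩
      rw [top_of_not hi, ha j fun hjH => hi ⟨j, hjH, by simpa [bundles] using hj⟩]
  obtain ⟨j, hj, hjt⟩ := key
  refine ⟨j, hj, ?_⟩
  have := Finset.add_sum_erase _ p hj
  rw [load_eq_sum o H p hb ha, hjt] at this
  rw [load_eq_sum o H p hb ha]
  linarith [h i e]

/-- A chore is easy for an agent if she has no cheaper one. -/
def Easy (c : Fin n → Fin m → ℝ) (i : Fin n) (j : Fin m) : Prop := ∀ l, c i j ≤ c i l

/-- The chores that are easy for nobody. -/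
def hard (c : Fin n → Fin m → ℝ) : Set (Fin m) := {j | ∀ i, ¬ Easy c i j}

/-- A member of `C` owns only raised chores that are easy for her: lowest cost over highest price.
For an outsider, raised chores have cost and price b, hence ratio 1, and when such chores exist her
easy unraised ones have ratio a/a. Without raised chores all prices agree and easiness suffices. -/
theorem IsStage.onMBB {c : Fin n → Fin m → ℝ} {a b : ℝ} {o₀ o : Fin m → Fin n} {C : Set (Fin n)}
    {τ : ℕ} {p : Fin m → ℝ} (ha : 0 < a) (hab : a ≤ b) (hc : ∀ i j, c i j = a ∨ c i j = b)
    (h₀ : ∀ j ∉ hard c, Easy c (o₀ j) j)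
    (hC : IsLayer (Easy c) (hard c) o₀ τ C) (h : IsStage (Easy c) (hard c) o₀ a b C o)
    (hpb : ∀ j ∈ raised (hard c) o₀ C, p j = b) (hpa : ∀ j ∉ raised (hard c) o₀ C, p j = a) :
    OnMBB c (bundles o) p := by
  have hb : 0 < b := ha.trans_le hab
  have hp : ∀ j, 0 < p j ∧ p j ≤ b := fun j => by
    by_cases hj : j ∈ raised (hard c) o₀ C
    · rw [hpb j hj]; exact ⟨hb, le_rfl⟩
    · rw [hpa j hj]; exact ⟨ha, hab⟩
  have hca : ∀ i j, a ≤ c i j := fun i j => by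
    rcases hc i j with h | h <;> rw [h]
    exact hab
  intro i j hj j'
  have hji : o j = i := by simpa [bundles] using hj
  rw [div_le_div_iff₀ (hp j).1 (hp j').1]
  -- By closedness of the layer the raised chore l is not easy for i, so both costs occur in her
  -- row.
  have hout : i ∉ C → ∀ l ∈ raised (hard c) o₀ C, c i l = b ∧ ∀ l', Easy c i l' → c i l' = a := by
    intro hi l hl
    have hne : ¬ Easy c i l := by
      intro he
      by_cases hlU : l ∈ hard c
      · exact hlU i he
      · exact hi (hC.closed l hlU (hl.resolve_left hlU) i he)
    unfold Easy at hne
    push Not at hne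
    obtain ⟨l', hl'⟩ := hne
    have h1 : c i l = b := by
      rcases hc i l with h1 | h1
      · exact absurd (hca i l') (by rw [← h1]; exact hl'.not_ge)
      · exact h1
    have h2 : c i l' = a := by
      rcases hc i l' with h2 | h2
      · exact h2
      · rw [h1, h2] at hl'
        exact absurd hl' (lt_irrefl _)
    exact ⟨h1, fun l'' he => le_antisymm (h2 ▸ he l') (hca i l'')⟩
  by_cases hjH : j ∈ raised (hard c) o₀ C
  · rw [hpb j hjH]
    have hal := h.allowed j hjH
    rw [hji] at hal
    by_cases hiC : i ∈ C
    · have he : Easy c i j := hal.resolve_left fun hh => hh hiC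
      have hcj : 0 < c i j := ha.trans_le (hca i j)
      calc c i j * p j' ≤ c i j * b := by gcongr; exact (hp j').2
        _ ≤ c i j' * b := by gcongr; exact he j'
    · rw [(hout hiC j hjH).1]
      by_cases hj' : j' ∈ raised (hard c) o₀ C
      · rw [(hout hiC j' hj').1, hpb j' hj']
      · rw [hpa j' hj', mul_comm]
        gcongr
        exact hca i j'
  · rw [hpa j hjH]
    have hoj := h.fixed j hjH
    have he : Easy c i j := by
      rw [← hji, hoj]
      exact h₀ j fun hu => hjH (Or.inl hu)
    have hiC : i ∉ C := fun hi => hjH (Or.inr (by rw [← hoj, hji]; exact hi))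
    by_cases hj' : j' ∈ raised (hard c) o₀ C
    · rw [(hout hiC j' hj').1, hpb j' hj', (hout hiC j' hj').2 j he, mul_comm]
    · rw [hpa j' hj']
      gcongr
      exact he j'

theorem cnt_le_of_reach {low : Fin n → Fin m → Prop} {H : Set (Fin m)} {o : Fin m → Fin n} {b : ℝ}
    (hb : 0 < b) (h : Balanced 0 b o H low) {i e : Fin n}
    (hr : Relation.ReflTransGen (Link o H low) i e) : cnt o H i ≤ cnt o H e + 1 := by
  rcases Nat.eq_zero_or_pos (cnt o H i) with h0 | h0
  · omega
  · have h1 := h i e hr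
    rw [top_of_mem (cnt_pos.1 h0)] at h1
    simp only [load, zero_mul, add_zero] at h1
    have h2 : b * (cnt o H i : ℝ) ≤ b * ((cnt o H e + 1 : ℕ) : ℝ) := by
      push_cast
      linarith
    exact_mod_cast le_of_mul_le_mul_left h2 hb

/-- With low price 0 the earnings are multiples of the counts, so balance limits the drop along a
path to one chore. Hence everybody reachable from an agent with τ chores has at least τ - 1. -/
theorem isLayer_of_reach {low : Fin n → Fin m → Prop} {U : Set (Fin m)} {o₀ : Fin m → Fin n}
    {b : ℝ} (hb : 0 < b) (h : Balanced 0 b o₀ Uᶜ low) {τ : ℕ} {C : Set (Fin n)}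
    (hmem : ∀ i, τ ≤ cnt o₀ Uᶜ i → i ∈ C)
    (hclosed : ∀ j ∈ Uᶜ, o₀ j ∈ C → ∀ e, low e j → e ∈ C)
    (hreach : ∀ e ∈ C, ∃ i, τ ≤ cnt o₀ Uᶜ i ∧ Relation.ReflTransGen (Link o₀ Uᶜ low) i e) :
    IsLayer low U o₀ τ C where
  mem := hmem
  closed := hclosed
  le e he := by
    obtain ⟨i, hi, hr⟩ := hreach e he
    exact hi.trans (cnt_le_of_reach hb h hr)

end StageConsequences

/-! ## Reasoning about programs -/

/-- Writing an index cell. -/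
def _root_.State.setI (s : State) (z : ℕ × ℕ × ℕ) (v : ℕ) : State :=
  { s with idx := Function.update s.idx z v }

/-- Writing a number cell. -/
noncomputable def _root_.State.setN (s : State) (z : ℕ × ℕ × ℕ) (y : ℝ) : State :=
  { s with num := Function.update s.num z y }

@[simp] theorem setI_num (s : State) (z v) : (s.setI z v).num = s.num := rfl
@[simp] theorem setN_idx (s : State) (z y) : (s.setN z y).idx = s.idx := rfl
@[simp] theorem setI_idx (s : State) (A i j v A' i' j' : ℕ) :
    (s.setI (A, i, j) v).idx (A', i', j') =
      if A' = A ∧ i' = i ∧ j' = j then v else s.idx (A', i', j') := by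
  simp [State.setI, Function.update_apply]
@[simp] theorem setN_num (s : State) (A i j A' i' j' : ℕ) (y : ℝ) :
    (s.setN (A, i, j) y).num (A', i', j') =
      if A' = A ∧ i' = i ∧ j' = j then y else s.num (A', i', j') := by
  simp [State.setN, Function.update_apply]

attribute [simp] IExpr.eval Cell.addr Test.Holds NumOp.Result

/-- Started in `s`, the program `P` halts after at most `T` steps in a state with property `Q`, and
all numbers that it computes have property `G`. -/
def Spec (G : ℝ → Prop) (P : Prog) (s : State) (T : ℕ) (Q : State → Prop) : Prop :=
  ∃ t L s', Exec P s t L s' ∧ t ≤ T ∧ (∀ y ∈ L, G y) ∧ Q s'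

variable {G : ℝ → Prop}

theorem Spec.mono {P : Prog} {s : State} {T T' : ℕ} {Q Q' : State → Prop} (h : Spec G P s T Q)
    (hT : T ≤ T') (hQ : ∀ s', Q s' → Q' s') : Spec G P s T' Q' := by
  obtain ⟨t, L, s', he, ht, hL, hq⟩ := h
  exact ⟨t, L, s', he, ht.trans hT, hL, hQ _ hq⟩

theorem Spec.seq {P R : Prog} {s : State} {T₁ T₂ : ℕ} {Q : State → Prop}
    (h : Spec G P s T₁ fun s' => Spec G R s' T₂ Q) : Spec G (.seq P R) s (T₁ + T₂) Q := by
  obtain ⟨t, L, s', he, ht, hL, t', L', s'', he', ht', hL', hq⟩ := h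
  refine ⟨t + t', L ++ L', s'', .seq he he', by omega, fun y hy => ?_, hq⟩
  exact (List.mem_append.1 hy).elim (hL y) (hL' y)

theorem Spec.branch {b : Test} {P R : Prog} {s : State} {T : ℕ} {Q : State → Prop}
    (h₁ : b.Holds s → Spec G P s T Q) (h₂ : ¬ b.Holds s → Spec G R s T Q) :
    Spec G (.branch b P R) s (b.cost + T) Q := by
  by_cases hb : b.Holds s
  · obtain ⟨t, L, s', he, ht, hL, hq⟩ := h₁ hb
    exact ⟨_, L, s', .branchTrue hb he, by omega, hL, hq⟩
  · obtain ⟨t, L, s', he, ht, hL, hq⟩ := h₂ hb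
    exact ⟨_, L, s', .branchFalse hb he, by omega, hL, hq⟩

/-- A loop with invariant `I v`, where the variant `v` decreases. -/
theorem Spec.loop {b : Test} {P : Prog} {K : ℕ} {I : ℕ → State → Prop}
    (hI : ∀ v s, I v s → b.Holds s → Spec G P s K fun s' => ∃ v' < v, I v' s') {s : State} {v V : ℕ}
    (h : I v s) (hV : v ≤ V) {Q : State → Prop} (hQ : ∀ v s, I v s → ¬ b.Holds s → Q s) :
    Spec G (.loop b P) s (V * (b.cost + K) + b.cost) Q := by
  suffices hs : Spec G (.loop b P) s (v * (b.cost + K) + b.cost) Q from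
    hs.mono (by gcongr) fun _ h => h
  clear hV
  induction v using Nat.strong_induction_on generalizing s with
  | _ v ih =>
    by_cases hb : b.Holds s
    · obtain ⟨t, L, s', he, ht, hL, v', hv, hq⟩ := hI v s h hb
      obtain ⟨t', L', s'', he', ht', hL', hq'⟩ := ih v' hv hq
      refine ⟨_, _, s'', .loopTrue hb he he', ?_, fun y hy => ?_, hq'⟩
      · have : (v' + 1) * (b.cost + K) ≤ v * (b.cost + K) := Nat.mul_le_mul_right _ hv
        rw [add_mul] at this
        omega
      · exact (List.mem_append.1 hy).elim (hL y) (hL' y)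
    · exact ⟨_, _, s, .loopFalse hb, by omega, by simp, hQ v s h hb⟩

/-- Weakest precondition of a program without loops. -/
def wp (G : ℝ → Prop) : Prog → (State → Prop) → State → Prop
  | .setIdx r e, Q, s => Q (s.setI (r.addr s) (e.eval s))
  | .setNum r op, Q, s => ∃ y, op.Result s y ∧ G y ∧ Q (s.setN (r.addr s) y)
  | .seq P R, Q, s => wp G P (wp G R Q) s
  | .branch b P R, Q, s => (b.Holds s → wp G P Q s) ∧ (¬ b.Holds s → wp G R Q s)
  | .loop _ _, _, _ => False

/-- Bound for the number of steps of a program without loops. -/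
def steps : Prog → ℕ
  | .setIdx r e => r.cost + e.cost
  | .setNum r op => r.cost + op.cost
  | .seq P R => steps P + steps R
  | .branch b P R => b.cost + max (steps P) (steps R)
  | .loop _ _ => 0

/-- For a loop `wp` is false, so the placeholder value of `steps` there is harmless. -/
theorem spec_of_wp {P : Prog} {s : State} {Q : State → Prop} (h : wp G P Q s) :
    Spec G P s (steps P) Q := by
  induction P generalizing s Q with
  | setIdx r e => exact ⟨_, _, _, .setIdx r e s, le_rfl, by simp, h⟩
  | setNum r op =>
    obtain ⟨y, hy, hG, hq⟩ := h
    exact ⟨_, _, _, .setNum r op s y hy, le_rfl, by simpa using hG, hq⟩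
  | seq P R ihP ihR => exact Spec.seq ((ihP h).mono le_rfl fun _ h' => ihR h')
  | branch b P R ihP ihR =>
    exact Spec.branch (fun hb => (ihP (h.1 hb)).mono (le_max_left _ _) fun _ h => h)
      fun hb => (ihR (h.2 hb)).mono (le_max_right _ _) fun _ h => h
  | loop b P => exact h.elim

/-! ### Abbreviations for programs -/

/-- The scalar index variable `A`. -/
abbrev var (A : ℕ) : IExpr := .read A (.const 0) (.const 0)

/-- Entry `e` of the one-dimensional index array `A`. -/
abbrev arr (A : ℕ) (e : IExpr) : IExpr := .read A (.const 0) e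

/-- Number of agents. -/
abbrev nE : IExpr := .read 0 (.const 0) (.const 0)

/-- Number of chores. -/
abbrev mE : IExpr := .read 0 (.const 0) (.const 1)

/-- The cell `e` of the one-dimensional array `A`. -/
abbrev cell (A : ℕ) (e : IExpr) : Cell := ⟨A, .const 0, e⟩

/-- The cell of the scalar variable `A`. -/
abbrev scal (A : ℕ) : Cell := ⟨A, .const 0, .const 0⟩

/-- Assignment to a scalar index variable. -/
abbrev setV (A : ℕ) (e : IExpr) : Prog := .setIdx (scal A) e

/-- Assignment to an entry of a one-dimensional index array. -/
abbrev setA (A : ℕ) (i e : IExpr) : Prog := .setIdx (cell A i) e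

/-- The program that does nothing useful. -/
abbrev skip : Prog := setV 21 (.const 0)

/-- `e < f` -/
abbrev ltE (e f : IExpr) : Test := .leIdx (.add e (.const 1)) f

/-- The flag `e` is set. -/
abbrev onE (e : IExpr) : Test := .leIdx (.const 1) e

/-- `for X = 0, …, e - 1` -/
def forLoop (X : ℕ) (e : IExpr) (P : Prog) : Prog :=
  .seq (setV X (.const 0)) (.loop (ltE (var X) e) (.seq P (setV X (.add (var X) (.const 1)))))

/-- Steps of a loop with `k` rounds and a body of at most `K` steps. -/
def forSteps (e : IExpr) (K k : ℕ) : ℕ :=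
  4 + (k * ((ltE (var 0) e).cost + (K + 8)) + (ltE (var 0) e).cost)

/-- The invariant is required after the increment of the counter, so it may speak about the whole
state. The bound `e` may be re-evaluated every round, provided that the invariant fixes its value.
-/
theorem spec_forLoop {X : ℕ} {e : IExpr} {P : Prog} {K k : ℕ} {s : State} {Q : State → Prop}
    (I : ℕ → State → Prop) (he : ∀ i s, I i s → e.eval s = k)
    (hI : ∀ i < k, ∀ s, I i s → s.idx (X, 0, 0) = i →
      Spec G P s K fun s' => s'.idx (X, 0, 0) = i ∧ I (i + 1) (s'.setI (X, 0, 0) (i + 1)))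
    (h0 : I 0 (s.setI (X, 0, 0) 0)) (hQ : ∀ s, I k s → Q s) :
    Spec G (forLoop X e P) s (forSteps e K k) Q := by
  unfold forLoop
  -- Initializing the counter costs 4 steps and incrementing it costs 8.
  refine (Spec.seq (T₁ := 4)
    (T₂ := k * ((ltE (var X) e).cost + (K + 8)) + (ltE (var X) e).cost) ?_).mono
    (le_of_eq ?_) fun _ h => h
  · refine (spec_of_wp (P := setV X (.const 0)) (Q := fun s' => s' = s.setI (X, 0, 0) 0)
      (by simp [wp])).mono (by simp [steps, Cell.cost, IExpr.cost]) ?_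
    rintro _ rfl
    refine Spec.loop (I := fun v s => v + s.idx (X, 0, 0) = k ∧ I (s.idx (X, 0, 0)) s)
      (v := k) ?_ ?_ le_rfl ?_
    · rintro v s ⟨hv, hIs⟩ hb
      simp only [Test.Holds, IExpr.eval, he _ _ hIs] at hb
      refine (Spec.seq (T₂ := 8) ((hI _ hb s hIs rfl).mono le_rfl ?_)).mono le_rfl fun _ h => h
      rintro s' ⟨hX, hI'⟩
      refine (spec_of_wp (Q := fun s'' => s'' = s'.setI (X, 0, 0) (s.idx (X, 0, 0) + 1))
        (by simp [wp, hX])).mono (by simp [steps, Cell.cost, IExpr.cost]) ?_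
      rintro _ rfl
      exact ⟨v - 1, by omega, by simp; omega, by simpa using hI'⟩
    · simpa using h0
    · rintro v s ⟨hv, hIs⟩ hb
      simp only [Test.Holds, IExpr.eval, he _ _ hIs] at hb
      have : s.idx (X, 0, 0) = k := by omega
      exact hQ s (this ▸ hIs)
  · simp [forSteps, Test.cost, IExpr.cost]

/-! ### Contents of arrays -/

/-- Only index arrays in `L` have changed. -/
def Keep (L : List ℕ) (s s' : State) : Prop :=
  ∀ A ∉ L, ∀ i j, s'.idx (A, i, j) = s.idx (A, i, j)

/-- Only number arrays in `L` have changed. -/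
def KeepN (L : List ℕ) (s s' : State) : Prop :=
  ∀ A ∉ L, ∀ i j, s'.num (A, i, j) = s.num (A, i, j)

/-- The index array `A` holds flags for the elements of `S`. -/
def Flag {k : ℕ} (A : ℕ) (S : Set (Fin k)) (s : State) : Prop :=
  ∀ i : Fin k, 1 ≤ s.idx (A, 0, i) ↔ i ∈ S

/-- The two-dimensional index array `A` holds flags for the relation `R`. -/
def Flag₂ {k l : ℕ} (A : ℕ) (R : Fin k → Fin l → Prop) (s : State) : Prop :=
  ∀ (i : Fin k) (j : Fin l), 1 ≤ s.idx (A, i, j) ↔ R i j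

/-- The index array `A` holds the values of `f`. -/
def Vals {k : ℕ} (A : ℕ) (f : Fin k → ℕ) (s : State) : Prop :=
  ∀ i : Fin k, s.idx (A, 0, i) = f i

/-- The number array `A` holds the values of `f`. -/
def NumVals {k : ℕ} (A : ℕ) (f : Fin k → ℝ) (s : State) : Prop :=
  ∀ i : Fin k, s.num (A, 0, i) = f i

theorem Keep.refl (L : List ℕ) (s : State) : Keep L s s := fun _ _ _ _ => rfl
theorem KeepN.refl (L : List ℕ) (s : State) : KeepN L s s := fun _ _ _ _ => rfl

theorem Keep.trans {L L' L'' : List ℕ} {s s' s'' : State} (h : Keep L s s') (h' : Keep L' s' s'')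
    (h₁ : L ⊆ L'' := by decide) (h₂ : L' ⊆ L'' := by decide) : Keep L'' s s'' :=
  fun A hA i j => (h' A (fun hh => hA (h₂ hh)) i j).trans (h A (fun hh => hA (h₁ hh)) i j)

theorem KeepN.trans {L L' L'' : List ℕ} {s s' s'' : State} (h : KeepN L s s')
    (h' : KeepN L' s' s'') (h₁ : L ⊆ L'' := by decide) (h₂ : L' ⊆ L'' := by decide) :
    KeepN L'' s s'' :=
  fun A hA i j => (h' A (fun hh => hA (h₂ hh)) i j).trans (h A (fun hh => hA (h₁ hh)) i j)

theorem Keep.setI {L : List ℕ} {s s' : State} (h : Keep L s s') {A i j v : ℕ}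
    (hA : A ∈ L := by decide) : Keep L s (s'.setI (A, i, j) v) := by
  intro A' hA' i' j'
  have : A' ≠ A := fun hh => hA' (hh ▸ hA)
  simp [this, h A' hA' i' j']

theorem Keep.setN {L : List ℕ} {s s' : State} (h : Keep L s s') {z y} : Keep L s (s'.setN z y) := h

theorem KeepN.setI {L : List ℕ} {s s' : State} (h : KeepN L s s') {z v} :
    KeepN L s (s'.setI z v) := h

theorem KeepN.setN {L : List ℕ} {s s' : State} (h : KeepN L s s') {A i j : ℕ} {y : ℝ}
    (hA : A ∈ L := by decide) : KeepN L s (s'.setN (A, i, j) y) := by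
  intro A' hA' i' j'
  have : A' ≠ A := fun hh => hA' (hh ▸ hA)
  simp [this, h A' hA' i' j']

theorem Keep.flag {L : List ℕ} {s s' : State} (h : Keep L s s') {k A : ℕ} {S : Set (Fin k)}
    (hs : Flag A S s) (hA : A ∉ L := by decide) : Flag A S s' := fun i => by
  rw [h A hA]; exact hs i

theorem Keep.flag₂ {L : List ℕ} {s s' : State} (h : Keep L s s') {k l A : ℕ}
    {R : Fin k → Fin l → Prop} (hs : Flag₂ A R s) (hA : A ∉ L := by decide) : Flag₂ A R s' :=
  fun i j => by rw [h A hA]; exact hs i j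

theorem Keep.vals {L : List ℕ} {s s' : State} (h : Keep L s s') {k A : ℕ} {f : Fin k → ℕ}
    (hs : Vals A f s) (hA : A ∉ L := by decide) : Vals A f s' := fun i => by
  rw [h A hA]; exact hs i

theorem KeepN.numVals {L : List ℕ} {s s' : State} (h : KeepN L s s') {k A : ℕ} {f : Fin k → ℝ}
    (hs : NumVals A f s) (hA : A ∉ L := by decide) : NumVals A f s' := fun i => by
  rw [h A hA]; exact hs i

theorem Keep.eq {L : List ℕ} {s s' : State} (h : Keep L s s') {A i j v : ℕ}
    (hs : s.idx (A, i, j) = v) (hA : A ∉ L := by decide) : s'.idx (A, i, j) = v :=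
  (h A hA i j).trans hs

theorem KeepN.eq {L : List ℕ} {s s' : State} (h : KeepN L s s') {A i j : ℕ} {y : ℝ}
    (hs : s.num (A, i, j) = y) (hA : A ∉ L := by decide) : s'.num (A, i, j) = y :=
  (h A hA i j).trans hs

/-- For loops that tabulate a function: the body is only examined in states that agree with the
initial one outside the table and the counter. -/
theorem spec_map {G : ℝ → Prop} {X A k : ℕ} {e : IExpr} {P : Prog} {s : State} (f : ℕ → ℕ)
    (hXA : X ≠ A) (he : ∀ s', Keep [A, X] s s' → e.eval s' = k)
    (hP : ∀ i < k, ∀ s', Keep [A, X] s s' → s'.num = s.num → s'.idx (X, 0, 0) = i →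
      wp G P (fun s'' => s'' = s'.setI (A, 0, i) (f i)) s') :
    Spec G (forLoop X e P) s (forSteps e (steps P) k) fun s' =>
      Keep [A, X] s s' ∧ s'.num = s.num ∧ ∀ i < k, s'.idx (A, 0, i) = f i := by
  refine spec_forLoop
    (fun r s' => Keep [A, X] s s' ∧ s'.num = s.num ∧ ∀ i < r, s'.idx (A, 0, i) = f i)
    (fun i s' h => he s' h.1) ?_ ?_ fun s' h => h
  · rintro i hi s' ⟨h1, h2, h3⟩ hX
    refine (spec_of_wp (hP i hi s' h1 h2 hX)).mono le_rfl ?_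
    rintro _ rfl
    refine ⟨by simp [hXA, hX], (h1.setI (by simp)).setI (by simp), by simpa using h2, fun r hr => ?_⟩
    rcases Nat.lt_succ_iff_lt_or_eq.1 hr with h | rfl
    · simp [hXA.symm, h.ne, h3 r h]
    · simp [hXA.symm]
  · exact ⟨(Keep.refl _ _).setI (by simp), rfl, fun r hr => absurd hr (Nat.not_lt_zero r)⟩

/-! ### The numbers that are computed -/

/-- Small integer combinations of `lo` and `hi`. -/
def Good (lo hi : ℝ) (m : ℕ) (y : ℝ) : Prop :=
  ∃ u v : ℕ, u ≤ m + 1 ∧ v ≤ m + 1 ∧ y = u * lo + v * hi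

theorem good_zero (lo hi : ℝ) (m : ℕ) : Good lo hi m 0 := ⟨0, 0, by simp⟩
theorem good_lo (lo hi : ℝ) (m : ℕ) : Good lo hi m lo := ⟨1, 0, by simp⟩
theorem good_hi (lo hi : ℝ) (m : ℕ) : Good lo hi m hi := ⟨0, 1, by simp⟩

theorem good_comb {lo hi β : ℝ} {m u v : ℕ} (hβ : β = 0 ∨ β = lo) (hu : u ≤ m + 1)
    (hv : v ≤ m + 1) : Good lo hi m (hi * v + β * u) := by
  rcases hβ with rfl | rfl
  · exact ⟨0, v, by simp, hv, by ring⟩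
  · exact ⟨u, v, hu, hv, by ring⟩

/-! ### Configurations -/

/-- The memory holds the sizes, the easiness relation, the set `H` of chores of high price, the set
`C` of raised agents (as its complement), the high price and the low one. -/
structure Cfg {n m : ℕ} (low : Fin n → Fin m → Prop) (H : Set (Fin m)) (C : Set (Fin n))
    (b β : ℝ) (s : State) : Prop where
  n : s.idx (0, 0, 0) = n
  m : s.idx (0, 0, 1) = m
  low : Flag₂ 2 low s
  mv : Flag 3 H s
  free : Flag 4 Cᶜ s
  b : s.num (4, 0, 0) = b
  β : s.num (5, 0, 0) = β

/-- The memory holds the owners of the chores. -/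
def Own {n m : ℕ} (A : ℕ) (o : Fin m → Fin n) (s : State) : Prop := Vals A (fun j => (o j : ℕ)) s

section

variable {n m : ℕ} {low : Fin n → Fin m → Prop} {H : Set (Fin m)} {C : Set (Fin n)}
  {lo hi β : ℝ} {o : Fin m → Fin n} {s s' : State}

theorem Cfg.keep (h : Cfg low H C hi β s) {L L' : List ℕ} (hk : Keep L s s') (hk' : KeepN L' s s')
    (h0 : 0 ∉ L := by decide) (h2 : 2 ∉ L := by decide) (h3 : 3 ∉ L := by decide)
    (h4 : 4 ∉ L := by decide) (hb : 4 ∉ L' := by decide) (hβ : 5 ∉ L' := by decide) :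
    Cfg low H C hi β s' :=
  ⟨hk.eq h.n h0, hk.eq h.m h0, hk.flag₂ h.low h2, hk.flag h.mv h3, hk.flag h.free h4,
    hk'.eq h.b hb, hk'.eq h.β hβ⟩

/-! ### Computing counts and earnings by one scan over the chores -/

/-- The chores before chore number `k`. -/
def below (m k : ℕ) : Set (Fin m) := {j | (j : ℕ) < k}

open Classical in
theorem cnt_insert (o : Fin m → Fin n) {S : Set (Fin m)} {j : Fin m} (hj : j ∉ S) (i : Fin n) :
    cnt o (insert j S) i = cnt o S i + if o j = i then 1 else 0 := by
  split_ifs with h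
  · rw [cnt, cnt, ← Finset.card_insert_of_notMem (a := j) (by simp [hj])]
    congr 1
    ext l
    simp only [Finset.mem_filter, Finset.mem_univ, true_and, Finset.mem_insert,
      Set.mem_insert_iff]
    constructor
    · rintro ⟨h1, rfl | h2⟩
      · exact Or.inl rfl
      · exact Or.inr ⟨h1, h2⟩
    · rintro (rfl | ⟨h1, h2⟩)
      · exact ⟨h, Or.inl rfl⟩
      · exact ⟨h1, Or.inr h2⟩
  · refine cnt_congr fun l => ?_
    simp only [Set.mem_insert_iff]
    constructor
    · rintro ⟨h1, rfl | h2⟩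
      · exact absurd h1 h
      · exact ⟨h1, h2⟩
    · rintro ⟨h1, h2⟩
      exact ⟨h1, Or.inr h2⟩

open Classical in
theorem cnt_below_succ (o : Fin m → Fin n) (S : Set (Fin m)) {k : ℕ} (hk : k < m) (i : Fin n) :
    cnt o (S ∩ below m (k + 1)) i =
      cnt o (S ∩ below m k) i + if o ⟨k, hk⟩ = i ∧ ⟨k, hk⟩ ∈ S then 1 else 0 := by
  have hmem : ∀ j : Fin m, j ∈ below m (k + 1) ↔ j = ⟨k, hk⟩ ∨ j ∈ below m k := fun j => by
    simp only [below, Set.mem_ofPred_eq, Fin.ext_iff]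
    omega
  by_cases hS : (⟨k, hk⟩ : Fin m) ∈ S
  · have : S ∩ below m (k + 1) = insert ⟨k, hk⟩ (S ∩ below m k) := by
      ext j
      simp only [Set.mem_inter_iff, Set.mem_insert_iff, hmem]
      constructor
      · rintro ⟨h1, h2 | h2⟩
        exacts [Or.inl h2, Or.inr ⟨h1, h2⟩]
      · rintro (rfl | h)
        exacts [⟨hS, Or.inl rfl⟩, ⟨h.1, Or.inr h.2⟩]
    rw [this, cnt_insert _ (by simp [below])]
    simp [hS]
  · have : S ∩ below m (k + 1) = S ∩ below m k := by
      ext j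
      simp only [Set.mem_inter_iff, hmem]
      refine and_congr_right fun hj => or_iff_right ?_
      rintro rfl
      exact hS hj
    simp [this, hS]

theorem inter_below_zero (S : Set (Fin m)) : S ∩ below m 0 = ∅ := by
  ext j; simp [below]

theorem inter_below_all (S : Set (Fin m)) : S ∩ below m m = S := by
  ext j; simp [below]

theorem cnt_empty (o : Fin m → Fin n) (i : Fin n) : cnt o ∅ i = 0 := by
  simp [cnt]

/-- Computes earnings, highest prices and numbers of chores of high price. -/
def loads : Prog :=
  .seq (forLoop 11 nE (.seq (.setNum (cell 1 (var 11)) (.const 0))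
      (.seq (.setNum (cell 2 (var 11)) (.copy (scal 5))) (setA 9 (var 11) (.const 0)))))
    (forLoop 12 mE (.branch (onE (arr 3 (var 12)))
      (.seq (.setNum (cell 1 (arr 1 (var 12))) (.add (cell 1 (arr 1 (var 12))) (scal 4)))
        (.seq (.setNum (cell 2 (arr 1 (var 12))) (.copy (scal 4)))
          (setA 9 (arr 1 (var 12)) (.add (arr 9 (arr 1 (var 12))) (.const 1)))))
      (.setNum (cell 1 (arr 1 (var 12))) (.add (cell 1 (arr 1 (var 12))) (scal 5)))))

def loadsBody₁ : ℕ := steps (.seq (.setNum (cell 1 (var 11)) (.const 0))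
      (.seq (.setNum (cell 2 (var 11)) (.copy (scal 5))) (setA 9 (var 11) (.const 0))))

def loadsBody₂ : ℕ := steps (.branch (onE (arr 3 (var 12)))
      (.seq (.setNum (cell 1 (arr 1 (var 12))) (.add (cell 1 (arr 1 (var 12))) (scal 4)))
        (.seq (.setNum (cell 2 (arr 1 (var 12))) (.copy (scal 4)))
          (setA 9 (arr 1 (var 12)) (.add (arr 9 (arr 1 (var 12))) (.const 1)))))
      (.setNum (cell 1 (arr 1 (var 12))) (.add (cell 1 (arr 1 (var 12))) (scal 5))))

def loadsSteps (n m : ℕ) : ℕ := forSteps nE loadsBody₁ n + forSteps mE loadsBody₂ m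

theorem spec_loads (hs : Cfg low H C hi β s) (hβ : β = 0 ∨ β = lo) (ho : Own 1 o s) :
    Spec (Good lo hi m) loads s (loadsSteps n m) fun s' =>
      Keep [9, 11, 12] s s' ∧ KeepN [1, 2] s s' ∧ NumVals 1 (load β hi o H) s' ∧
      NumVals 2 (top β hi o H) s' ∧ Vals 9 (cnt o H) s' := by
  have hGβ : Good lo hi m β := by
    rcases hβ with rfl | rfl
    exacts [good_zero _ _ _, good_lo _ _ _]
  refine Spec.seq ?_
  refine spec_forLoop (fun k s' => Keep [9, 11, 12] s s' ∧ KeepN [1, 2] s s' ∧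
    ∀ i < k, s'.num (1, 0, i) = 0 ∧ s'.num (2, 0, i) = β ∧ s'.idx (9, 0, i) = 0)
    (fun k s' h => h.1.eq hs.n) ?_ ?_ ?_
  · rintro k hk s' ⟨h1, h2, h3⟩ hX
    refine spec_of_wp ?_
    simp only [wp, NumOp.Result, IExpr.eval, Cell.addr, hX, exists_eq_left, setI_num, setN_num,
      setN_idx, setI_idx]
    have h5 := h2.eq hs.β
    refine ⟨by simpa using good_zero lo hi m, by simpa [h5] using hGβ, by simp,
      (h1.setN.setN.setI).setI, ((h2.setN).setN.setI).setI, fun i hi => ?_⟩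
    rcases Nat.lt_succ_iff_lt_or_eq.1 hi with h | rfl
    · simpa [h.ne] using h3 i h
    · simpa using h5
  · exact ⟨(Keep.refl _ _).setI, KeepN.refl _ _, fun i hi => absurd hi (Nat.not_lt_zero _)⟩
  rintro s₁ ⟨h1, h2, h3⟩
  -- Partial sums over the chores scanned so far. Each is a combination of the two prices with
  -- coefficients at most m + 1, hence `Good`.
  refine spec_forLoop (fun k s' => Keep [9, 11, 12] s s' ∧ KeepN [1, 2] s s' ∧
    (∀ i, s'.num (1, 0, (i : Fin n)) =
      hi * cnt o (H ∩ below m k) i + β * cnt o (Hᶜ ∩ below m k) i) ∧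
    NumVals 2 (top β hi o (H ∩ below m k)) s' ∧ Vals 9 (cnt o (H ∩ below m k)) s')
    (fun k s' h => h.1.eq hs.m) ?_ ?_ ?_
  · rintro k hk s' ⟨h1, h2, h3, h4, h5⟩ hX
    have h6 : s'.idx (1, 0, k) = o ⟨k, hk⟩ := h1.vals ho (by decide) ⟨k, hk⟩
    have h7 : 1 ≤ s'.idx (3, 0, k) ↔ ⟨k, hk⟩ ∈ H := h1.flag hs.mv (by decide) ⟨k, hk⟩
    have h8 := h2.eq hs.b
    have h9 := h2.eq hs.β
    refine spec_of_wp ?_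
    simp only [wp, NumOp.Result, IExpr.eval, Cell.addr, hX, exists_eq_left, setI_num, setN_num,
      setN_idx, setI_idx, Test.Holds, h6, h7, h8, h9]
    have e1 := cnt_below_succ o H hk
    have e2 := cnt_below_succ o Hᶜ hk
    have b1 := cnt_le o (H ∩ below m k) (o ⟨k, hk⟩)
    have b2 := cnt_le o (Hᶜ ∩ below m k) (o ⟨k, hk⟩)
    constructor
    · intro hH
      refine ⟨?_, ?_, ?_, ?_, ?_, ?_, ?_, ?_⟩
      · rw [h3 (o ⟨k, hk⟩)]
        have := good_comb (lo := lo) (hi := hi) (β := β) (m := m)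
          (u := cnt o (Hᶜ ∩ below m k) (o ⟨k, hk⟩)) (v := cnt o (H ∩ below m k) (o ⟨k, hk⟩) + 1)
          hβ (by omega) (by omega)
        convert this using 1
        push_cast
        ring
      · simpa [h8] using good_hi lo hi m
      · simp
      · exact h1.setN.setN.setI.setI
      · exact (h2.setN.setN).setI.setI
      · intro i
        rw [e1, e2]
        by_cases hi' : i = o ⟨k, hk⟩
        · subst hi'
          simp [hH, h3]
          ring
        · have : o ⟨k, hk⟩ ≠ i := fun hh => hi' hh.symm
          simp [Fin.val_inj, hi', this, h3]
      · intro i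
        by_cases hi' : i = o ⟨k, hk⟩
        · subst hi'
          simp [top_eq, e1, hH]
        · have : o ⟨k, hk⟩ ≠ i := fun hh => hi' hh.symm
          simp [Fin.val_inj, hi', h4 i, top_eq, e1, this]
      · intro i
        rw [e1]
        by_cases hi' : i = o ⟨k, hk⟩
        · subst hi'
          simp [hH, h5 _]
        · have : o ⟨k, hk⟩ ≠ i := fun hh => hi' hh.symm
          simp [Fin.val_inj, hi', h5 i, this]
    · intro hH
      refine ⟨?_, ?_, ?_, ?_, ?_, ?_, ?_⟩
      · rw [h3 (o ⟨k, hk⟩)]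
        have := good_comb (lo := lo) (hi := hi) (β := β) (m := m)
          (u := cnt o (Hᶜ ∩ below m k) (o ⟨k, hk⟩) + 1) (v := cnt o (H ∩ below m k) (o ⟨k, hk⟩))
          hβ (by omega) (by omega)
        convert this using 1
        push_cast
        ring
      · simp
      · exact h1.setN.setI
      · exact (h2.setN).setI
      · intro i
        rw [e1, e2]
        by_cases hi' : i = o ⟨k, hk⟩
        · subst hi'
          simp [hH, h3]
          ring
        · have : o ⟨k, hk⟩ ≠ i := fun hh => hi' hh.symm
          simp [Fin.val_inj, hi', this, h3]
      · intro i
        simp [h4 i, top_eq, e1, hH]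
      · intro i
        simp [h5 i, e1, hH]
  · refine ⟨h1.setI, h2.setI, fun i => ?_, fun i => ?_, fun i => ?_⟩
    · simp [inter_below_zero, cnt_empty, h3 i i.2]
    · simp [inter_below_zero, top, h3 i i.2]
    · simp [inter_below_zero, cnt_empty, h3 i i.2]
  · rintro s' ⟨h1, h2, h3, h4, h5⟩
    rw [inter_below_all] at h4 h5
    refine ⟨h1, h2, fun i => ?_, h4, h5⟩
    have := h3 i
    rwa [inter_below_all, inter_below_all] at this

end

section

variable {n m : ℕ} {low : Fin n → Fin m → Prop} {H : Set (Fin m)} {C : Set (Fin n)}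
  {s s' : State} {lo hi β : ℝ} {o : Fin m → Fin n}

/-! ### Reachability -/

/-- Array `6` holds, for every element of `S` outside `S₀`, a chore by which it is reached from an
element of `S` of smaller rank. -/
def Forest (o : Fin m → Fin n) (H : Set (Fin m)) (al : Fin n → Fin m → Prop) (S₀ S : Set (Fin n))
    (ρ : Fin n → ℕ) (s : State) : Prop :=
  ∀ e ∈ S, e ∉ S₀ → ∃ j : Fin m, s.idx (6, 0, e) = j ∧ j ∈ H ∧ al e j ∧ o j ∈ S ∧ ρ (o j) < ρ e

theorem Forest.reach {al : Fin n → Fin m → Prop} {S₀ S : Set (Fin n)} {ρ : Fin n → ℕ}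
    (h : Forest o H al S₀ S ρ s) {e : Fin n} (he : e ∈ S) :
    ∃ i ∈ S₀, Relation.ReflTransGen (Link o H al) i e := by
  induction hk : ρ e using Nat.strong_induction_on generalizing e with
  | _ k ih =>
    by_cases he₀ : e ∈ S₀
    · exact ⟨e, he₀, .refl⟩
    · obtain ⟨j, -, hjH, hal, hjS, hlt⟩ := h e he he₀
      obtain ⟨i, hi, hr⟩ := ih _ (hk ▸ hlt) hjS rfl
      exact ⟨i, hi, hr.tail ⟨j, hjH, rfl, hal⟩⟩

/-- Array 4 marks the complement of `C`, so the sum of the two flags encodes the disjunction in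
`Allowed`. -/
def reachTest : Test :=
  .conj (onE (arr 3 (var 12))) (.conj (onE (arr 5 (arr 1 (var 12))))
    (.conj (.neg (onE (arr 5 (var 11))))
      (onE (.add (.read 2 (var 11) (var 12)) (arr 4 (var 11))))))

def reachBody : Prog :=
  .branch reachTest
    (.seq (setA 5 (var 11) (.const 1)) (.seq (setA 6 (var 11) (var 12))
      (.seq (setV 12 (.const 0)) (setV 11 (.const 0)))))
    (.branch (ltE (.add (var 11) (.const 1)) nE) (setV 11 (.add (var 11) (.const 1)))
      (.seq (setV 11 (.const 0)) (setV 12 (.add (var 12) (.const 1)))))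

/-- Marks everything reachable from the marked agents. -/
def reach : Prog :=
  .seq (setV 12 (.const 0)) (.seq (setV 11 (.const 0)) (.loop (ltE (var 12) mE) reachBody))

/-- There are at most n new marks, and each restarts the scan of the m·n pairs of a chore and an
agent. -/
def reachSteps (n m : ℕ) : ℕ :=
  4 + (4 + ((n * (n * m + 1) + m * n) * ((ltE (var 12) mE).cost + steps reachBody) +
    (ltE (var 12) mE).cost))

open Classical in
/-- Number of elements of a set of agents. -/
noncomputable def size (S : Set (Fin n)) : ℕ := (Finset.univ.filter (· ∈ S)).card

theorem size_le (S : Set (Fin n)) : size S ≤ n := by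
  classical
  exact (Finset.card_le_univ _).trans (by simp)

theorem size_insert {S : Set (Fin n)} {e : Fin n} (he : e ∉ S) :
    size (insert e S) = size S + 1 := by
  classical
  rw [size, size, ← Finset.card_insert_of_notMem (a := e) (by simpa using he)]
  congr 1
  ext x
  simp

theorem spec_reach {G : ℝ → Prop} (hn : 0 < n) (hs : Cfg low H C hi β s) (ho : Own 1 o s)
    {S₀ : Set (Fin n)} (hS : Flag 5 S₀ s) :
    Spec G reach s (reachSteps n m) fun s' =>
      Keep [5, 6, 11, 12] s s' ∧ s'.num = s.num ∧ ∃ S ρ, Flag 5 S s' ∧ S₀ ⊆ S ∧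
        Forest o H (Allowed low C) S₀ S ρ s' ∧ (∀ e ∈ S, ρ e < n) ∧
        ∀ j ∈ H, o j ∈ S → ∀ e, Allowed low C e j → e ∈ S := by
  unfold reach
  refine Spec.seq ((spec_of_wp (Q := fun s' => s' = s.setI (12, 0, 0) 0) (by simp [wp])).mono
    (by simp [steps, Cell.cost, IExpr.cost]) ?_)
  rintro _ rfl
  refine Spec.seq ((spec_of_wp (Q := fun s' => s' = (s.setI (12, 0, 0) 0).setI (11, 0, 0) 0)
    (by simp [wp])).mono (by simp [steps, Cell.cost, IExpr.cost]) ?_)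
  rintro _ rfl
  -- The pairs scanned since the last mark satisfy the closure condition. The variant is
  -- lexicographic: unmarked agents first, then unscanned pairs.
  refine Spec.loop (I := fun v s' => Keep [5, 6, 11, 12] s s' ∧ s'.num = s.num ∧
    s'.idx (11, 0, 0) < n ∧ s'.idx (12, 0, 0) ≤ m ∧ ∃ S ρ, Flag 5 S s' ∧ S₀ ⊆ S ∧
      Forest o H (Allowed low C) S₀ S ρ s' ∧ (∀ e ∈ S, ρ e < size S) ∧
      (∀ (j : Fin m) (e : Fin n), (j : ℕ) < s'.idx (12, 0, 0) ∨
        (j : ℕ) = s'.idx (12, 0, 0) ∧ (e : ℕ) < s'.idx (11, 0, 0) →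
        j ∈ H → o j ∈ S → Allowed low C e j → e ∈ S) ∧
      v = (n - size S) * (n * m + 1) + ((m - s'.idx (12, 0, 0)) * n - s'.idx (11, 0, 0)))
    (v := (n - size S₀) * (n * m + 1) + m * n) ?_ ?_ ?_ ?_
  · rintro v s' ⟨h1, h2, h3, h4, S, ρ, h5, h6, h7, h8, h9, rfl⟩ hb
    generalize hk : s'.idx (12, 0, 0) = k at *
    generalize hl : s'.idx (11, 0, 0) = l at *
    simp only [Test.Holds, IExpr.eval, hk, h1.eq hs.m] at hb
    have hkm : k < m := hb
    have e1 : s'.idx (1, 0, k) = o ⟨k, hkm⟩ := h1.vals ho (by decide) ⟨k, hkm⟩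
    have e2 : 1 ≤ s'.idx (3, 0, k) ↔ ⟨k, hkm⟩ ∈ H := h1.flag hs.mv (by decide) ⟨k, hkm⟩
    have e3 : 1 ≤ s'.idx (5, 0, o ⟨k, hkm⟩) ↔ o ⟨k, hkm⟩ ∈ S := h5 _
    have e4 : 1 ≤ s'.idx (5, 0, l) ↔ ⟨l, h3⟩ ∈ S := h5 ⟨l, h3⟩
    have e5 : 1 ≤ s'.idx (2, l, k) + s'.idx (4, 0, l) ↔ Allowed low C ⟨l, h3⟩ ⟨k, hkm⟩ := by
      have a1 : 1 ≤ s'.idx (2, l, k) ↔ low ⟨l, h3⟩ ⟨k, hkm⟩ :=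
        h1.flag₂ hs.low (by decide) ⟨l, h3⟩ ⟨k, hkm⟩
      have a2 : 1 ≤ s'.idx (4, 0, l) ↔ ⟨l, h3⟩ ∈ Cᶜ := h1.flag hs.free (by decide) ⟨l, h3⟩
      rw [Allowed, ← a1, ← Set.mem_compl_iff, ← a2]
      omega
    have hT : reachTest.Holds s' ↔ ⟨k, hkm⟩ ∈ H ∧ o ⟨k, hkm⟩ ∈ S ∧ ⟨l, h3⟩ ∉ S ∧
        Allowed low C ⟨l, h3⟩ ⟨k, hkm⟩ := by
      simp only [reachTest, Test.Holds, IExpr.eval, hk, hl, e1, e2, e3, e4, e5]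
    have hmul : (m - k) * n = (m - (k + 1)) * n + n := by
      rw [← Nat.succ_mul]
      congr 1
      omega
    refine spec_of_wp ?_
    unfold reachBody
    simp only [wp, hT]
    constructor
    · rintro ⟨b1, b2, b3, b4⟩
      simp only [IExpr.eval, Cell.addr, hl, hk, setI_idx]
      -- The rank of a new agent is the number of agents marked before her, which exceeds all
      -- earlier ranks.
      refine ⟨(n - size (insert ⟨l, h3⟩ S)) * (n * m + 1) + m * n, ?_, ?_, ?_, ?_, ?_,
        insert ⟨l, h3⟩ S, Function.update ρ ⟨l, h3⟩ (size S), ?_, h6.trans (Set.subset_insert _ _),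
        ?_, ?_, ?_, ?_⟩
      · rw [size_insert b3]
        have := size_le (insert (⟨l, h3⟩ : Fin n) S)
        rw [size_insert b3] at this
        have : n - size S = (n - (size S + 1)) + 1 := by omega
        rw [this, Nat.succ_mul, mul_comm m n]
        have : l < (m - k) * n := by omega
        omega
      · exact h1.setI.setI.setI.setI
      · simpa using h2
      · simpa using hn
      · simp
      · intro i
        simp only [setI_idx, Set.mem_insert_iff, Fin.ext_iff]
        by_cases hi' : (i : ℕ) = l
        · simp [hi']
        · simpa [hi'] using h5 i
      · intro e he he₀
        by_cases hel : e = ⟨l, h3⟩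
        · subst hel
          have : o ⟨k, hkm⟩ ≠ ⟨l, h3⟩ := fun hh => b3 (hh ▸ b2)
          exact ⟨⟨k, hkm⟩, by simp, b1, b4, Or.inr b2, by simpa [this] using h8 _ b2⟩
        · have heS : e ∈ S := he.resolve_left hel
          obtain ⟨j, c1, c2, c3, c4, c5⟩ := h7 e heS he₀
          have : o j ≠ ⟨l, h3⟩ := fun hh => b3 (hh ▸ c4)
          have hel' : (e : ℕ) ≠ l := fun hh => hel (Fin.ext hh)
          exact ⟨j, by simpa [hel'] using c1, c2, c3, Or.inr c4, by simpa [this, hel] using c5⟩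
      · intro e he
        rw [size_insert b3]
        by_cases hel : e = ⟨l, h3⟩
        · subst hel
          simp
        · simpa [hel] using (h8 e (he.resolve_left hel)).trans (Nat.lt_succ_self _)
      · rintro j e (hj | ⟨-, he⟩)
        · simp at hj
        · simp at he
      · simp
    · intro hno
      simp only [Test.Holds, IExpr.eval, Cell.addr, hl, hk, h1.eq hs.n, setI_idx]
      have h9' : ∀ (j : Fin m) (e : Fin n), (j : ℕ) < k ∨ (j : ℕ) = k ∧ (e : ℕ) ≤ l →
          j ∈ H → o j ∈ S → Allowed low C e j → e ∈ S := by
        rintro j e hje c1 c2 c3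
        by_cases hh : (j : ℕ) = k ∧ (e : ℕ) = l
        · obtain ⟨rfl, rfl⟩ := hh
          by_contra hne
          exact hno ⟨c1, c2, hne, c3⟩
        · exact h9 j e (by omega) c1 c2 c3
      constructor
      · intro hln
        refine ⟨_, ?_, h1.setI, h2, by simpa using hln, by simpa [hk] using h4, S, ρ, ?_, h6, ?_,
          h8, ?_, rfl⟩
        · simp
          omega
        · intro i; simpa using h5 i
        · intro e he he₀; simpa using h7 e he he₀
        · intro j e hje
          simp at hje
          exact h9' j e (by omega)
      · intro hln
        refine ⟨_, ?_, h1.setI.setI, h2, by simpa using hn, by simpa [hk] using hkm, S, ρ, ?_, h6,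
          ?_, h8, ?_, rfl⟩
        · simp
          omega
        · intro i; simpa using h5 i
        · intro e he he₀; simpa using h7 e he he₀
        · intro j e hje
          simp at hje
          exact h9' j e (by have := e.2; omega)
  · refine ⟨(Keep.refl _ _).setI.setI, rfl, by simpa using hn, by simp, S₀, fun _ => 0, ?_,
      subset_rfl, fun e he he₀ => absurd he he₀, ?_, ?_, by simp⟩
    · intro i; simpa using hS i
    · intro e he
      classical
      exact Finset.card_pos.2 ⟨e, by simpa using he⟩
    · rintro j e hje
      simp at hje
  · have : (n - size S₀) * (n * m + 1) ≤ n * (n * m + 1) := Nat.mul_le_mul_right _ (by omega)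
    omega
  · rintro v s' ⟨h1, h2, h3, h4, S, ρ, h5, h6, h7, h8, h9, -⟩ hb
    simp only [Test.Holds, IExpr.eval, h1.eq hs.m] at hb
    refine ⟨h1, h2, S, ρ, h5, h6, h7, fun e he => (h8 e he).trans_le (size_le S), ?_⟩
    intro j hj hjS e hal
    exact h9 j e (Or.inl (by have := j.2; omega)) hj hjS hal

/-! ### Passing chores along a path -/

theorem cnt_update (o : Fin m → Fin n) {S : Set (Fin m)} {j : Fin m} (hj : j ∈ S) (e f : Fin n) :
    cnt (Function.update o j e) S f + (if f = o j then 1 else 0) =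
      cnt o S f + if f = e then 1 else 0 := by
  have hS : S = insert j (S \ {j}) := by simp [Set.insert_eq_of_mem hj]
  have h : cnt (Function.update o j e) (S \ {j}) f = cnt o (S \ {j}) f := by
    refine cnt_congr fun l => and_congr_left fun hl => ?_
    have : l ≠ j := fun hh => hl.2 hh
    simp [this]
  rw [hS, cnt_insert _ (by simp), cnt_insert _ (by simp), h]
  simp only [Function.update_self, eq_comm (a := f)]
  split_ifs <;> omega

def transferBody : Prog :=
  .seq (setV 16 (arr 6 (var 15))) (.seq (setV 17 (arr 1 (var 16)))
    (.seq (setA 1 (var 16) (var 15)) (setV 15 (var 17))))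

def transferTest : Test := .neg (.conj (.leIdx (var 15) (var 10)) (.leIdx (var 10) (var 15)))

/-- Passes chores along the path from agent `10` to agent `14`. -/
def transfer : Prog := .seq (setV 15 (var 14)) (.loop transferTest transferBody)

def transferSteps (n : ℕ) : ℕ :=
  6 + (n * (transferTest.cost + steps transferBody) + transferTest.cost)

/-- The path is walked backwards from e to i, each agent receiving the chore by which she was
reached. Ranks decrease strictly, so every chore met later still has its original owner, and the
walk ends at i, the only root. -/
theorem spec_transfer {G : ℝ → Prop} {al : Fin n → Fin m → Prop} (ho : Own 1 o s) {i e : Fin n}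
    {S : Set (Fin n)} {ρ : Fin n → ℕ} (hi : s.idx (10, 0, 0) = i) (he : s.idx (14, 0, 0) = e)
    (hS : Forest o H al {i} S ρ s) (hρ : ∀ e ∈ S, ρ e < n) (heS : e ∈ S) :
    Spec G transfer s (transferSteps n) fun s' =>
      Keep [1, 15, 16, 17] s s' ∧ s'.num = s.num ∧ ∃ o' : Fin m → Fin n, Own 1 o' s' ∧
        (∀ f, cnt o' H f + (if f = i then 1 else 0) = cnt o H f + if f = e then 1 else 0) ∧
        (∀ j ∉ H, o' j = o j) ∧ ∀ j ∈ H, al (o' j) j ∨ o' j = o j := by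
  unfold transfer
  refine Spec.seq ((spec_of_wp (Q := fun s' => s' = s.setI (15, 0, 0) e) (by simp [wp, he])).mono
    (by simp [steps, Cell.cost, IExpr.cost]) ?_)
  rintro _ rfl
  have hT : ∀ (s' : State) (cur : Fin n), s'.idx (15, 0, 0) = cur → s'.idx (10, 0, 0) = i →
      (transferTest.Holds s' ↔ cur ≠ i) := by
    intro s' cur h h'
    simp only [transferTest, Test.Holds, IExpr.eval, h, h', ne_eq, Fin.ext_iff]
    omega
  -- At any time e has gained a chore and the current agent is one short; these cancel at the start.
  refine Spec.loop (I := fun v s' => Keep [1, 15, 16, 17] s s' ∧ s'.num = s.num ∧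
    ∃ (o' : Fin m → Fin n) (cur : Fin n), cur ∈ S ∧ s'.idx (15, 0, 0) = cur ∧ Own 1 o' s' ∧
      (∀ f, cnt o' H f + (if f = cur then 1 else 0) = cnt o H f + if f = e then 1 else 0) ∧
      (∀ j ∉ H, o' j = o j) ∧ (∀ j ∈ H, al (o' j) j ∨ o' j = o j) ∧
      (∀ j, ρ (o j) < ρ cur → o' j = o j) ∧ v = ρ cur) (v := ρ e) ?_ ?_ (hρ e heS).le ?_
  · rintro v s' ⟨h1, h2, o', cur, h3, h4, h5, h6, h7, h8, h9, rfl⟩ hb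
    rw [hT s' cur h4 (h1.eq hi)] at hb
    obtain ⟨j, c1, c2, c3, c4, c5⟩ := hS cur h3 hb
    have hoj := h9 j c5
    have e1 : s'.idx (6, 0, cur) = j := h1.eq c1
    have e2 : s'.idx (1, 0, j) = o j := by rw [← hoj]; exact h5 j
    refine spec_of_wp ?_
    simp only [transferBody, wp, IExpr.eval, Cell.addr, h4, setI_idx]
    simp only [e1, e2, if_true, if_false, and_self, and_true, Nat.reduceEqDiff, false_and]
    refine ⟨_, c5, h1.setI.setI.setI.setI, h2, Function.update o' j cur, o j, c4, by simp,
      ?_, ?_, ?_, ?_, ?_, rfl⟩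
    · intro l
      by_cases hl : l = j
      · subst hl; simp
      · have : (l : ℕ) ≠ j := fun hh => hl (Fin.ext hh)
        simpa [this, hl] using h5 l
    · intro f
      rw [← hoj, cnt_update o' c2]
      exact h6 f
    · intro l hl
      have : l ≠ j := fun hh => hl (hh ▸ c2)
      simpa [this] using h7 l hl
    · intro l hl
      by_cases hlj : l = j
      · subst hlj; simpa using Or.inl c3
      · simpa [hlj] using h8 l hl
    · intro l hl
      have : l ≠ j := fun hh => lt_irrefl _ (hh ▸ hl)
      simpa [this] using h9 l (hl.trans c5)
  · refine ⟨(Keep.refl _ _).setI, rfl, o, e, heS, by simp, fun l => by simpa using ho l, fun f => rfl,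
      fun _ _ => rfl, fun _ _ => Or.inr rfl, fun _ _ => rfl, rfl⟩
  · rintro v s' ⟨h1, h2, o', cur, h3, h4, h5, h6, h7, h8, h9, rfl⟩ hb
    rw [hT s' cur h4 (h1.eq hi), not_ne_iff] at hb
    subst hb
    exact ⟨h1, h2, o', h5, h6, h7, h8⟩

/-! ### Looking for envy -/

theorem good_load_add_top (hβ : β = 0 ∨ β = lo) (e i : Fin n) :
    Good lo hi m (load β hi o H e + top β hi o H i) := by
  have h1 := cnt_le o H e
  have h2 := cnt_le o Hᶜ e
  unfold load top
  split_ifs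
  · have := good_comb (hi := hi) hβ (u := cnt o Hᶜ e) (v := cnt o H e + 1) (m := m) (by omega)
      (by omega)
    convert this using 1
    push_cast
    ring
  · have := good_comb (hi := hi) hβ (u := cnt o Hᶜ e + 1) (v := cnt o H e) (m := m) (by omega)
      (by omega)
    convert this using 1
    push_cast
    ring

def searchBody : Prog :=
  .seq (.setNum (scal 6) (.add (cell 1 (var 11)) (cell 2 (var 10))))
    (.branch (.conj (onE (arr 5 (var 11))) (.neg (.leNum (cell 1 (var 10)) (scal 6))))
      (setV 14 (var 11)) skip)

/-- Looks for a marked agent whom agent `10` envies. -/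
def search : Prog := .seq (setV 14 nE) (forLoop 11 nE searchBody)

def searchSteps (n : ℕ) : ℕ := 6 + forSteps nE (steps searchBody) n

/-- The value n, which is no agent's number, signals that nobody was found. -/
theorem spec_search (hs : Cfg low H C hi β s) (hβ : β = 0 ∨ β = lo) {S : Set (Fin n)}
    (hS : Flag 5 S s) {i : Fin n} (hi' : s.idx (10, 0, 0) = i) (h1 : NumVals 1 (load β hi o H) s)
    (h2 : NumVals 2 (top β hi o H) s) :
    Spec (Good lo hi m) search s (searchSteps n) fun s' =>
      Keep [11, 14, 21] s s' ∧ KeepN [6] s s' ∧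
        ((s'.idx (14, 0, 0) = n ∧ ∀ e ∈ S, load β hi o H i ≤ load β hi o H e + top β hi o H i) ∨
          ∃ e ∈ S, s'.idx (14, 0, 0) = e ∧
            load β hi o H e + top β hi o H i < load β hi o H i) := by
  unfold search
  refine Spec.seq ((spec_of_wp (Q := fun s' => s' = s.setI (14, 0, 0) n)
    (by simp [wp, hs.n])).mono (by simp [steps, Cell.cost, IExpr.cost]) ?_)
  rintro _ rfl
  refine spec_forLoop (fun k s' => Keep [11, 14, 21] s s' ∧ KeepN [6] s s' ∧
        ((s'.idx (14, 0, 0) = n ∧ ∀ e ∈ S, (e : ℕ) < k →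
          load β hi o H i ≤ load β hi o H e + top β hi o H i) ∨
          ∃ e ∈ S, s'.idx (14, 0, 0) = e ∧
            load β hi o H e + top β hi o H i < load β hi o H i)) (fun k s' h => h.1.eq hs.n) ?_ ?_ ?_
  · rintro k hk s' ⟨a1, a2, a3⟩ hX
    have e1 : s'.num (1, 0, k) = load β hi o H ⟨k, hk⟩ := a2.numVals h1 (by decide) ⟨k, hk⟩
    have e2 : s'.num (2, 0, i) = top β hi o H i := a2.numVals h2 (by decide) i
    have e3 : s'.num (1, 0, i) = load β hi o H i := a2.numVals h1 (by decide) i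
    have e4 : 1 ≤ s'.idx (5, 0, k) ↔ ⟨k, hk⟩ ∈ S := a1.flag hS (by decide) ⟨k, hk⟩
    refine spec_of_wp ?_
    simp only [searchBody, wp, NumOp.Result, IExpr.eval, Cell.addr, Test.Holds, hX, a1.eq hi',
      exists_eq_left, setI_idx, setN_num, setN_idx, e1, e2, e4]
    simp only [if_true, if_false, and_self, and_true, Nat.reduceEqDiff, false_and, e3]
    refine ⟨good_load_add_top hβ _ _, ?_, ?_⟩
    · rintro ⟨b1, b2⟩
      exact ⟨trivial, a1.setN.setI.setI, (a2.setN).setI.setI,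
        Or.inr ⟨⟨k, hk⟩, b1, by simp, not_le.1 b2⟩⟩
    · intro hno
      refine ⟨trivial, a1.setN.setI.setI, (a2.setN).setI.setI, a3.imp ?_ ?_⟩
      · rintro ⟨c1, c2⟩
        refine ⟨by simpa using c1, fun e he hek => ?_⟩
        rcases Nat.lt_succ_iff_lt_or_eq.1 hek with h | h
        · exact c2 e he h
        · have : e = ⟨k, hk⟩ := Fin.ext h
          subst this
          by_contra hlt
          exact hno ⟨he, hlt⟩
      · rintro ⟨e, c1, c2, c3⟩
        exact ⟨e, c1, by simpa using c2, c3⟩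
  · exact ⟨(Keep.refl _ _).setI.setI, KeepN.refl _ _, Or.inl ⟨by simp, fun e _ he =>
      absurd he (Nat.not_lt_zero _)⟩⟩
  · rintro s' ⟨a1, a2, a3⟩
    exact ⟨a1, a2, a3.imp (fun h => ⟨h.1, fun e he => h.2 e he e.2⟩) id⟩

end

section

variable {n m : ℕ} {low : Fin n → Fin m → Prop} {H : Set (Fin m)} {C : Set (Fin n)}
  {s s' : State} {lo hi β : ℝ} {o : Fin m → Fin n}

/-! ### A potential for the number of transfers

An agent `f` has slots at the heights `base f + b * t`; her chores fill the lowest ones. -/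

open Classical in
/-- Number of slots below height `z`. -/
noncomputable def rank (m : ℕ) (base : Fin n → ℝ) (b z : ℝ) : ℕ :=
  (Finset.univ.filter fun x : Fin n × Fin m => base x.1 + b * (x.2 : ℕ) < z).card

/-- Total rank of the filled slots, when agent `f` owns `k f` chores. -/
noncomputable def potential (m : ℕ) (base : Fin n → ℝ) (b : ℝ) (k : Fin n → ℕ) : ℕ :=
  ∑ f, ∑ t ∈ Finset.range (k f), rank m base b (base f + b * t)

theorem rank_le (base : Fin n → ℝ) (b z : ℝ) : rank m base b z ≤ n * m := by
  classical
  exact (Finset.card_le_univ _).trans (by simp)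

/-- Using ranks instead of heights makes the bound independent of the real numbers involved. -/
theorem potential_le (base : Fin n → ℝ) (b : ℝ) {k : Fin n → ℕ} (hk : ∀ f, k f ≤ m) :
    potential m base b k ≤ n * (m * (n * m)) := by
  calc potential m base b k ≤ ∑ _f : Fin n, m * (n * m) := by
        refine Finset.sum_le_sum fun f _ => ?_
        calc ∑ t ∈ Finset.range (k f), rank m base b (base f + b * t)
            ≤ ∑ t ∈ Finset.range (k f), n * m := Finset.sum_le_sum fun _ _ => rank_le _ _ _
          _ = k f * (n * m) := by simp
          _ ≤ m * (n * m) := Nat.mul_le_mul_right _ (hk f)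
    _ = n * (m * (n * m)) := by simp

/-- A transfer empties the top slot of i and fills the next slot of e. Envy up to a chore of price b
says that the filled slot lies lower than the emptied one. -/
theorem potential_lt {base : Fin n → ℝ} {b : ℝ} {k k' : Fin n → ℕ} {i e : Fin n} (hie : i ≠ e)
    (hk : ∀ f, k' f + (if f = i then 1 else 0) = k f + if f = e then 1 else 0)
    (he : k' e ≤ m) (hlt : base e + b * k e + b < base i + b * k i) :
    potential m base b k' < potential m base b k := by
  classical
  have h1 := hk i
  have h2 := hk e
  simp only [if_true, hie, hie.symm, if_false, add_zero] at h1 h2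
  have key : potential m base b k' + rank m base b (base i + b * k' i) =
      potential m base b k + rank m base b (base e + b * k e) := by
    have hi' : rank m base b (base i + b * k' i) =
        ∑ f, if f = i then rank m base b (base f + b * k' f) else 0 := by simp
    have he' : rank m base b (base e + b * k e) =
        ∑ f, if f = e then rank m base b (base f + b * k f) else 0 := by simp
    rw [hi', he', potential, potential, ← Finset.sum_add_distrib, ← Finset.sum_add_distrib]
    refine Finset.sum_congr rfl fun f _ => ?_
    by_cases hfi : f = i
    · subst hfi
      simp [hie, ← h1, Finset.sum_range_succ]
    · by_cases hfe : f = e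
      · subst hfe
        simp [hfi, h2, Finset.sum_range_succ]
      · have := hk f
        simp only [hfi, hfe, if_false, add_zero] at this
        simp [hfi, hfe, this]
  have hr : rank m base b (base e + b * k e) < rank m base b (base i + b * k' i) := by
    have h3 : base e + b * k e < base i + b * k' i := by
      rw [← h1] at hlt
      push_cast at hlt
      linarith
    refine Finset.card_lt_card ?_
    rw [Finset.ssubset_iff_of_subset]
    -- The slot filled by e lies below the emptied one but not below itself, so the rank drops
    -- strictly.
    · refine ⟨(e, ⟨k e, by omega⟩), ?_, ?_⟩
      · simpa using h3
      · simp
    · intro x hx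
      simp only [Finset.mem_filter, Finset.mem_univ, true_and] at hx ⊢
      exact hx.trans h3
  omega

/-! ### Balancing -/

def clearBody : Prog := setA 5 (var 11) (.const 0)

def balanceBody : Prog :=
  .seq loads (.seq (forLoop 11 nE clearBody) (.seq (setA 5 (var 10) (.const 1)) (.seq reach
    (.seq search (.branch (ltE (var 14) nE) (.seq transfer (setV 10 (.const 0)))
      (setV 10 (.add (var 10) (.const 1))))))))

/-- Passes chores of high price along paths until the owners are balanced. -/
def balance : Prog := .seq (setV 10 (.const 0)) (.loop (ltE (var 10) nE) balanceBody)

def balanceBodySteps (n m : ℕ) : ℕ :=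
  loadsSteps n m + (forSteps nE (steps clearBody) n + (steps (setA 5 (var 10) (.const 1)) +
    (reachSteps n m + (searchSteps n + ((ltE (var 14) nE).cost + (transferSteps n + 8))))))

def balanceSteps (n m : ℕ) : ℕ :=
  4 + ((n * (m * (n * m)) * (n + 1) + n) * ((ltE (var 10) nE).cost + balanceBodySteps n m) +
    (ltE (var 10) nE).cost)

/-- Agents before the pointer 10 envy nobody reachable; a transfer may spoil this, so the pointer
then returns to 0. The variant is the potential times n + 1 plus the number of agents still to be
examined. -/
theorem spec_balance (hn : 0 < n) (hs : Cfg low H C hi β s) (hβ : β = 0 ∨ β = lo) (hβ0 : 0 ≤ β)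
    (hhi : 0 < hi) (ho : Own 1 o s) :
    Spec (Good lo hi m) balance s (balanceSteps n m) fun s' =>
      Keep [1, 5, 6, 9, 10, 11, 12, 14, 15, 16, 17, 21] s s' ∧ KeepN [1, 2, 6] s s' ∧
        ∃ o' : Fin m → Fin n, Own 1 o' s' ∧ (∀ j ∉ H, o' j = o j) ∧
          (∀ j ∈ H, Allowed low C (o' j) j ∨ o' j = o j) ∧
          Balanced β hi o' H (Allowed low C) := by
  unfold balance
  refine Spec.seq ((spec_of_wp (Q := fun s' => s' = s.setI (10, 0, 0) 0) (by simp [wp])).mono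
    (by simp [steps, Cell.cost, IExpr.cost]) ?_)
  rintro _ rfl
  -- Low-priced chores never move here, so their contribution is a constant ground level for the
  -- slots.
  let base : Fin n → ℝ := fun f => β * cnt o Hᶜ f
  refine Spec.loop (I := fun v s' =>
      Keep [1, 5, 6, 9, 10, 11, 12, 14, 15, 16, 17, 21] s s' ∧ KeepN [1, 2, 6] s s' ∧
      s'.idx (10, 0, 0) ≤ n ∧
        ∃ o' : Fin m → Fin n, Own 1 o' s' ∧ (∀ j ∉ H, o' j = o j) ∧
          (∀ j ∈ H, Allowed low C (o' j) j ∨ o' j = o j) ∧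
          (∀ i : Fin n, (i : ℕ) < s'.idx (10, 0, 0) → ∀ e,
            Relation.ReflTransGen (Link o' H (Allowed low C)) i e →
              load β hi o' H i ≤ load β hi o' H e + top β hi o' H i) ∧
          v = potential m base hi (cnt o' H) * (n + 1) + (n - s'.idx (10, 0, 0)))
    (v := potential m base hi (cnt o H) * (n + 1) + n) ?_ ?_ ?_ ?_
  · rintro v s₁ ⟨k1, k2, h10, o₁, ho₁, hfix, hal, hbal, rfl⟩ hb
    simp only [Test.Holds, IExpr.eval, k1.eq hs.n] at hb
    generalize hi10 : s₁.idx (10, 0, 0) = i' at *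
    obtain ⟨i, rfl⟩ : ∃ i : Fin n, i' = i := ⟨⟨i', hb⟩, rfl⟩
    refine Spec.seq ((spec_loads (hs.keep k1 k2) hβ ho₁).mono le_rfl ?_)
    rintro s₂ ⟨a1, a2, a3, a4, -⟩
    refine Spec.seq ((spec_map (X := 11) (A := 5) (k := n) (e := nE) (fun _ => 0) (by decide) (fun s' h => h.eq (a1.eq (k1.eq hs.n)))
      fun r hr s' h _ hX => by simp [clearBody, wp, hX]).mono le_rfl ?_)
    rintro s₃ ⟨b1, b2, b3⟩
    have b1' : KeepN [] s₂ s₃ := fun _ _ _ _ => by rw [b2]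
    have hi3 : s₃.idx (10, 0, 0) = i := b1.eq (a1.eq hi10)
    refine Spec.seq ((spec_of_wp (Q := fun s' => s' = s₃.setI (5, 0, i) 1)
      (by simp [wp, hi3])).mono le_rfl ?_)
    rintro s₄ hs₄
    have c1 : Keep [5, 9, 11, 12] s₁ s₄ := by
      rw [hs₄]; exact (a1.trans b1 (L'' := [5, 9, 11, 12])).setI
    have c2 : KeepN [1, 2] s₁ s₄ := by
      rw [hs₄]; exact (a2.trans b1' (L'' := [1, 2])).setI
    have hmark : Flag 5 {i} s₄ := by
      intro f
      by_cases hf : f = i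
      · subst hf; simp [hs₄]
      · simp [hs₄, hf, Fin.val_inj, b3 f f.2]
    have d3 : NumVals 1 (load β hi o₁ H) s₄ := by
      rw [hs₄]; exact b1'.numVals a3
    have d4 : NumVals 2 (top β hi o₁ H) s₄ := by
      rw [hs₄]; exact b1'.numVals a4
    have c1s := k1.trans c1 (L'' := [1, 5, 6, 9, 10, 11, 12, 14, 15, 16, 17, 21])
    have c2s := k2.trans c2 (L'' := [1, 2, 6])
    refine Spec.seq ((spec_reach hn (hs.keep c1s c2s) (c1.vals ho₁) hmark).mono le_rfl ?_)
    rintro s₅ ⟨e1, e2, S, ρ, hS, hsub, hforest, hρ, hclosed⟩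
    have e2' : KeepN [] s₄ s₅ := fun _ _ _ _ => by rw [e2]
    have f1 := c1s.trans e1 (L'' := [1, 5, 6, 9, 10, 11, 12, 14, 15, 16, 17, 21])
    have f2 := c2s.trans e2' (L'' := [1, 2, 6])
    have hi5 : s₅.idx (10, 0, 0) = i := e1.eq (c1.eq hi10)
    refine Spec.seq ((spec_search (hs.keep f1 f2) hβ hS hi5 (e2'.numVals d3)
      (e2'.numVals d4)).mono le_rfl ?_)
    rintro s₆ ⟨g1, g2, g3⟩
    have f1' := f1.trans g1 (L'' := [1, 5, 6, 9, 10, 11, 12, 14, 15, 16, 17, 21])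
    have f2' := f2.trans g2 (L'' := [1, 2, 6])
    have hi6 : s₆.idx (10, 0, 0) = i := g1.eq hi5
    have ho6 : Own 1 o₁ s₆ := g1.vals (e1.vals (c1.vals ho₁))
    refine Spec.branch ?_ ?_
    · intro hlt
      simp only [Test.Holds, IExpr.eval, f1'.eq hs.n] at hlt
      obtain ⟨e, heS, he, hviol⟩ := g3.resolve_left (fun h => by omega)
      refine Spec.seq (T₂ := 8) ((spec_transfer (H := H) (al := Allowed low C) (S := S) (ρ := ρ)
        ho6 hi6 he ?_ hρ heS).mono le_rfl ?_)
      · intro f hf hf'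
        obtain ⟨j, q1, q2⟩ := hforest f hf hf'
        exact ⟨j, g1.eq q1, q2⟩
      rintro s₇ ⟨l1, l2, o₂, l3, l4, l5, l6⟩
      refine (spec_of_wp (Q := fun s' => s' = s₇.setI (10, 0, 0) 0) (by simp [wp])).mono
        (by simp [steps, Cell.cost, IExpr.cost]) ?_
      rintro _ rfl
      have l2' : KeepN [] s₆ s₇ := fun _ _ _ _ => by rw [l2]
      refine ⟨potential m base hi (cnt o₂ H) * (n + 1) + n, ?_,
        (f1'.trans l1 (L'' := [1, 5, 6, 9, 10, 11, 12, 14, 15, 16, 17, 21])).setI,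
        (f2'.trans l2' (L'' := [1, 2, 6])).setI, by simp, o₂, fun j => by simpa using l3 j,
        fun j hj => (l5 j hj).trans (hfix j hj), ?_, ?_, by simp⟩
      · obtain ⟨i₀, hi₀, hr⟩ := hforest.reach heS
        obtain rfl : i₀ = i := hi₀
        have hb1 : ∀ f, cnt o₁ Hᶜ f = cnt o Hᶜ f := fun f =>
          cnt_congr fun j => and_congr_left fun hj => by rw [hfix j hj]
        have hie : i₀ ≠ e := by
          rintro rfl
          have : 0 ≤ top β hi o₁ H i₀ := by
            unfold top; split_ifs
            exacts [hhi.le, hβ0]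
          linarith
        -- A nontrivial path starts with a chore of high price, so the envy is measured up to the
        -- price `hi`.
        have hpos : ∃ j ∈ H, o₁ j = i₀ := by
          rcases Relation.ReflTransGen.cases_head hr with h | ⟨x, ⟨j, hj, hj', -⟩, -⟩
          · exact absurd h hie
          · exact ⟨j, hj, hj'⟩
        rw [top_of_mem hpos, load, load, hb1, hb1] at hviol
        have := potential_lt (m := m) (base := base) (b := hi) (k := cnt o₁ H) (k' := cnt o₂ H)
          hie l4 (cnt_le _ _ _) (by simp only [base]; linarith)
        have := Nat.mul_le_mul_right (n + 1) this
        rw [Nat.succ_mul] at this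
        omega
      · intro j hj
        rcases l6 j hj with h | h
        · exact Or.inl h
        · rw [h]; exact hal j hj
      · intro f hf
        simp at hf
    · intro hge
      simp only [Test.Holds, IExpr.eval, f1'.eq hs.n] at hge
      have hno : ∀ e ∈ S, load β hi o₁ H i ≤ load β hi o₁ H e + top β hi o₁ H i := by
        rcases g3 with h | ⟨e, -, he, -⟩
        · exact h.2
        · have := e.2
          omega
      refine (spec_of_wp (Q := fun s' => s' = s₆.setI (10, 0, 0) (i + 1)) (by simp [wp, hi6])).mono
        (by simp [steps, Cell.cost, IExpr.cost]) ?_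
      rintro _ rfl
      have hilt := i.2
      refine ⟨_, ?_, f1'.setI, f2'.setI, ?_, o₁, fun j => by simpa using ho6 j, hfix, hal, ?_, rfl⟩
      · simp
        omega
      · simp
      · intro f hf e hr
        simp only [setI_idx, and_self, if_true] at hf
        rcases Nat.lt_succ_iff_lt_or_eq.1 hf with h | h
        · exact hbal f h e hr
        · obtain rfl : f = i := Fin.ext h
          refine hno e ?_
          induction hr with
          | refl => exact hsub rfl
          | tail _ hl ih =>
            obtain ⟨j, q1, rfl, q3⟩ := hl
            exact hclosed j q1 ih _ q3
  · exact ⟨(Keep.refl _ _).setI, KeepN.refl _ _, by simp, o, fun j => by simpa using ho j,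
      fun _ _ => rfl, fun _ _ => Or.inr rfl, fun i hi' => by simp at hi', by simp⟩
  · have := Nat.mul_le_mul_right (n + 1) (potential_le (m := m) base hi (cnt_le o H))
    omega
  · rintro v s₁ ⟨k1, k2, h10, o₁, ho₁, hfix, hal, hbal, -⟩ hb
    simp only [Test.Holds, IExpr.eval, k1.eq hs.n] at hb
    exact ⟨k1, k2, o₁, ho₁, hfix, hal, fun i e hr => hbal i (by have := i.2; omega) e hr⟩

/-! ### Checking for envy -/

def checkBody : Prog :=
  .seq (.setNum (scal 6) (.add (cell 1 (var 11)) (cell 2 (var 10))))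
    (.branch (.leNum (cell 1 (var 10)) (scal 6)) skip (setV 19 (.const 1)))

/-- Sets the variable `19` if there is envy between any two agents. -/
def check : Prog :=
  .seq loads (.seq (setV 19 (.const 0)) (forLoop 10 nE (forLoop 11 nE checkBody)))

def checkSteps (n m : ℕ) : ℕ :=
  loadsSteps n m + (4 + forSteps nE (forSteps nE (steps checkBody) n) n)

theorem spec_check (hs : Cfg low H C hi β s) (hβ : β = 0 ∨ β = lo) (ho : Own 1 o s) :
    Spec (Good lo hi m) check s (checkSteps n m) fun s' =>
      Keep [9, 10, 11, 12, 19, 21] s s' ∧ KeepN [1, 2, 6] s s' ∧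
        (1 ≤ s'.idx (19, 0, 0) ↔ ∃ i e, load β hi o H e + top β hi o H i < load β hi o H i) := by
  unfold check
  refine Spec.seq ((spec_loads hs hβ ho).mono le_rfl ?_)
  rintro s₁ ⟨a1, a2, a3, a4, -⟩
  refine Spec.seq ((spec_of_wp (Q := fun s' => s' = s₁.setI (19, 0, 0) 0) (by simp [wp])).mono
    (by simp [steps, Cell.cost, IExpr.cost]) ?_)
  rintro _ rfl
  let I : ℕ → ℕ → State → Prop := fun k l s' =>
    Keep [10, 11, 19, 21] s₁ s' ∧ KeepN [6] s₁ s' ∧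
      (1 ≤ s'.idx (19, 0, 0) ↔ ∃ i e : Fin n, ((i : ℕ) < k ∨ (i : ℕ) = k ∧ (e : ℕ) < l) ∧
        load β hi o H e + top β hi o H i < load β hi o H i)
  refine spec_forLoop (fun k => I k 0) (fun k s' h => h.1.eq (a1.eq hs.n)) ?_ ?_ ?_
  · intro k hk s₂ hI2 hX
    refine spec_forLoop (fun l s' => I k l s' ∧ s'.idx (10, 0, 0) = k)
      (fun l s' h => h.1.1.eq (a1.eq hs.n)) ?_ ?_ ?_
    · rintro l hl s₃ ⟨⟨b1, b2, b3⟩, b4⟩ hX'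
      have e1 : s₃.num (1, 0, l) = load β hi o H ⟨l, hl⟩ := b2.numVals a3 (by decide) ⟨l, hl⟩
      have e2 : s₃.num (2, 0, k) = top β hi o H ⟨k, hk⟩ := b2.numVals a4 (by decide) ⟨k, hk⟩
      have e3 : s₃.num (1, 0, k) = load β hi o H ⟨k, hk⟩ := b2.numVals a3 (by decide) ⟨k, hk⟩
      have hiff : (∃ i e : Fin n, ((i : ℕ) < k ∨ (i : ℕ) = k ∧ (e : ℕ) < l + 1) ∧
          load β hi o H e + top β hi o H i < load β hi o H i) ↔
          1 ≤ s₃.idx (19, 0, 0) ∨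
          load β hi o H ⟨l, hl⟩ + top β hi o H ⟨k, hk⟩ < load β hi o H ⟨k, hk⟩ := by
        rw [b3]
        constructor
        · rintro ⟨i, e, h1, h2⟩
          by_cases h : (i : ℕ) = k ∧ (e : ℕ) = l
          · obtain ⟨rfl, rfl⟩ := h
            exact Or.inr h2
          · exact Or.inl ⟨i, e, by omega, h2⟩
        · rintro (⟨i, e, h1, h2⟩ | h)
          · exact ⟨i, e, by omega, h2⟩
          · exact ⟨_, _, Or.inr ⟨rfl, Nat.lt_succ_self _⟩, h⟩
      refine spec_of_wp ?_
      simp only [checkBody, wp, NumOp.Result, IExpr.eval, Cell.addr, Test.Holds, hX', b4,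
        exists_eq_left, setI_idx, setN_num, setN_idx, e1, e2]
      simp only [if_true, if_false, and_self, and_true, Nat.reduceEqDiff, false_and, e3]
      refine ⟨good_load_add_top hβ _ _, ?_, ?_⟩
      · intro hle
        refine ⟨trivial, b1.setN.setI.setI, (b2.setN).setI.setI, ?_⟩
        rw [hiff]
        simp only [setI_idx, setN_idx, Nat.reduceEqDiff, false_and, if_false, iff_self_or]
        exact fun h => absurd hle h.not_ge
      · intro hlt
        refine ⟨trivial, b1.setN.setI.setI, (b2.setN).setI.setI, ?_⟩
        rw [hiff]
        simp only [setI_idx, and_self, Nat.reduceEqDiff, false_and, if_false, if_true, le_refl,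
          true_iff]
        exact Or.inr (not_le.1 hlt)
    · exact ⟨⟨hI2.1.setI, hI2.2.1.setI, by simpa using hI2.2.2⟩, by simpa using hX⟩
    · rintro s₃ ⟨⟨b1, b2, b3⟩, b4⟩
      refine ⟨b4, b1.setI, b2.setI, ?_⟩
      simp only [setI_idx, Nat.reduceEqDiff, false_and, if_false, b3]
      refine exists_congr fun i => exists_congr fun e => and_congr_left fun _ => ?_
      have := e.2
      omega
  · refine ⟨(Keep.refl _ _).setI.setI, KeepN.refl _ _, ?_⟩
    simp
  · rintro s₂ ⟨b1, b2, b3⟩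
    refine ⟨a1.trans b1, a2.trans b2, ?_⟩
    rw [b3]
    refine exists_congr fun i => exists_congr fun e => and_iff_right (Or.inl i.2)

end

section

variable {n m : ℕ} {low : Fin n → Fin m → Prop} {U : Set (Fin m)} {C : Set (Fin n)}
  {lo hi β : ℝ} {o₀ : Fin m → Fin n} {s s' : State}

theorem KeepN.of_eq (h : s'.num = s.num) : KeepN [] s s' := fun _ _ _ _ => by rw [h]

/-! ### One stage -/

/-- The data that persist between stages: the easiness relation, the chores that are easy for
nobody, owners who find the other chores easy, and the prices. -/
structure Base {n m : ℕ} (low : Fin n → Fin m → Prop) (U : Set (Fin m)) (o₀ : Fin m → Fin n)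
    (lo hi : ℝ) (s : State) : Prop where
  n : s.idx (0, 0, 0) = n
  m : s.idx (0, 0, 1) = m
  low : Flag₂ 2 low s
  hard : Flag 8 U s
  own : Own 7 o₀ s
  lo : s.num (3, 0, 0) = lo
  hi : s.num (4, 0, 0) = hi

theorem Base.keep (h : Base low U o₀ lo hi s) {L L' : List ℕ} (hk : Keep L s s')
    (hk' : KeepN L' s s') (h0 : 0 ∉ L := by decide) (h2 : 2 ∉ L := by decide)
    (h7 : 7 ∉ L := by decide) (h8 : 8 ∉ L := by decide) (h3' : 3 ∉ L' := by decide)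
    (h4' : 4 ∉ L' := by decide) : Base low U o₀ lo hi s' :=
  ⟨hk.eq h.n h0, hk.eq h.m h0, hk.flag₂ h.low h2, hk.flag h.hard h8, hk.vals h.own h7,
    hk'.eq h.lo h3', hk'.eq h.hi h4'⟩

def restoreOwn : Prog := setA 1 (var 12) (arr 7 (var 12))
def restoreMv : Prog := setA 3 (var 12) (.sub (.const 1) (arr 8 (var 12)))
-- Formally all agents count as raised, which reduces `Allowed` to easiness (`allowed_univ`).
def restoreFree : Prog := setA 4 (var 11) (.const 0)

/-- Returns to the initial owners; only the chores that are easy for somebody can be passed. -/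
def restore : Prog :=
  .seq (forLoop 12 mE restoreOwn) (.seq (forLoop 12 mE restoreMv) (forLoop 11 nE restoreFree))

def restoreSteps (n m : ℕ) : ℕ :=
  forSteps mE (steps restoreOwn) m + (forSteps mE (steps restoreMv) m +
    forSteps nE (steps restoreFree) n)

theorem spec_restore {G : ℝ → Prop} (hs : Base low U o₀ lo hi s) (hβ : s.num (5, 0, 0) = β) :
    Spec G restore s (restoreSteps n m) fun s' =>
      Keep [1, 3, 4, 11, 12] s s' ∧ s'.num = s.num ∧ Cfg low Uᶜ Set.univ hi β s' ∧ Own 1 o₀ s' := by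
  unfold restore
  refine Spec.seq ((spec_map (X := 12) (A := 1) (k := m) (e := mE) (fun k => s.idx (7, 0, k))
    (by decide) (fun s' h => h.eq hs.m)
    fun r hr s' h _ hX => by simp [restoreOwn, wp, hX, h 7 (by decide)]).mono le_rfl ?_)
  rintro s₁ ⟨a1, a2, a3⟩
  refine Spec.seq ((spec_map (X := 12) (A := 3) (k := m) (e := mE) (fun k => 1 - s.idx (8, 0, k))
    (by decide) (fun s' h => h.eq (a1.eq hs.m))
    fun r hr s' h _ hX => by
      simp [restoreMv, wp, hX, h 8 (by decide), a1 8 (by decide)]).mono le_rfl ?_)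
  rintro s₂ ⟨b1, b2, b3⟩
  refine (spec_map (X := 11) (A := 4) (k := n) (e := nE) (fun _ => 0)
    (by decide) (fun s' h => h.eq (b1.eq (a1.eq hs.n)))
    fun r hr s' h _ hX => by simp [restoreFree, wp, hX]).mono le_rfl ?_
  rintro s₃ ⟨c1, c2, c3⟩
  have k := (a1.trans b1 (L'' := [1, 3, 12])).trans c1 (L'' := [1, 3, 4, 11, 12])
  have e : s₃.num = s.num := c2.trans (b2.trans a2)
  refine ⟨k, e, ⟨k.eq hs.n, k.eq hs.m, k.flag₂ hs.low, ?_, ?_, by rw [e]; exact hs.hi,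
    by rw [e]; exact hβ⟩, ?_⟩
  · intro j
    rw [c1 3 (by decide), b3 j j.2, Set.mem_compl_iff, ← hs.hard j]
    omega
  · intro i
    simp [c3 i i.2]
  · exact c1.vals (b1.vals fun j => (a3 j j.2).trans (hs.own j))

def freeBody : Prog := .branch (onE (arr 5 (var 11))) skip (setV 20 (var 11))
def raiseFree : Prog := setA 4 (var 11) (.sub (.const 1) (arr 5 (var 11)))
def raiseMv : Prog := setA 3 (var 12) (.add (arr 8 (var 12)) (arr 5 (arr 7 (var 12))))
def raiseOwn : Prog :=
  .branch (onE (arr 8 (var 12))) (setA 1 (var 12) (var 20)) (setA 1 (var 12) (arr 7 (var 12)))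

/-- Raises the marked agents and gives the chores that are hard for everybody to some agent who is
not raised. -/
def raise : Prog :=
  .seq (setV 20 (.const 0)) (.seq (forLoop 11 nE freeBody) (.seq (forLoop 11 nE raiseFree)
    (.seq (forLoop 12 mE raiseMv) (.seq (forLoop 12 mE raiseOwn)
      (.setNum (scal 5) (.copy (scal 3)))))))

def raiseSteps (n m : ℕ) : ℕ :=
  4 + (forSteps nE (steps freeBody) n + (forSteps nE (steps raiseFree) n +
    (forSteps mE (steps raiseMv) m + (forSteps mE (steps raiseOwn) m +
      steps (.setNum (scal 5) (.copy (scal 3)))))))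

-- The first scan stores the last unmarked agent. If all agents are marked, the default 0 remains
-- and the chores in `U` go to a raised agent; the property of z is therefore conditional.
open Classical in
theorem spec_raise (hn : 0 < n) (hs : Base low U o₀ lo hi s) (hC : Flag 5 C s) :
    Spec (Good lo hi m) raise s (raiseSteps n m) fun s' =>
      Keep [1, 3, 4, 11, 12, 20, 21] s s' ∧ KeepN [5] s s' ∧
        Cfg low (raised U o₀ C) C hi lo s' ∧
        ∃ z : Fin n, ((∃ z', z' ∉ C) → z ∉ C) ∧ Own 1 (fun j => if j ∈ U then z else o₀ j) s' := by
  unfold raise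
  refine Spec.seq ((spec_of_wp (Q := fun s' => s' = s.setI (20, 0, 0) 0) (by simp [wp])).mono
    (by simp [steps, Cell.cost, IExpr.cost]) ?_)
  rintro _ rfl
  refine Spec.seq ((spec_forLoop (X := 11) (e := nE) (k := n) (Q := fun s' => Keep [11, 20, 21] s s' ∧ s'.num = s.num ∧
    ∃ z : Fin n, s'.idx (20, 0, 0) = z ∧ ((∃ z', z' ∉ C) → z ∉ C))
    (fun k s' => Keep [11, 20, 21] s s' ∧ s'.num = s.num ∧ ∃ z : Fin n, s'.idx (20, 0, 0) = z ∧
      ((∃ z', z' ∉ C ∧ (z' : ℕ) < k) → z ∉ C)) (fun k s' h => h.1.eq hs.n) ?_ ?_ ?_).mono le_rfl ?_)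
  · rintro k hk s' ⟨h1, h2, z, h3, h4⟩ hX
    have e1 : 1 ≤ s'.idx (5, 0, k) ↔ ⟨k, hk⟩ ∈ C := h1.flag hC (by decide) ⟨k, hk⟩
    refine spec_of_wp ?_
    simp only [freeBody, wp, IExpr.eval, Cell.addr, Test.Holds, hX, e1, setI_idx]
    constructor
    · intro hmem
      refine ⟨by simp, h1.setI.setI, h2, z, by simpa using h3, ?_⟩
      rintro ⟨z', hz', hlt⟩
      refine h4 ⟨z', hz', ?_⟩
      have : (z' : ℕ) ≠ k := by
        rintro rfl
        exact hz' hmem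
      omega
    · intro hmem
      exact ⟨by simp, h1.setI.setI, h2, ⟨k, hk⟩, by simp, fun _ => hmem⟩
  · exact ⟨(Keep.refl _ _).setI.setI, rfl, ⟨0, hn⟩, by simp, by simp⟩
  · rintro s' ⟨h1, h2, z, h3, h4⟩
    exact ⟨h1, h2, z, h3, fun ⟨z', hz'⟩ => h4 ⟨z', hz', z'.2⟩⟩
  rintro s₁ ⟨a1, a2, z, hz, hzC⟩
  refine Spec.seq ((spec_map (X := 11) (A := 4) (k := n) (e := nE) (fun k => 1 - s.idx (5, 0, k))
    (by decide) (fun s' h => h.eq (a1.eq hs.n))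
    fun r hr s' h _ hX => by
      simp [raiseFree, wp, hX, h 5 (by decide), a1 5 (by decide)]).mono le_rfl ?_)
  rintro s₂ ⟨b1, b2, b3⟩
  have b1' := a1.trans b1 (L'' := [4, 11, 20, 21])
  refine Spec.seq ((spec_map (X := 12) (A := 3) (k := m) (e := mE)
    (fun k => s.idx (8, 0, k) + s.idx (5, 0, s.idx (7, 0, k)))
    (by decide) (fun s' h => h.eq (b1'.eq hs.m))
    fun r hr s' h _ hX => by
      simp [raiseMv, wp, hX, h 5 (by decide), b1' 5 (by decide), h 7 (by decide),
        b1' 7 (by decide), h 8 (by decide), b1' 8 (by decide)]).mono le_rfl ?_)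
  rintro s₃ ⟨c1, c2, c3⟩
  have c1' := b1'.trans c1 (L'' := [3, 4, 11, 12, 20, 21])
  have hz3 : s₃.idx (20, 0, 0) = z := c1.eq (b1.eq hz)
  refine Spec.seq ((spec_map (X := 12) (A := 1) (k := m) (e := mE)
    (fun k => if 1 ≤ s.idx (8, 0, k) then (z : ℕ) else s.idx (7, 0, k))
    (by decide) (fun s' h => h.eq (c1'.eq hs.m))
    fun r hr s' h _ hX => by
      simp only [raiseOwn, wp, hX, IExpr.eval, Cell.addr, Test.Holds, h.eq hz3, h 7 (by decide),
        c1' 7 (by decide), h 8 (by decide), c1' 8 (by decide)]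
      exact ⟨fun h => by rw [if_pos h], fun h => by rw [if_neg h]⟩).mono le_rfl ?_)
  rintro s₄ ⟨d1, d2, d3⟩
  have d1' := c1'.trans d1 (L'' := [1, 3, 4, 11, 12, 20, 21])
  have e : s₄.num = s.num := d2.trans (c2.trans (b2.trans a2))
  have hlo : s₄.num (3, 0, 0) = lo := by rw [e]; exact hs.lo
  have hhi : s₄.num (4, 0, 0) = hi := by rw [e]; exact hs.hi
  refine (spec_of_wp (Q := fun s' => s' = s₄.setN (5, 0, 0) lo) ?_).mono le_rfl ?_
  · simp [wp, hlo, good_lo]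
  rintro _ rfl
  refine ⟨d1', ?_, ⟨d1'.eq hs.n, d1'.eq hs.m, d1'.flag₂ hs.low, ?_, ?_, by simpa using hhi,
    by simp⟩, z, hzC, ?_⟩
  · exact KeepN.setN fun A _ i j => by rw [e]
  · intro j
    rw [setN_idx, d1 3 (by decide), c3 j j.2]
    have h1 : 1 ≤ s.idx (8, 0, j) ↔ j ∈ U := hs.hard j
    have h2 : s.idx (7, 0, j) = o₀ j := hs.own j
    have h3 : 1 ≤ s.idx (5, 0, o₀ j) ↔ o₀ j ∈ C := hC (o₀ j)
    show _ ↔ j ∈ U ∨ o₀ j ∈ C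
    rw [h2, ← h1, ← h3]
    omega
  · intro i
    rw [setN_idx, d1 4 (by decide), c1 4 (by decide), b3 i i.2, Set.mem_compl_iff, ← hC i]
    omega
  · intro j
    have h2 : s.idx (7, 0, j) = o₀ j := hs.own j
    have h3 : 1 ≤ s.idx (8, 0, j) ↔ j ∈ U := hs.hard j
    rw [setN_idx, d3 j j.2]
    simp only [h3, h2]
    split_ifs <;> rfl

/-- By truncated subtraction the flag is positive exactly if the count is at least the threshold,
also for threshold 0. -/
def sourceBody : Prog :=
  setA 5 (var 11) (.sub (.add (arr 9 (var 11)) (.const 1)) (var 18))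

/-- Raises the agents with at least `18` chores and those reachable from them, balances the owners
of the chores of high price, checks for envy and decreases the threshold. -/
def stage : Prog :=
  .seq restore (.seq loads (.seq (forLoop 11 nE sourceBody) (.seq reach (.seq raise
    (.seq balance (.seq check (setV 18 (.sub (var 18) (.const 1)))))))))

def stageSteps (n m : ℕ) : ℕ :=
  restoreSteps n m + (loadsSteps n m + (forSteps nE (steps sourceBody) n + (reachSteps n m +
    (raiseSteps n m + (balanceSteps n m + (checkSteps n m +
      steps (setV 18 (.sub (var 18) (.const 1)))))))))

theorem allowed_univ (low : Fin n → Fin m → Prop) : Allowed low Set.univ = low := by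
  funext e j
  simp [Allowed]

/-- The low price β left over from earlier is 0 or `lo`; it does not matter, since only the counts
from the first call of `loads` are used. A proper stage is claimed only if somebody lies outside
`C`, to hold the chores in `U`. -/
theorem spec_stage (hn : 0 < n) (hs : Base low U o₀ lo hi s) (hβ : s.num (5, 0, 0) = β)
    (hβ' : β = 0 ∨ β = lo) (hlo : 0 < lo) (hle : lo ≤ hi) (h₀ : ∀ j ∉ U, low (o₀ j) j)
    (hbal : Balanced 0 hi o₀ Uᶜ low) {τ : ℕ} (hτ : s.idx (18, 0, 0) = τ) :
    Spec (Good lo hi m) stage s (stageSteps n m) fun s' =>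
      Base low U o₀ lo hi s' ∧ s'.num (5, 0, 0) = lo ∧ s'.idx (18, 0, 0) = τ - 1 ∧
        ∃ C o, IsLayer low U o₀ τ C ∧ Own 1 o s' ∧
          ((∃ z, z ∉ C) → IsStage low U o₀ lo hi C o) ∧
          (1 ≤ s'.idx (19, 0, 0) ↔ ∃ i e, load lo hi o (raised U o₀ C) e +
            top lo hi o (raised U o₀ C) i < load lo hi o (raised U o₀ C) i) := by
  classical
  have hhi := hlo.trans_le hle
  unfold stage
  refine Spec.seq ((spec_restore hs hβ).mono le_rfl ?_)
  rintro s₁ ⟨a1, a2, a3, a4⟩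
  have ha := KeepN.of_eq a2
  refine Spec.seq ((spec_loads a3 hβ' a4).mono le_rfl ?_)
  rintro s₂ ⟨b1, b2, -, -, b5⟩
  have b1' := a1.trans b1 (L'' := [1, 3, 4, 9, 11, 12])
  have b2' := ha.trans b2 (L'' := [1, 2])
  refine Spec.seq ((spec_map (X := 11) (A := 5) (k := n) (e := nE)
    (fun k => s₂.idx (9, 0, k) + 1 - τ) (by decide) (fun s' h => h.eq (b1'.eq hs.n))
    fun r hr s' h _ hX => by
      simp [sourceBody, wp, hX, h 9 (by decide), h.eq (b1'.eq hτ)]).mono le_rfl ?_)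
  rintro s₃ ⟨c1, c2, c3⟩
  have hc := KeepN.of_eq c2
  have c1' := b1'.trans c1 (L'' := [1, 3, 4, 5, 9, 11, 12])
  have c2' := b2'.trans hc (L'' := [1, 2])
  have hsrc : Flag 5 {i | τ ≤ cnt o₀ Uᶜ i} s₃ := by
    intro i
    have := b5 i
    rw [c3 i i.2, this, Set.mem_ofPred_eq]
    omega
  have hcfg : Cfg low Uᶜ Set.univ hi β s₃ :=
    a3.keep (b1.trans c1 (L'' := [5, 9, 11, 12])) (b2.trans hc (L'' := [1, 2]))
  refine Spec.seq ((spec_reach hn hcfg (c1.vals (b1.vals a4)) hsrc).mono le_rfl ?_)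
  rintro s₄ ⟨d1, d2, C, ρ, dC, dsub, dforest, -, dclosed⟩
  have d1' := c1'.trans d1 (L'' := [1, 3, 4, 5, 6, 9, 11, 12])
  have d2' := c2'.trans (KeepN.of_eq d2) (L'' := [1, 2])
  rw [allowed_univ] at dforest dclosed
  have hlayer : IsLayer low U o₀ τ C :=
    isLayer_of_reach hhi hbal (fun i hi => dsub hi) dclosed fun e he => dforest.reach he
  refine Spec.seq ((spec_raise hn (hs.keep d1' d2') dC).mono le_rfl ?_)
  rintro s₅ ⟨e1, e2, e3, z, ez, eo⟩
  have e1' := d1'.trans e1 (L'' := [1, 3, 4, 5, 6, 9, 11, 12, 20, 21])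
  have e2' := d2'.trans e2 (L'' := [1, 2, 5])
  refine Spec.seq ((spec_balance hn e3 (Or.inr rfl) hlo.le hhi eo).mono le_rfl ?_)
  rintro s₆ ⟨f1, f2, o, fo, ffix, fal, fbal⟩
  have f1' := e1'.trans f1 (L'' := [1, 3, 4, 5, 6, 9, 10, 11, 12, 14, 15, 16, 17, 20, 21])
  have f2' := e2'.trans f2 (L'' := [1, 2, 5, 6])
  have fcfg := e3.keep f1 f2
  refine Spec.seq ((spec_check fcfg (Or.inr rfl) fo).mono le_rfl ?_)
  rintro s₇ ⟨g1, g2, g3⟩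
  have g1' := f1'.trans g1 (L'' := [1, 3, 4, 5, 6, 9, 10, 11, 12, 14, 15, 16, 17, 18, 19,
    20, 21])
  have g2' := f2'.trans g2 (L'' := [1, 2, 5, 6])
  refine (spec_of_wp (Q := fun s' => s' = s₇.setI (18, 0, 0) (τ - 1))
    (by simp [wp, g1.eq (f1'.eq hτ)])).mono le_rfl ?_
  rintro _ rfl
  refine ⟨hs.keep (g1'.setI (A := 18)) g2'.setI, ?_, by simp, C, o, hlayer, fun j => ?_, ?_, ?_⟩
  · exact (f2.trans g2 (L'' := [1, 2, 6])).eq e3.β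
  · simpa using g1.vals fo (by decide) j
  · intro hz
    refine ⟨fun j hj => ?_, fun j hj => ?_, fbal⟩
    · rw [ffix j hj, if_neg fun hu => hj (Or.inl hu)]
    · rcases fal j hj with h | h
      · exact h
      · rw [h]
        split_ifs with hu
        · exact Or.inl (ez hz)
        · exact Or.inr (h₀ j hu)
  · simpa using g3

/-! ### All stages -/

theorem spec_stages (hn : 0 < n) (hs : Base low U o₀ lo hi s) (hβ : s.num (5, 0, 0) = 0)
    (hlo : 0 < lo) (hle : lo ≤ hi) (h₀ : ∀ j ∉ U, low (o₀ j) j)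
    (hbal : Balanced 0 hi o₀ Uᶜ low) (hτ : s.idx (18, 0, 0) = m + 2)
    (hbad : s.idx (19, 0, 0) = 1) :
    Spec (Good lo hi m) (.loop (onE (var 19)) stage) s
      ((m + 2) * ((onE (var 19)).cost + stageSteps n m) + (onE (var 19)).cost) fun s' =>
        ∃ τ C o, IsLayer low U o₀ τ C ∧ IsStage low U o₀ lo hi C o ∧ Own 1 o s' ∧
          ∀ i e, load lo hi o (raised U o₀ C) i ≤
            load lo hi o (raised U o₀ C) e + top lo hi o (raised U o₀ C) i := by
  -- The variant is the threshold of the coming stage. A set flag carries the evidence of envy in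
  -- the settled stage of threshold v + 1, except before the first round; a cleared flag carries the
  -- final result.
  refine Spec.loop (I := fun v s' => Base low U o₀ lo hi s' ∧
      (s'.num (5, 0, 0) = 0 ∨ s'.num (5, 0, 0) = lo) ∧ s'.idx (18, 0, 0) = v ∧
      (1 ≤ s'.idx (19, 0, 0) → v = m + 2 ∨ ∃ C o e, IsLayer low U o₀ (v + 1) C ∧
        IsStage low U o₀ lo hi C o ∧ Settled lo hi o (raised U o₀ C) ∧
        load lo hi o (raised U o₀ C) e + lo < lo * v) ∧
      (¬ 1 ≤ s'.idx (19, 0, 0) → ∃ τ C o, IsLayer low U o₀ τ C ∧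
        IsStage low U o₀ lo hi C o ∧ Own 1 o s' ∧
          ∀ i e, load lo hi o (raised U o₀ C) i ≤
            load lo hi o (raised U o₀ C) e + top lo hi o (raised U o₀ C) i))
    (v := m + 2) ?_ ⟨hs, Or.inl hβ, hτ, fun _ => Or.inl rfl, fun h => absurd hbad.ge h⟩ le_rfl ?_
  · rintro v s₁ ⟨h1, h2, h3, h4, -⟩ hb
    have hb' := h4 hb
    refine (spec_stage hn h1 rfl h2 hlo hle h₀ hbal h3).mono le_rfl ?_
    rintro s₂ ⟨a1, a2, a3, C, o, a4, a5, a6, a7⟩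
    -- Otherwise truncated subtraction would leave the threshold, and with it the variant,
    -- unchanged.
    have hv : 1 ≤ v := by
      rcases hb' with h | ⟨_, _, _, _, _, _, h⟩
      · omega
      · have := two_le_of_load_lt hlo hle h
        omega
    have key : IsStage low U o₀ lo hi C o ∧ Settled lo hi o (raised U o₀ C) := by
      rcases hb' with h | ⟨C', o', e', b1, b2, b3, b4⟩
      -- In the first round the threshold is m + 2, and even an agent who was merely reached would
      -- need m + 1 chores.
      · have hC : ∀ i, i ∉ C := by
          intro i hi'
          have h5 := a4.le i hi'
          have h6 := cnt_le o₀ Uᶜ i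
          omega
        have hst := a6 ⟨⟨0, hn⟩, hC _⟩
        exact ⟨hst, hst.settled_of_empty hC⟩
      · obtain ⟨z, hz⟩ := b2.exists_cnt_lt b1 hlo hle b3 b4
        have hst := a6 ⟨z, fun hzC => by have := a4.le z hzC; omega⟩
        exact ⟨hst, IsStage.settled_of_violation h₀ hlo hle b2 b1 b3 b4 hst a4⟩
    obtain ⟨hst, hset⟩ := key
    obtain ⟨w, rfl⟩ : ∃ w, v = w + 1 := ⟨v - 1, by omega⟩
    refine ⟨w, Nat.lt_succ_self w, a1, Or.inr a2, by simpa using a3, fun hb2 => Or.inr ?_,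
      fun hb2 => ⟨w + 1, C, o, a4, hst, a5, ?_⟩⟩
    · obtain ⟨i, e, hie⟩ := a7.1 hb2
      exact ⟨C, o, e, a4, hst, hset, hst.load_lt_of_violation a4 hlo hle hset hie⟩
    · intro i e
      by_contra! hlt
      exact hb2 (a7.2 ⟨i, e, hlt⟩)
  · rintro v s₁ ⟨-, -, -, -, h⟩ hb
    exact h hb

end

section

variable {n m : ℕ} {s s' : State} {lo hi : ℝ} {c : Fin n → Fin m → ℝ}

/-! ### Preparation -/

theorem spec_forLoop₂ {G : ℝ → Prop} {X Y K : ℕ} {P : Prog} {Q : State → Prop} (hXY : X ≠ Y)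
    (J : ℕ → ℕ → State → Prop) (hn : ∀ k l s, J k l s → s.idx (0, 0, 0) = n)
    (hm : ∀ k l s, J k l s → s.idx (0, 0, 1) = m)
    (hP : ∀ k < n, ∀ l < m, ∀ s, J k l s → s.idx (X, 0, 0) = k → s.idx (Y, 0, 0) = l →
      Spec G P s K fun s' => s'.idx (X, 0, 0) = k ∧ s'.idx (Y, 0, 0) = l ∧
        J k (l + 1) (s'.setI (Y, 0, 0) (l + 1)))
    (hrow : ∀ k s, J k m s → J (k + 1) 0 (s.setI (X, 0, 0) (k + 1)))
    (hcol : ∀ k s, J k 0 s → J k 0 (s.setI (Y, 0, 0) 0))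
    (h0 : J 0 0 (s.setI (X, 0, 0) 0)) (hQ : ∀ s, J n 0 s → Q s) :
    Spec G (forLoop X nE (forLoop Y mE P)) s (forSteps nE (forSteps mE K m) n) Q := by
  refine spec_forLoop (fun k => J k 0) (fun k s' h => hn _ _ _ h) ?_ h0 hQ
  intro k hk s₂ hJ hX
  refine spec_forLoop (fun l s' => J k l s' ∧ s'.idx (X, 0, 0) = k)
    (fun l s' h => hm _ _ _ h.1) ?_ ?_ ?_
  · rintro l hl s₃ ⟨h1, h2⟩ hY
    refine (hP k hk l hl s₃ h1 h2 hY).mono le_rfl ?_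
    rintro s₄ ⟨h3, h4, h5⟩
    exact ⟨h4, h5, by simpa [hXY] using h3⟩
  · exact ⟨hcol _ _ hJ, by simpa [hXY] using hX⟩
  · rintro s₃ ⟨h1, h2⟩
    exact ⟨h2, hrow _ _ h1⟩

/-- The memory holds the instance. -/
structure Input (c : Fin n → Fin m → ℝ) (s : State) : Prop where
  c : ∀ (i : Fin n) (j : Fin m), s.num (0, i, j) = c i j
  n : s.idx (0, 0, 0) = n
  m : s.idx (0, 0, 1) = m

theorem Input.keep (h : Input c s) {L L' : List ℕ} (hk : Keep L s s') (hk' : KeepN L' s s')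
    (h0 : 0 ∉ L := by decide) (h0' : 0 ∉ L' := by decide) : Input c s' :=
  ⟨fun i j => hk'.eq (h.c i j) h0', hk.eq h.n h0, hk.eq h.m h0⟩

theorem input_inputState (c : Fin n → Fin m → ℝ) : Input c (inputState c) :=
  ⟨fun i j => by simp [inputState], by simp [inputState], by simp [inputState]⟩

/-- The instance has lowest cost `lo` and highest cost `hi`, and no other costs. -/
structure Bivalued (c : Fin n → Fin m → ℝ) (lo hi : ℝ) : Prop where
  le : lo ≤ hi
  cases : ∀ i j, c i j = lo ∨ c i j = hi
  lo : ∃ i j, c i j = lo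
  hi : ∃ i j, c i j = hi

def rangeBody : Prog :=
  .seq (.branch (.leNum (scal 3) ⟨0, var 10, var 12⟩) skip
      (.setNum (scal 3) (.copy ⟨0, var 10, var 12⟩)))
    (.branch (.leNum ⟨0, var 10, var 12⟩ (scal 4)) skip
      (.setNum (scal 4) (.copy ⟨0, var 10, var 12⟩)))

def rangeStart : Prog :=
  .seq (.setNum (scal 3) (.copy ⟨0, .const 0, .const 0⟩))
    (.setNum (scal 4) (.copy ⟨0, .const 0, .const 0⟩))

/-- Finds the lowest and the highest cost. -/
def range : Prog := .seq rangeStart (forLoop 10 nE (forLoop 12 mE rangeBody))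

def rangeSteps (n m : ℕ) : ℕ :=
  steps rangeStart + forSteps nE (forSteps mE (steps rangeBody) m) n

theorem spec_range (hn : 0 < n) (hm : 0 < m) (hs : Input c s) (hc : Bivalued c lo hi) :
    Spec (Good lo hi m) range s (rangeSteps n m) fun s' =>
      Keep [10, 12, 21] s s' ∧ KeepN [3, 4] s s' ∧ s'.num (3, 0, 0) = lo ∧
        s'.num (4, 0, 0) = hi := by
  have hgood : ∀ {y}, y = lo ∨ y = hi → Good lo hi m y := by
    rintro y (rfl | rfl)
    exacts [good_lo _ _ _, good_hi _ _ _]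
  have h00 := hs.c ⟨0, hn⟩ ⟨0, hm⟩
  have hc00 := hc.cases ⟨0, hn⟩ ⟨0, hm⟩
  rw [← h00] at hc00
  unfold range
  refine Spec.seq ((spec_of_wp (Q := fun s' => Keep [] s s' ∧ KeepN [3, 4] s s' ∧
    (s'.num (3, 0, 0) = lo ∨ s'.num (3, 0, 0) = hi) ∧
    (s'.num (4, 0, 0) = lo ∨ s'.num (4, 0, 0) = hi)) ?_).mono le_rfl ?_)
  · simp only [rangeStart, wp, NumOp.Result, IExpr.eval, Cell.addr, exists_eq_left]
    refine ⟨hgood hc00, by simpa using hgood hc00, Keep.refl _ _,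
      ((KeepN.refl _ _).setN).setN, by simpa using hc00, by simpa using hc00⟩
  rintro s₁ ⟨a1, a2, a3, a4⟩
  have hs1 := hs.keep a1 a2
  refine spec_forLoop₂ (n := n) (m := m) (by decide) (fun k l s' => Keep [10, 12, 21] s₁ s' ∧
    KeepN [3, 4] s₁ s' ∧ (s'.num (3, 0, 0) = lo ∨ s'.num (3, 0, 0) = hi) ∧
    (s'.num (4, 0, 0) = lo ∨ s'.num (4, 0, 0) = hi) ∧
    ∀ (i : Fin n) (j : Fin m), ((i : ℕ) < k ∨ (i : ℕ) = k ∧ (j : ℕ) < l) →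
      s'.num (3, 0, 0) ≤ c i j ∧ c i j ≤ s'.num (4, 0, 0)) (fun k l s' h => h.1.eq hs1.n)
    (fun k l s' h => h.1.eq hs1.m) ?_ ?_ ?_ ?_ ?_
  · rintro k hk l hl s' ⟨b1, b2, b3, b4, b5⟩ hX hY
    have e1 : s'.num (0, k, l) = c ⟨k, hk⟩ ⟨l, hl⟩ := b2.eq (hs1.c ⟨k, hk⟩ ⟨l, hl⟩)
    have hcc := hc.cases ⟨k, hk⟩ ⟨l, hl⟩
    -- the invariant for arbitrary new bounds
    have hstep : ∀ s'', Keep [10, 12, 21] s₁ s'' → KeepN [3, 4] s₁ s'' →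
        s''.idx (10, 0, 0) = k → s''.idx (12, 0, 0) = l →
        (s''.num (3, 0, 0) = s'.num (3, 0, 0) ∨ s''.num (3, 0, 0) = c ⟨k, hk⟩ ⟨l, hl⟩) →
        (s''.num (4, 0, 0) = s'.num (4, 0, 0) ∨ s''.num (4, 0, 0) = c ⟨k, hk⟩ ⟨l, hl⟩) →
        s''.num (3, 0, 0) ≤ s'.num (3, 0, 0) → s''.num (3, 0, 0) ≤ c ⟨k, hk⟩ ⟨l, hl⟩ →
        s'.num (4, 0, 0) ≤ s''.num (4, 0, 0) → c ⟨k, hk⟩ ⟨l, hl⟩ ≤ s''.num (4, 0, 0) →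
        s''.idx (10, 0, 0) = k ∧ s''.idx (12, 0, 0) = l ∧
          Keep [10, 12, 21] s₁ (s''.setI (12, 0, 0) (l + 1)) ∧
          KeepN [3, 4] s₁ (s''.setI (12, 0, 0) (l + 1)) ∧
          (s''.num (3, 0, 0) = lo ∨ s''.num (3, 0, 0) = hi) ∧
          (s''.num (4, 0, 0) = lo ∨ s''.num (4, 0, 0) = hi) ∧
          ∀ (i : Fin n) (j : Fin m), ((i : ℕ) < k ∨ (i : ℕ) = k ∧ (j : ℕ) < l + 1) →
            s''.num (3, 0, 0) ≤ c i j ∧ c i j ≤ s''.num (4, 0, 0) := by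
      intro s'' c1 c2 c3 c4 c5 c6 c7 c8 c9 c10
      refine ⟨c3, c4, c1.setI, c2.setI, ?_, ?_, fun i j hij => ?_⟩
      · rcases c5 with h | h <;> rw [h]
        exacts [b3, hcc]
      · rcases c6 with h | h <;> rw [h]
        exacts [b4, hcc]
      · by_cases h : (i : ℕ) = k ∧ (j : ℕ) = l
        · obtain ⟨rfl, rfl⟩ := h
          exact ⟨c8, c10⟩
        · have := b5 i j (by omega)
          exact ⟨c7.trans this.1, this.2.trans c9⟩
    refine (spec_of_wp (P := rangeBody) (Q := fun s'' =>
      Keep [10, 12, 21] s₁ s'' ∧ KeepN [3, 4] s₁ s'' ∧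
        s''.idx (10, 0, 0) = k ∧ s''.idx (12, 0, 0) = l ∧
        (s''.num (3, 0, 0) = s'.num (3, 0, 0) ∨ s''.num (3, 0, 0) = c ⟨k, hk⟩ ⟨l, hl⟩) ∧
        (s''.num (4, 0, 0) = s'.num (4, 0, 0) ∨ s''.num (4, 0, 0) = c ⟨k, hk⟩ ⟨l, hl⟩) ∧
        s''.num (3, 0, 0) ≤ s'.num (3, 0, 0) ∧ s''.num (3, 0, 0) ≤ c ⟨k, hk⟩ ⟨l, hl⟩ ∧
        s'.num (4, 0, 0) ≤ s''.num (4, 0, 0) ∧ c ⟨k, hk⟩ ⟨l, hl⟩ ≤ s''.num (4, 0, 0)) ?_).mono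
      le_rfl ?_
    · simp only [rangeBody, wp, NumOp.Result, IExpr.eval, Cell.addr, Test.Holds, hX, hY, e1,
        exists_eq_left, setI_idx, setI_num, setN_num, setN_idx]
      have hgc := hgood hcc
      refine ⟨fun h1 => ⟨?_, ?_⟩, fun h1 => ⟨hgc, ?_, ?_⟩⟩
      · simp only [Nat.reduceEqDiff, false_and, if_false, e1]
        intro h2
        exact ⟨b1.setI.setI, b2.setI.setI, trivial, trivial, Or.inl trivial, Or.inl trivial,
          le_rfl, h1, le_rfl, h2⟩
      · simp only [Nat.reduceEqDiff, false_and, if_false, e1, not_le]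
        intro h2
        refine ⟨hgc, b1.setI.setN, (b2.setI).setN, trivial, trivial, Or.inl trivial, ?_, ?_, ?_,
          ?_, ?_⟩
        · simp
        · exact le_rfl
        · exact h1
        · simpa using h2.le
        · simp
      · simp only [Nat.reduceEqDiff, false_and, if_false]
        intro h2
        refine ⟨b1.setN.setI, (b2.setN).setI, trivial, trivial, ?_, Or.inl trivial, ?_, ?_, le_rfl,
          h2⟩
        · simp
        · simpa using (not_le.1 h1).le
        · simp
      · simp only [Nat.reduceEqDiff, false_and, if_false, not_le]
        intro h2
        refine ⟨hgc, b1.setN.setN, (b2.setN).setN, trivial, trivial, ?_, ?_, ?_, ?_, ?_, ?_⟩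
        · simp
        · simp
        · simpa using (not_le.1 h1).le
        · simp
        · simpa using h2.le
        · simp
    · rintro s'' ⟨c1, c2, c3, c4, c5, c6, c7, c8, c9, c10⟩
      exact hstep s'' c1 c2 c3 c4 c5 c6 c7 c8 c9 c10
  · rintro k s' ⟨b1, b2, b3, b4, b5⟩
    refine ⟨b1.setI, b2.setI, b3, b4, fun i j hij => b5 i j ?_⟩
    have := j.2
    omega
  · rintro k s' ⟨b1, b2, b3, b4, b5⟩
    exact ⟨b1.setI, b2.setI, b3, b4, b5⟩
  · exact ⟨(Keep.refl _ _).setI, KeepN.refl _ _, a3, a4, fun i j hij => by omega⟩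
  · rintro s' ⟨b1, b2, b3, b4, b5⟩
    refine ⟨a1.trans b1, a2.trans b2, ?_, ?_⟩
    · obtain ⟨i, j, hij⟩ := hc.lo
      have := (b5 i j (Or.inl i.2)).1
      rcases b3 with h | h
      · exact h
      · exact le_antisymm (this.trans_eq hij) (h ▸ hc.le)
    · obtain ⟨i, j, hij⟩ := hc.hi
      have := (b5 i j (Or.inl i.2)).2
      rcases b4 with h | h
      · exact le_antisymm (h ▸ hc.le) (hij.symm.le.trans this)
      · exact h

def easyBody : Prog :=
  .branch (.leNum ⟨0, var 10, var 12⟩ ⟨0, var 10, var 13⟩) skip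
    (.setIdx ⟨2, var 10, var 12⟩ (.const 0))

def easyRow : Prog := .seq (.setIdx ⟨2, var 10, var 12⟩ (.const 1)) (forLoop 13 mE easyBody)

/-- Computes which chores are easy for which agents. -/
def easy : Prog := forLoop 10 nE (forLoop 12 mE easyRow)

def easyRowSteps (m : ℕ) : ℕ :=
  steps (.setIdx ⟨2, var 10, var 12⟩ (.const 1)) + forSteps mE (steps easyBody) m

def easySteps (n m : ℕ) : ℕ := forSteps nE (forSteps mE (easyRowSteps m) m) n

theorem spec_easy {G : ℝ → Prop} (hs : Input c s) :
    Spec G easy s (easySteps n m) fun s' =>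
      Keep [2, 10, 12, 13, 21] s s' ∧ s'.num = s.num ∧ Flag₂ 2 (Easy c) s' := by
  refine spec_forLoop₂ (n := n) (m := m) (by decide) (fun k l s' =>
    Keep [2, 10, 12, 13, 21] s s' ∧ s'.num = s.num ∧
    ∀ (i : Fin n) (j : Fin m), ((i : ℕ) < k ∨ (i : ℕ) = k ∧ (j : ℕ) < l) →
      (1 ≤ s'.idx (2, i, j) ↔ Easy c i j)) (fun k l s' h => h.1.eq hs.n)
    (fun k l s' h => h.1.eq hs.m) ?_ ?_ ?_ ?_ ?_
  · rintro k hk l hl s₁ ⟨b1, b2, b3⟩ hX hY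
    refine Spec.seq ((spec_of_wp (Q := fun s' => s' = s₁.setI (2, k, l) 1)
      (by simp [wp, hX, hY])).mono le_rfl ?_)
    rintro _ rfl
    -- The flag starts at 1 and is cleared by the first cheaper chore in the row.
    refine spec_forLoop (fun r s' => Keep [2, 13, 21] s₁ s' ∧ s'.num = s.num ∧
      (∀ i j, ¬ (i = k ∧ j = l) → s'.idx (2, i, j) = s₁.idx (2, i, j)) ∧
      (1 ≤ s'.idx (2, k, l) ↔ ∀ j' : Fin m, (j' : ℕ) < r → c ⟨k, hk⟩ ⟨l, hl⟩ ≤ c ⟨k, hk⟩ j'))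
      (fun r s' h => h.1.eq (b1.eq hs.m)) ?_ ?_ ?_
    · rintro r hr s₂ ⟨d1, d2, d3, d4⟩ hZ
      have e1 : s.num (0, k, l) = c ⟨k, hk⟩ ⟨l, hl⟩ := hs.c ⟨k, hk⟩ ⟨l, hl⟩
      have e2 : s.num (0, k, r) = c ⟨k, hk⟩ ⟨r, hr⟩ := hs.c ⟨k, hk⟩ ⟨r, hr⟩
      have hX2 := d1.eq hX
      have hY2 := d1.eq hY
      refine spec_of_wp ?_
      simp only [easyBody, wp, IExpr.eval, Cell.addr, Test.Holds, hX2, hY2, hZ, setI_idx, d2, e1,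
        e2, Nat.reduceEqDiff, false_and, if_false, setI_num, true_and]
      constructor
      · intro hle
        refine ⟨d1.setI.setI, d3, ?_⟩
        rw [d4]
        refine ⟨fun h j' hj' => ?_, fun h j' hj' => h j' (by omega)⟩
        rcases Nat.lt_succ_iff_lt_or_eq.1 hj' with h' | rfl
        · exact h j' h'
        · exact hle
      · intro hlt
        refine ⟨d1.setI.setI, fun i j hij => ?_, ?_⟩
        · rw [if_neg hij]
          exact d3 i j hij
        · simp only [if_true]
          exact ⟨fun h => absurd h (by norm_num), fun h => absurd (h ⟨r, hr⟩ (Nat.lt_succ_self r)) hlt⟩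
    · refine ⟨(Keep.refl _ _).setI.setI, b2, fun i j hij => by simp [hij], by simp⟩
    · rintro s₂ ⟨d1, d2, d3, d4⟩
      refine ⟨d1.eq hX, d1.eq hY, (b1.trans d1 (L'' := [2, 10, 12, 13, 21])).setI, d2, ?_⟩
      intro i j hij
      simp only [setI_idx, Nat.reduceEqDiff, false_and, if_false]
      by_cases h : (i : ℕ) = k ∧ (j : ℕ) = l
      · obtain ⟨rfl, rfl⟩ := h
        rw [d4]
        exact ⟨fun h j' => h j' j'.2, fun h j' _ => h j'⟩
      · rw [d3 i j h]
        exact b3 i j (by omega)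
  · rintro k s' ⟨b1, b2, b3⟩
    refine ⟨b1.setI, b2, fun i j hij => ?_⟩
    have := j.2
    simpa using b3 i j (by omega)
  · rintro k s' ⟨b1, b2, b3⟩
    exact ⟨b1.setI, b2, fun i j hij => by simpa using b3 i j hij⟩
  · exact ⟨(Keep.refl _ _).setI, rfl, fun i j hij => by omega⟩
  · rintro s' ⟨b1, b2, b3⟩
    exact ⟨b1, b2, fun i j => b3 i j (Or.inl i.2)⟩

def ownersBody : Prog :=
  .branch (onE (.read 2 (var 11) (var 12)))
    (.seq (setA 8 (var 12) (.const 0)) (setA 7 (var 12) (var 11))) skip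

def ownersStart : Prog := .seq (setA 8 (var 12) (.const 1)) (setA 7 (var 12) (.const 0))

/-- Gives every chore that is easy for somebody to such an agent, and marks the other chores. -/
def owners : Prog := forLoop 12 mE (.seq ownersStart (forLoop 11 nE ownersBody))

def ownersSteps (n m : ℕ) : ℕ :=
  forSteps mE (steps ownersStart + forSteps nE (steps ownersBody) n) m

theorem spec_owners {G : ℝ → Prop} (hn : 0 < n) (hs : Input c s) (he : Flag₂ 2 (Easy c) s) :
    Spec G owners s (ownersSteps n m) fun s' =>
      Keep [7, 8, 11, 12, 21] s s' ∧ s'.num = s.num ∧ Flag 8 (hard c) s' ∧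
        ∃ o : Fin m → Fin n, Own 7 o s' ∧ ∀ j ∉ hard c, Easy c (o j) j := by
  refine spec_forLoop (fun k s' => Keep [7, 8, 11, 12, 21] s s' ∧ s'.num = s.num ∧
    ∀ j : Fin m, (j : ℕ) < k → ∃ e : Fin n, s'.idx (7, 0, j) = e ∧
      (1 ≤ s'.idx (8, 0, j) ↔ j ∈ hard c) ∧ (j ∉ hard c → Easy c e j))
    (fun k s' h => h.1.eq hs.m) ?_ ?_ ?_
  · rintro k hk s₁ ⟨b1, b2, b3⟩ hX
    refine Spec.seq ((spec_of_wp (Q := fun s' => s' = (s₁.setI (8, 0, k) 1).setI (7, 0, k) 0)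
      (by simp [ownersStart, wp, hX])).mono le_rfl ?_)
    rintro _ rfl
    refine spec_forLoop (fun r s' => Keep [7, 8, 11, 21] s₁ s' ∧ s'.num = s.num ∧
      (∀ j, j ≠ k → s'.idx (7, 0, j) = s₁.idx (7, 0, j) ∧ s'.idx (8, 0, j) = s₁.idx (8, 0, j)) ∧
      ∃ e : Fin n, s'.idx (7, 0, k) = e ∧
        (1 ≤ s'.idx (8, 0, k) ↔ ¬ ∃ i : Fin n, (i : ℕ) < r ∧ Easy c i ⟨k, hk⟩) ∧
        ((∃ i : Fin n, (i : ℕ) < r ∧ Easy c i ⟨k, hk⟩) → Easy c e ⟨k, hk⟩))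
      (fun r s' h => h.1.eq (b1.eq hs.n)) ?_ ?_ ?_
    · rintro r hr s₂ ⟨d1, d2, d3, e, d4, d5, d6⟩ hZ
      have e1 : 1 ≤ s₂.idx (2, r, k) ↔ Easy c ⟨r, hr⟩ ⟨k, hk⟩ := by
        rw [d1 2 (by decide), b1 2 (by decide)]
        exact he ⟨r, hr⟩ ⟨k, hk⟩
      refine spec_of_wp ?_
      simp only [ownersBody, wp, IExpr.eval, Cell.addr, Test.Holds, hZ, d1.eq hX, setI_idx, e1,
        Nat.reduceEqDiff, false_and, if_false, setI_num, true_and]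
      constructor
      · intro hE
        refine ⟨d1.setI.setI.setI, d2, fun j hj => by simpa [hj] using d3 j hj, ⟨r, hr⟩, by simp,
          ?_, fun _ => hE⟩
        simp only [if_true]
        exact ⟨fun h => absurd h (by norm_num), fun h => absurd ⟨⟨r, hr⟩, Nat.lt_succ_self r, hE⟩ h⟩
      · intro hE
        have hiff : (∃ i : Fin n, (i : ℕ) < r + 1 ∧ Easy c i ⟨k, hk⟩) ↔
            ∃ i : Fin n, (i : ℕ) < r ∧ Easy c i ⟨k, hk⟩ := by
          refine ⟨fun ⟨i, h1, h2⟩ => ⟨i, ?_, h2⟩, fun ⟨i, h1, h2⟩ => ⟨i, by omega, h2⟩⟩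
          rcases Nat.lt_succ_iff_lt_or_eq.1 h1 with h | rfl
          · exact h
          · exact absurd h2 hE
        rw [hiff]
        exact ⟨d1.setI.setI, d2, d3, e, d4, d5, d6⟩
    · exact ⟨(Keep.refl _ _).setI.setI.setI, b2, fun j hj => by simp [hj], ⟨0, hn⟩, by simp, by simp,
        by simp⟩
    · rintro s₂ ⟨d1, d2, d3, e, d4, d5, d6⟩
      refine ⟨d1.eq hX, (b1.trans d1 (L'' := [7, 8, 11, 12, 21])).setI, d2, fun j hj => ?_⟩
      simp only [setI_idx, Nat.reduceEqDiff, false_and, if_false]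
      rcases Nat.lt_succ_iff_lt_or_eq.1 hj with h | h
      · rw [(d3 j h.ne).1, (d3 j h.ne).2]
        exact b3 j h
      · have hjk : j = ⟨k, hk⟩ := Fin.ext h
        subst hjk
        have hiff : (⟨k, hk⟩ : Fin m) ∈ hard c ↔
            ¬ ∃ i : Fin n, (i : ℕ) < n ∧ Easy c i ⟨k, hk⟩ := by
          simp [hard]
        refine ⟨e, d4, by rw [d5, hiff], fun h => d6 ?_⟩
        rw [hiff, not_not] at h
        exact h
  · exact ⟨(Keep.refl _ _).setI, rfl, fun j hj => absurd hj (Nat.not_lt_zero _)⟩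
  · rintro s' ⟨b1, b2, b3⟩
    choose o ho using fun j : Fin m => b3 j j.2
    exact ⟨b1, b2, fun j => (ho j).2.1, o, fun j => (ho j).1, fun j => (ho j).2.2⟩

end

section

variable {n m : ℕ} {s s' : State} {lo hi : ℝ} {c : Fin n → Fin m → ℝ}

/-! ### The whole program -/

def saveBody : Prog := setA 7 (var 12) (arr 1 (var 12))

/-- The program for at least one chore. -/
def solve : Prog :=
  .seq range (.seq easy (.seq owners (.seq (setV 18 (.add mE (.const 2))) (.seq restore
    (.seq balance (.seq (forLoop 12 mE saveBody) (.seq (setV 19 (.const 1))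
      (.loop (onE (var 19)) stage))))))))

def solveSteps (n m : ℕ) : ℕ :=
  rangeSteps n m + (easySteps n m + (ownersSteps n m + (steps (setV 18 (.add mE (.const 2))) +
    (restoreSteps n m + (balanceSteps n m + (forSteps mE (steps saveBody) m +
      (steps (setV 19 (.const 1)) + ((m + 2) * ((onE (var 19)).cost + stageSteps n m) +
        (onE (var 19)).cost))))))))

theorem spec_solve (hn : 0 < n) (hm : 0 < m) (hc : Bivalued c lo hi) (hlo : 0 < lo) :
    Spec (Good lo hi m) solve (inputState c) (solveSteps n m) fun s' =>
      ∃ τ C, ∃ o₀ o : Fin m → Fin n, (∀ j ∉ hard c, Easy c (o₀ j) j) ∧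
        IsLayer (Easy c) (hard c) o₀ τ C ∧ IsStage (Easy c) (hard c) o₀ lo hi C o ∧ Own 1 o s' ∧
          ∀ i e, load lo hi o (raised (hard c) o₀ C) i ≤
            load lo hi o (raised (hard c) o₀ C) e + top lo hi o (raised (hard c) o₀ C) i := by
  have hin := input_inputState c
  have hβ : (inputState c).num (5, 0, 0) = 0 := by simp [inputState]
  generalize inputState c = s at *
  have hhi := hlo.trans_le hc.le
  unfold solve
  refine Spec.seq ((spec_range hn hm hin hc).mono le_rfl ?_)
  rintro s₁ ⟨a1, a2, a3, a4⟩
  refine Spec.seq ((spec_easy (hin.keep a1 a2)).mono le_rfl ?_)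
  rintro s₂ ⟨b1, b2, b3⟩
  have b1' := a1.trans b1 (L'' := [2, 10, 12, 13, 21])
  have b2' := a2.trans (KeepN.of_eq b2) (L'' := [3, 4])
  refine Spec.seq ((spec_owners hn (hin.keep b1' b2') b3).mono le_rfl ?_)
  rintro s₃ ⟨c1, c2, c3, o₁, c4, c5⟩
  have c1' := b1'.trans c1 (L'' := [2, 7, 8, 10, 11, 12, 13, 21])
  have c2' := b2'.trans (KeepN.of_eq c2) (L'' := [3, 4])
  have hnum : s₃.num = s₁.num := c2.trans b2
  refine Spec.seq ((spec_of_wp (Q := fun s' => s' = s₃.setI (18, 0, 0) (m + 2))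
    (by simp [wp, c1'.eq hin.m])).mono le_rfl ?_)
  rintro s₄ hs₄
  have d1 : Keep [18] s₃ s₄ := by rw [hs₄]; exact (Keep.refl _ _).setI
  have d2 : s₄.num = s₁.num := by rw [hs₄]; exact hnum
  have d1' := c1'.trans d1 (L'' := [2, 7, 8, 10, 11, 12, 13, 18, 21])
  have d3 : s₄.idx (18, 0, 0) = m + 2 := by simp [hs₄]
  have hbase : Base (Easy c) (hard c) o₁ lo hi s₄ :=
    ⟨d1'.eq hin.n, d1'.eq hin.m, d1.flag₂ (c1.flag₂ b3), d1.flag c3, d1.vals c4,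
      by rw [d2, a3], by rw [d2, a4]⟩
  have hβ4 : s₄.num (5, 0, 0) = 0 := by rw [d2]; exact a2.eq hβ
  refine Spec.seq ((spec_restore hbase hβ4).mono le_rfl ?_)
  rintro s₅ ⟨e1, e2, e3, e4⟩
  -- Cell 5 still holds its initial 0, so this run balances the mere numbers of chores outside `hard
  -- c`.
  refine Spec.seq ((spec_balance hn e3 (Or.inl rfl) le_rfl hhi e4).mono le_rfl ?_)
  rintro s₆ ⟨f1, f2, o₀, f3, f4, f5, f6⟩
  rw [allowed_univ] at f5 f6
  have h₀ : ∀ j ∉ hard c, Easy c (o₀ j) j := by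
    intro j hj
    rcases f5 j hj with h | h
    · exact h
    · rw [h]
      exact c5 j hj
  have f1' := e1.trans f1 (L'' := [1, 3, 4, 5, 6, 9, 10, 11, 12, 14, 15, 16, 17, 21])
  have f2' := (KeepN.of_eq e2).trans f2 (L'' := [1, 2, 6])
  have g0 := hbase.keep f1' f2'
  -- The balanced owners are saved, since every stage starts again from them.
  refine Spec.seq ((spec_map (X := 12) (A := 7) (k := m) (e := mE) (fun k => s₆.idx (1, 0, k))
    (by decide) (fun s' h => h.eq g0.m)
    fun r hr s' h _ hX => by simp [saveBody, wp, hX, h 1 (by decide)]).mono le_rfl ?_)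
  rintro s₇ ⟨g1, g2, g3⟩
  refine Spec.seq ((spec_of_wp (Q := fun s' => s' = s₇.setI (19, 0, 0) 1)
    (by simp [wp])).mono le_rfl ?_)
  rintro s₈ hs₈
  have k1 : Keep [7, 12, 19] s₆ s₈ := by
    rw [hs₈]; exact (g1.trans (Keep.refl [] _) (L'' := [7, 12, 19])).setI
  have k2 : s₈.num = s₆.num := by rw [hs₈]; exact g2
  have hbase' : Base (Easy c) (hard c) o₀ lo hi s₈ := by
    refine ⟨k1.eq g0.n, k1.eq g0.m, k1.flag₂ g0.low, k1.flag g0.hard, fun j => ?_,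
      by rw [k2]; exact g0.lo, by rw [k2]; exact g0.hi⟩
    simpa [hs₈, g3 j j.2] using f3 j
  refine (spec_stages hn hbase' (by rw [k2]; exact f2'.eq hβ4) hlo hc.le h₀ f6
    (k1.eq (f1'.eq d3)) (by simp [hs₈])).mono le_rfl ?_
  rintro s₉ ⟨τ, C, o, h1, h2, h3, h4⟩
  exact ⟨τ, C, o₀, o, h₀, h1, h2, h3, h4⟩

/-- The program. -/
def program : Prog := .branch (onE mE) solve skip

def programSteps (n m : ℕ) : ℕ := (onE mE).cost + (solveSteps n m + steps skip)

/-! ### Polynomial bounds -/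

/-- Bounded by a polynomial in the sum of the arguments. -/
def PolyBounded (f : ℕ → ℕ → ℕ) : Prop := ∃ p : Polynomial ℕ, ∀ n m, f n m ≤ p.eval (n + m)

theorem PolyBounded.const (k : ℕ) : PolyBounded fun _ _ => k :=
  ⟨Polynomial.C k, fun n m => by simp⟩

theorem PolyBounded.left : PolyBounded fun n _ => n :=
  ⟨Polynomial.X, fun n m => by simp⟩

theorem PolyBounded.right : PolyBounded fun _ m => m :=
  ⟨Polynomial.X, fun n m => by simp⟩

theorem PolyBounded.add {f g : ℕ → ℕ → ℕ} (hf : PolyBounded f) (hg : PolyBounded g) :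
    PolyBounded fun n m => f n m + g n m := by
  obtain ⟨p, hp⟩ := hf
  obtain ⟨q, hq⟩ := hg
  exact ⟨p + q, fun n m => by
    rw [Polynomial.eval_add]
    exact add_le_add (hp n m) (hq n m)⟩

theorem PolyBounded.mul {f g : ℕ → ℕ → ℕ} (hf : PolyBounded f) (hg : PolyBounded g) :
    PolyBounded fun n m => f n m * g n m := by
  obtain ⟨p, hp⟩ := hf
  obtain ⟨q, hq⟩ := hg
  exact ⟨p * q, fun n m => by
    rw [Polynomial.eval_mul]
    exact Nat.mul_le_mul (hp n m) (hq n m)⟩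

theorem PolyBounded.forSteps {f g : ℕ → ℕ → ℕ} (e : IExpr) (hf : PolyBounded f)
    (hg : PolyBounded g) : PolyBounded fun n m => forSteps e (f n m) (g n m) :=
  (const _).add ((hg.mul ((const _).add (hf.add (const _)))).add (const _))

open PolyBounded in
theorem polyBounded_loadsSteps : PolyBounded loadsSteps :=
  ((const _).forSteps nE left).add ((const _).forSteps mE right)

open PolyBounded in
theorem polyBounded_reachSteps : PolyBounded reachSteps :=
  (const _).add ((const _).add ((((left.mul ((left.mul right).add (const 1))).add
    (right.mul left)).mul (const _)).add (const _)))

open PolyBounded in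
theorem polyBounded_balanceSteps : PolyBounded balanceSteps := by
  have hbody : PolyBounded balanceBodySteps :=
    polyBounded_loadsSteps.add (((const _).forSteps nE left).add ((const _).add
      (polyBounded_reachSteps.add (((const _).add ((const _).forSteps nE left)).add ((const _).add
        (((const _).add ((left.mul (const _)).add (const _))).add (const 8)))))))
  exact (const _).add (((((left.mul (right.mul (left.mul right))).mul (left.add (const 1))).add
    left).mul ((const _).add hbody)).add (const _))

open PolyBounded in
theorem polyBounded_restoreSteps : PolyBounded restoreSteps :=
  ((const _).forSteps mE right).add (((const _).forSteps mE right).add ((const _).forSteps nE left))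

open PolyBounded in
theorem polyBounded_stageSteps : PolyBounded stageSteps := by
  have hraise : PolyBounded raiseSteps :=
    (const _).add (((const _).forSteps nE left).add (((const _).forSteps nE left).add
      (((const _).forSteps mE right).add (((const _).forSteps mE right).add (const _)))))
  have hcheck : PolyBounded checkSteps :=
    polyBounded_loadsSteps.add ((const _).add ((((const _).forSteps nE left).forSteps nE left)))
  exact polyBounded_restoreSteps.add (polyBounded_loadsSteps.add (((const _).forSteps nE left).add
    (polyBounded_reachSteps.add (hraise.add (polyBounded_balanceSteps.add
      (hcheck.add (const _)))))))

open PolyBounded in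
theorem polyBounded_programSteps : PolyBounded programSteps := by
  have hrange : PolyBounded rangeSteps :=
    (const _).add ((((const _).forSteps mE right).forSteps nE left))
  have heasy : PolyBounded easySteps :=
    ((((const _).add ((const _).forSteps mE right)).forSteps mE right).forSteps nE left)
  have howners : PolyBounded ownersSteps :=
    ((const _).add ((const _).forSteps nE left)).forSteps mE right
  exact (const _).add ((hrange.add (heasy.add (howners.add ((const _).add
    (polyBounded_restoreSteps.add (polyBounded_balanceSteps.add (((const _).forSteps mE right).add
      ((const _).add (((right.add (const 2)).mul ((const _).add polyBounded_stageSteps)).add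
        (const _)))))))))).add (const _))

/-! ### Bit lengths -/

theorem ratBits_comb_le {q₀ q₁ : ℚ} {B u v : ℕ} (h₀ : ratBits q₀ ≤ B) (h₁ : ratBits q₁ ≤ B)
    (hu : u ≤ B + 1) (hv : v ≤ B + 1) : ratBits (u * q₀ + v * q₁) ≤ 6 * B + 4 := by
  unfold ratBits at *
  have hn0 : q₀.num.natAbs ≤ 2 ^ B := (Nat.size_le.1 (by omega)).le
  have hn1 : q₁.num.natAbs ≤ 2 ^ B := (Nat.size_le.1 (by omega)).le
  have hd0 : q₀.den ≤ 2 ^ B := (Nat.size_le.1 (by omega)).le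
  have hd1 : q₁.den ≤ 2 ^ B := (Nat.size_le.1 (by omega)).le
  have hB : B + 1 ≤ 2 ^ B := Nat.lt_two_pow_self
  set r : ℚ := u * q₀ + v * q₁ with hr
  have hden : r.den ≤ q₀.den * q₁.den := by
    refine Nat.le_of_dvd (Nat.mul_pos q₀.pos q₁.pos) ?_
    refine (Rat.add_den_dvd _ _).trans (Nat.mul_dvd_mul ?_ ?_)
    · simpa using Rat.mul_den_dvd (u : ℚ) q₀
    · simpa using Rat.mul_den_dvd (v : ℚ) q₁
  have habs : ∀ q : ℚ, |q| ≤ q.num.natAbs := by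
    intro q
    have h1 : (1 : ℚ) ≤ q.den := by exact_mod_cast q.pos
    have h2 : |q| * q.den = q.num.natAbs := by
      rw [Nat.cast_natAbs, Int.cast_abs, ← Rat.mul_den_eq_num, abs_mul, Nat.abs_cast]
    nlinarith [abs_nonneg q]
  have hnum : (r.num.natAbs : ℚ) ≤
      ((u * q₀.num.natAbs + v * q₁.num.natAbs) * (q₀.den * q₁.den) : ℕ) := by
    have h1 : (r.num.natAbs : ℚ) = |r| * r.den := by
      rw [Nat.cast_natAbs, Int.cast_abs, ← Rat.mul_den_eq_num, abs_mul, Nat.abs_cast]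
    have h2 : |r| ≤ u * q₀.num.natAbs + v * q₁.num.natAbs := by
      refine (abs_add_le _ _).trans ?_
      rw [abs_mul, abs_mul, Nat.abs_cast, Nat.abs_cast]
      gcongr
      exacts [habs q₀, habs q₁]
    have h3 : (r.den : ℚ) ≤ (q₀.den * q₁.den : ℕ) := by exact_mod_cast hden
    rw [h1]
    push_cast at h3 ⊢
    gcongr
  have hnum' : r.num.natAbs ≤ (u * q₀.num.natAbs + v * q₁.num.natAbs) * (q₀.den * q₁.den) := by
    exact_mod_cast hnum
  have s1 : r.num.natAbs < 2 ^ (4 * B + 2) := by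
    calc r.num.natAbs ≤ (u * q₀.num.natAbs + v * q₁.num.natAbs) * (q₀.den * q₁.den) := hnum'
      _ ≤ (2 ^ B * 2 ^ B + 2 ^ B * 2 ^ B) * (2 ^ B * 2 ^ B) := by
          gcongr <;> omega
      _ = 2 ^ (4 * B + 1) := by ring
      _ < 2 ^ (4 * B + 2) := Nat.pow_lt_pow_right (by norm_num) (by omega)
  have s2 : r.den < 2 ^ (2 * B + 1) := by
    calc r.den ≤ q₀.den * q₁.den := hden
      _ ≤ 2 ^ B * 2 ^ B := Nat.mul_le_mul hd0 hd1
      _ = 2 ^ (2 * B) := by ring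
      _ < 2 ^ (2 * B + 1) := Nat.pow_lt_pow_right (by norm_num) (by omega)
  -- Numerator 4B + 2, denominator 2B + 1 and one bit for the sign add up to 6B + 4.
  have := Nat.size_le.2 s1
  have := Nat.size_le.2 s2
  omega

theorem ratBits_le_instBits (q : Fin n → Fin m → ℚ) (i : Fin n) (j : Fin m) :
    ratBits (q i j) ≤ instBits q := by
  have h1 : ratBits (q i j) ≤ ∑ j, ratBits (q i j) :=
    Finset.single_le_sum (f := fun j => ratBits (q i j)) (fun _ _ => Nat.zero_le _)
      (Finset.mem_univ j)
  have h2 : ∑ j, ratBits (q i j) ≤ ∑ i, ∑ j, ratBits (q i j) :=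
    Finset.single_le_sum (f := fun i => ∑ j, ratBits (q i j)) (fun _ _ => Nat.zero_le _)
      (Finset.mem_univ i)
  unfold instBits
  omega

theorem Good.ratBits_le {y : ℝ} (hy : Good lo hi m y) (hc : Bivalued c lo hi)
    {q : Fin n → Fin m → ℚ} (hq : ∀ i j, c i j = (q i j : ℝ)) :
    ∃ r : ℚ, y = (r : ℝ) ∧ ratBits r ≤ 6 * instBits q + 4 := by
  obtain ⟨u, v, hu, hv, rfl⟩ := hy
  obtain ⟨i, j, h₀⟩ := hc.lo
  obtain ⟨i', j', h₁⟩ := hc.hi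
  have hm : m ≤ instBits q := by unfold instBits; omega
  refine ⟨u * q i j + v * q i' j', ?_, ratBits_comb_le (ratBits_le_instBits q i j)
    (ratBits_le_instBits q i' j') (by omega) (by omega)⟩
  rw [← h₀, ← h₁, hq, hq]
  push_cast
  ring

/-- Minimum and maximum of the cost matrix. They coincide if only one value occurs, which the
argument permits; both being entries, they are rational for rational input. -/
theorem exists_bivalued {a b : ℝ} (hn : 0 < n) (hm : 0 < m) (ha : 0 < a) (hb : 0 < b)
    (hc : ∀ i j, c i j = a ∨ c i j = b) : ∃ lo hi, 0 < lo ∧ Bivalued c lo hi := by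
  have : Nonempty (Fin n × Fin m) := ⟨(⟨0, hn⟩, ⟨0, hm⟩)⟩
  obtain ⟨x, hx⟩ := Finite.exists_min fun x : Fin n × Fin m => c x.1 x.2
  obtain ⟨y, hy⟩ := Finite.exists_max fun x : Fin n × Fin m => c x.1 x.2
  refine ⟨c x.1 x.2, c y.1 y.2, ?_, hx y, fun i j => ?_, ⟨_, _, rfl⟩, ⟨_, _, rfl⟩⟩
  · rcases hc x.1 x.2 with h | h <;> rw [h] <;> assumption
  · have h1 := hx (i, j)
    have h2 := hy (i, j)
    have h3 := hc i j
    have h4 := hc x.1 x.2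
    have h5 := hc y.1 y.2
    grind

theorem outputBundles_eq {o : Fin m → Fin n} (h : Own 1 o s) :
    outputBundles n m s = bundles o := by
  funext i
  ext j
  have : s.idx (1, 0, j) = o j := h j
  simp [outputBundles, bundles, this, Fin.val_inj]

end

end BivaluedChores

open BivaluedChores in
/-- One program computes, for every bivalued instance of indivisible chores, an allocation that is
EF1 and fractionally Pareto-optimal, being supported by positive prices for which it is on minimum
bang-per-buck and price-EF1. It does so in strongly polynomial time: the number of steps is
polynomial in the numbers of agents and chores, and on rational input the numbers that arise are
rationals of bit length polynomial in the encoding length of the input. -/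
theorem theorem1 :
    ∃ (P : Prog) (T S : Polynomial ℕ), ∀ (n m : ℕ) (c : Fin n → Fin m → ℝ) (a b : ℝ),
      0 < n → 0 < a → 0 < b → (∀ i j, c i j = a ∨ c i j = b) →
      ∃ (t : ℕ) (L : List ℝ) (s : State), Exec P (inputState c) t L s ∧
        t ≤ T.eval (n + m) ∧
        (∀ q : Fin n → Fin m → ℚ, (∀ i j, c i j = (q i j : ℝ)) →
          ∀ y ∈ L, ∃ r : ℚ, y = (r : ℝ) ∧ ratBits r ≤ S.eval (instBits q)) ∧
        IsAllocation (outputBundles n m s) ∧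
        EF1 c (outputBundles n m s) ∧
        FPO c (outputBundles n m s) ∧
        ∃ p : Fin m → ℝ, (∀ j, 0 < p j) ∧
          OnMBB c (outputBundles n m s) p ∧ PEF1 (outputBundles n m s) p := by
  classical
  obtain ⟨T, hT⟩ := polyBounded_programSteps
  refine ⟨program, T, 6 * Polynomial.X + 4, ?_⟩
  intro n m c a b hn ha hb hc
  rcases Nat.eq_zero_or_pos m with rfl | hm
  -- Without chores no arithmetic on numbers takes place, so even the false property holds for all
  -- computed numbers.
  · have hrun : Spec (fun _ => False) program (inputState c) (programSteps n 0) fun _ => True := by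
      refine (Spec.branch (T := steps skip) (fun h => ?_)
        fun _ => spec_of_wp (by simp [wp])).mono ?_ fun _ h => h
      · simp [(input_inputState c).m] at h
      · unfold programSteps
        omega
    obtain ⟨t, L, s, hex, ht, hL, -⟩ := hrun
    refine ⟨t, L, s, hex, ht.trans (hT n 0), fun q _ y hy => (hL y hy).elim, fun j => j.elim0,
      fun i h => Or.inl (Finset.eq_empty_of_isEmpty _), ?_, fun j => j.elim0, fun j => j.elim0,
      fun i j => j.elim0, fun i h => Or.inl (Finset.eq_empty_of_isEmpty _)⟩
    rintro ⟨y, -, -, h, hlt⟩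
    rw [Finset.eq_empty_of_isEmpty (outputBundles n 0 s h)] at hlt
    simp at hlt
  · obtain ⟨lo, hi, hlo, hbi⟩ := exists_bivalued hn hm ha hb hc
    have hrun := (Spec.branch (b := onE mE) (R := skip) (fun _ => spec_solve hn hm hbi hlo)
      fun h => absurd (by simp [(input_inputState c).m]; omega) h)
    obtain ⟨t, L, s, hex, ht, hL, τ, C, o₀, o, h₀, hlayer, hstage, hown, hload⟩ := hrun
    have hcpos : ∀ i j, 0 < c i j := fun i j => by
      rcases hc i j with h | h <;> rw [h] <;> assumption
    let p : Fin m → ℝ := fun j => if j ∈ raised (hard c) o₀ C then hi else lo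
    have hpb : ∀ j ∈ raised (hard c) o₀ C, p j = hi := fun j hj => if_pos hj
    have hpa : ∀ j ∉ raised (hard c) o₀ C, p j = lo := fun j hj => if_neg hj
    have hp : ∀ j, 0 < p j := fun j => by
      by_cases hj : j ∈ raised (hard c) o₀ C
      · rw [hpb j hj]
        exact hlo.trans_le hbi.le
      · rw [hpa j hj]
        exact hlo
    have hmbb := hstage.onMBB hlo hbi.le hbi.cases h₀ hlayer hpb hpa
    have hpef := pef1_of_load_le hpb hpa hload
    refine ⟨t, L, s, hex, ?_, ?_, ?_⟩
    · refine le_trans ?_ (hT n m)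
      unfold programSteps
      omega
    · intro q hq y hy
      obtain ⟨r, hr, hbits⟩ := (hL y hy).ratBits_le hbi hq
      exact ⟨r, hr, by simpa using hbits⟩
    · rw [outputBundles_eq hown]
      exact ⟨isAllocation_bundles o, ef1_of_pef1 hcpos hp hmbb hpef, fpo_of_onMBB hcpos hp hmbb,
        p, hp, hmbb, hpef⟩
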